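/- **Proposition 3.6.** Let $\Omega=(0,1)^2\subset\mathbb R^2$, let $\alpha\in(0,1)$ and $F:=\begin{pmatrix}1&0\\0&1\end{pmatrix}$. For a displacement $u:\mathbb R^2\to\mathbb R^2$ with (distributional) symmetrized gradient $e(u)=\tfrac12(\nabla u+(\nabla u)^t)$, for $\chi\in BV(\Omega;\{0,1\})$ and for $\epsilon>0$ define $$\mathcal E_\epsilon(u,\chi):=\int_{[0,1]^2}\left|e(u)-\begin{pmatrix}1&0\\0&1+\alpha(1-2\chi)\end{pmatrix}\right|^2dx+\epsilon\int_{\Omega}|\nabla\chi| ,$$ where $|\cdot|$ is the Frobenius norm and $\int_{\Omega}|\nabla\chi|$ is the total variation of $\chi$ in the open square $\Omega$. Let $$\mathcal D_F:=\{E\in W^{2,1}_{loc}(\mathbb R^2;\mathbb R^{2\times2}):\ \operatorname{curl}\operatorname{curl}E=0\ \text{in }\mathbb R^2,\ E=F\ \text{a.e. in }\mathbb R^2\setminus\overline\Omega\},$$ where $\operatorname{curl}\operatorname{curl}E=\partial_1^2E_{22}-\partial_1\partial_2(E_{12}+E_{21})+\partial_2^2E_{11}$ in the sense of distributions. Then there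 are constants $\epsilon_0>0$, $c>0$ and $C>0$, depending only on $\alpha$, such that for all $\epsilon\in(0,\epsilon_0)$ $$c\,\epsilon^{4/5}\ \le\ \inf_{\chi\in BV(\Omega;\{0,1\})}\ \inf_{u:\ e(u)\in\mathcal D_F}\ \mathcal E_\epsilon(u,\chi)\ \le\ C\,\epsilon^{4/5}.$$ Here the inner infimum is over all $u\in L^1_{loc}(\mathbb R^2;\mathbb R^2)$ with $e(u)\in\mathcal D_F$. -/

import Mathlib

open MeasureTheory
open scoped ENNReal ContDiff

namespace SymGradTwoWell

noncomputable section

/-- The plane with its Euclidean norm and Lebesgue measure. The coordinates `x₁, x₂` have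
indices `0, 1`. -/
abbrev Plane : Type := EuclideanSpace ℝ (Fin 2)

/-- The matrices `ℝ^{2×2}`. -/
abbrev Mat2 : Type := Matrix (Fin 2) (Fin 2) ℝ

/-- The classical partial derivative `∂ᵢ φ`. -/
def pderiv (i : Fin 2) (φ : Plane → ℝ) (x : Plane) : ℝ :=
  fderiv ℝ φ x (EuclideanSpace.single i 1)

/-- Test functions `φ ∈ C_c^∞(ℝ²)`. -/
def IsTest (φ : Plane → ℝ) : Prop := ContDiff ℝ ∞ φ ∧ HasCompactSupport φ

/-- `g ∈ L¹_loc(ℝ²)` is the weak partial derivative `∂ᵢ f` of `f ∈ L¹_loc(ℝ²)`. -/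
def HasWeakPDeriv (i : Fin 2) (f g : Plane → ℝ) : Prop :=
  LocallyIntegrable f ∧ LocallyIntegrable g ∧
    ∀ φ : Plane → ℝ, IsTest φ → ∫ x, f x * pderiv i φ x = -∫ x, g x * φ x

/-- `f ∈ W^{k,1}_loc(ℝ²)`: all weak derivatives of order at most `k` exist and are locally
integrable. -/
def MemWLoc : ℕ → (Plane → ℝ) → Prop
  | 0, f => LocallyIntegrable f
  | k + 1, f => LocallyIntegrable f ∧ ∀ i, ∃ g, HasWeakPDeriv i f g ∧ MemWLoc k g

/-- `curl curl E = ∂₁²E₂₂ - ∂₁∂₂(E₁₂ + E₂₁) + ∂₂²E₁₁ = 0` in `ℝ²` in the sense of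
distributions. The symbol of this operator is `ξ × (ξ × M)ᵗ`. -/
def CurlCurlFree (E : Plane → Mat2) : Prop :=
  ∀ φ : Plane → ℝ, IsTest φ →
    ∫ x, (E x 1 1 * pderiv 0 (pderiv 0 φ) x
        - (E x 0 1 + E x 1 0) * pderiv 0 (pderiv 1 φ) x
        + E x 0 0 * pderiv 1 (pderiv 1 φ) x) = 0

/-- The admissible fields `𝒟_F` for the second order operator `curl curl`: the fields
`E ∈ W^{2,1}_loc(ℝ²; ℝ^{2×2})` with `curl curl E = 0` in `ℝ²` and `E = F` in `ℝ² ∖ closure Ω`. -/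
def Admissible (Ω : Set Plane) (F : Mat2) : Set (Plane → Mat2) :=
  {E | (∀ i j, MemWLoc 2 (fun x => E x i j)) ∧ CurlCurlFree E ∧
    ∀ᵐ x : Plane, x ∉ closure Ω → E x = F}

/-- `E = e(u) = (∇u + (∇u)ᵗ) / 2` in the sense of distributions, with `u` and `E` locally
integrable in `ℝ²`. -/
def IsSymGrad (u : Plane → Plane) (E : Plane → Mat2) : Prop :=
  (∀ i, LocallyIntegrable fun x => u x i) ∧ (∀ i j, LocallyIntegrable fun x => E x i j) ∧
    ∀ i j, ∀ φ : Plane → ℝ, IsTest φ →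
      ∫ x, (u x i * pderiv j φ x + u x j * pderiv i φ x) / 2 = -∫ x, E x i j * φ x

/-- The classical divergence of a vector field. -/
def divergence (Φ : Plane → Plane) (x : Plane) : ℝ := ∑ i, pderiv i (fun y => Φ y i) x

/-- The total variation `∫_Ω |∇f|`, i.e. the supremum of `∫_Ω f div Φ` over all
`Φ ∈ C_c^1(Ω; ℝ²)` with `|Φ| ≤ 1`. -/
def totalVariation (Ω : Set Plane) (f : Plane → ℝ) : ℝ≥0∞ :=
  ⨆ (Φ : Plane → Plane) (_ : ContDiff ℝ 1 Φ ∧ HasCompactSupport Φ ∧ tsupport Φ ⊆ Ω ∧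
    ∀ x, ‖Φ x‖ ≤ 1), ENNReal.ofReal (∫ x in Ω, f x * divergence Φ x)

/-- The phase indicators `χ ∈ BV(Ω; {0,1})`. -/
def PhaseIndicators (Ω : Set Plane) : Set (Plane → ℝ) :=
  {χ | IntegrableOn χ Ω ∧ totalVariation Ω χ < ⊤ ∧
    ∀ᵐ x ∂volume.restrict Ω, χ x = 0 ∨ χ x = 1}

/-- The strain `diag(1, 1 + α (1 - 2 s))` preferred by the phase `s ∈ {0,1}`. -/
def well (α s : ℝ) : Mat2 := !![1, 0; 0, 1 + α * (1 - 2 * s)]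

/-- The square of the Frobenius norm. -/
def frobSq (M : Mat2) : ℝ := ∑ i, ∑ j, M i j ^ 2

/-- The elastic energy as a function of the strain `E = e(u)` and of `χ`. -/
def elasticEnergy (Ω : Set Plane) (α : ℝ) (E : Plane → Mat2) (χ : Plane → ℝ) : ℝ≥0∞ :=
  ∫⁻ x in Ω, ENNReal.ofReal (frobSq (E x - well α (χ x)))

/-- The total energy, elastic energy plus `ε` times surface energy. -/
def energy (Ω : Set Plane) (α ε : ℝ) (E : Plane → Mat2) (χ : Plane → ℝ) : ℝ≥0∞ :=
  elasticEnergy Ω α E χ + ENNReal.ofReal ε * totalVariation Ω χ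

/-- The open unit square. Its closure is `[0,1]²`, and the boundary is a null set. -/
def unitSquare : Set Plane := {x | ∀ i, 0 < x i ∧ x i < 1}

/-- The infimum of the energy over all `χ ∈ BV(Ω; {0,1})` and all displacements `u` whose
symmetrized gradient lies in `𝒟_F`. -/
def minEnergy (Ω : Set Plane) (F : Mat2) (α ε : ℝ) : ℝ≥0∞ :=
  ⨅ (χ ∈ PhaseIndicators Ω) (u : Plane → Plane) (E : Plane → Mat2)
    (_ : IsSymGrad u E) (_ : E ∈ Admissible Ω F), energy Ω α ε E χ

end

end SymGradTwoWell

namespace SymGradTwoWell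

open Real (smoothTransition)

/-! ### Partial derivatives of smooth functions -/

theorem contDiff_pderiv {f : Plane → ℝ} (hf : ContDiff ℝ ∞ f) (i : Fin 2) :
    ContDiff ℝ ∞ (pderiv i f) :=
  (hf.fderiv_right (m := ∞) (by simp)).clm_apply contDiff_const

theorem hasCompactSupport_pderiv {f : Plane → ℝ} (hf : HasCompactSupport f) (i : Fin 2) :
    HasCompactSupport (pderiv i f) :=
  (hf.fderiv_apply (𝕜 := ℝ) _)

theorem IsTest.pderiv {f : Plane → ℝ} (hf : IsTest f) (i : Fin 2) : IsTest (pderiv i f) :=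
  ⟨contDiff_pderiv hf.1 i, hasCompactSupport_pderiv hf.2 i⟩

theorem contDiff_differentiable {f : Plane → ℝ} (hf : ContDiff ℝ ∞ f) : Differentiable ℝ f :=
  hf.differentiable (by simp)

theorem IsTest.integrable {f : Plane → ℝ} (hf : IsTest f) : Integrable f :=
  hf.1.continuous.integrable_of_hasCompactSupport hf.2

theorem IsTest.mul_left {f g : Plane → ℝ} (hf : ContDiff ℝ ∞ f) (hg : IsTest g) :
    IsTest (fun x => f x * g x) :=
  ⟨hf.mul hg.1, hg.2.mul_left⟩

theorem IsTest.sub {f g : Plane → ℝ} (hf : IsTest f) (hg : IsTest g) :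
    IsTest (fun x => f x - g x) :=
  ⟨hf.1.sub hg.1, hf.2.sub hg.2⟩

theorem IsTest.const_mul {f : Plane → ℝ} (c : ℝ) (hf : IsTest f) : IsTest (fun x => c * f x) :=
  IsTest.mul_left contDiff_const hf

/-- Integration by parts. -/
theorem integral_mul_pderiv {f φ : Plane → ℝ} (hf : ContDiff ℝ ∞ f) (hφ : IsTest φ) (i : Fin 2) :
    ∫ x, f x * pderiv i φ x = -∫ x, pderiv i f x * φ x :=
  integral_mul_fderiv_eq_neg_fderiv_mul_of_integrable
    (IsTest.mul_left (contDiff_pderiv hf i) hφ).integrable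
    (IsTest.mul_left hf (hφ.pderiv i)).integrable (IsTest.mul_left hf hφ).integrable
    (fun x _ => contDiff_differentiable hf x) (fun x _ => contDiff_differentiable hφ.1 x)

theorem integral_pderiv {φ : Plane → ℝ} (hφ : IsTest φ) (i : Fin 2) :
    ∫ x, pderiv i φ x = 0 := by
  have h := integral_mul_pderiv (f := fun _ => 1) contDiff_const hφ i
  simpa [pderiv] using h

theorem pderiv_comm {f : Plane → ℝ} (hf : ContDiff ℝ ∞ f) (i j : Fin 2) :
    pderiv i (pderiv j f) = pderiv j (pderiv i f) := by
  have hd : Differentiable ℝ (fderiv ℝ f) :=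
    (hf.fderiv_right (m := ∞) (by simp)).differentiable (by simp)
  have key : ∀ (k l : Fin 2) (x : Plane), pderiv k (pderiv l f) x =
      fderiv ℝ (fderiv ℝ f) x (EuclideanSpace.single k 1) (EuclideanSpace.single l 1) := by
    intro k l x
    unfold pderiv
    rw [fderiv_clm_apply (hd x) (differentiableAt_const _)]
    simp
  funext x
  rw [key, key]
  have h : IsSymmSndFDerivAt ℝ f x :=
    (hf.contDiffAt).isSymmSndFDerivAt (by
      rw [minSmoothness_of_isRCLikeNormedField]; exact WithTop.coe_le_coe.2 (le_top : (2 : ℕ∞) ≤ ⊤))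
  exact h _ _

theorem pderiv_add {f g : Plane → ℝ} (hf : ContDiff ℝ ∞ f) (hg : ContDiff ℝ ∞ g) (i : Fin 2)
    (x : Plane) : pderiv i (fun y => f y + g y) x = pderiv i f x + pderiv i g x := by
  simp [pderiv, fderiv_fun_add (contDiff_differentiable hf x) (contDiff_differentiable hg x)]

theorem pderiv_sub {f g : Plane → ℝ} (hf : ContDiff ℝ ∞ f) (hg : ContDiff ℝ ∞ g) (i : Fin 2)
    (x : Plane) : pderiv i (fun y => f y - g y) x = pderiv i f x - pderiv i g x := by
  simp [pderiv, fderiv_fun_sub (contDiff_differentiable hf x) (contDiff_differentiable hg x)]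

theorem pderiv_const_mul {f : Plane → ℝ} (hf : ContDiff ℝ ∞ f) (c : ℝ) (i : Fin 2)
    (x : Plane) : pderiv i (fun y => c * f y) x = c * pderiv i f x := by
  simp [pderiv, fderiv_const_mul (contDiff_differentiable hf x)]

/-! ### Averages along segments -/

/-- A parametric integral over `[0, 1]` of a smooth function is differentiable. -/
theorem hasFDerivAt_integral_unit {E G : Type} [NormedAddCommGroup E] [NormedSpace ℝ E]
    [NormedAddCommGroup G] [NormedSpace ℝ G] [FiniteDimensional ℝ E]
    {F : E → ℝ → G} (hF : ContDiff ℝ 1 (Function.uncurry F)) (x : E) :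
    HasFDerivAt (fun y => ∫ s in (0 : ℝ)..1, F y s)
      (∫ s in (0 : ℝ)..1, fderiv ℝ (fun y => F y s) x) x := by
  have hcF : Continuous (Function.uncurry F) := hF.continuous
  have hslice : ∀ y s, fderiv ℝ (fun y => F y s) y =
      (fderiv ℝ (Function.uncurry F) (y, s)).comp (ContinuousLinearMap.inl ℝ E ℝ) := by
    intro y s
    have h1 : HasFDerivAt (fun y : E => (y, s)) (ContinuousLinearMap.inl ℝ E ℝ) y :=
      hasFDerivAt_prodMk_left (𝕜 := ℝ) y s
    have h2 : HasFDerivAt (Function.uncurry F) (fderiv ℝ (Function.uncurry F) (y, s)) (y, s) :=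
      ((hF.differentiable (by simp)) (y, s)).hasFDerivAt
    exact (h2.comp y h1).fderiv
  have hcF' : Continuous (fun p : E × ℝ => fderiv ℝ (fun y => F y p.2) p.1) := by
    simp_rw [hslice]
    exact (hF.continuous_fderiv one_ne_zero).clm_comp continuous_const
  have : ProperSpace E := FiniteDimensional.proper ℝ E
  obtain ⟨C, hC⟩ := ((isCompact_closedBall x 1).prod (isCompact_Icc (a := (0 : ℝ)) (b := 1))
    ).exists_bound_of_continuousOn hcF'.continuousOn
  refine intervalIntegral.hasFDerivAt_integral_of_dominated_of_fderiv_le (𝕜 := ℝ)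
    (F := F) (F' := fun x s => fderiv ℝ (fun y => F y s) x) (bound := fun _ => C)
    (s := Metric.closedBall x 1) (Metric.closedBall_mem_nhds x one_pos) ?_ ?_ ?_ ?_ ?_ ?_
  · refine Filter.Eventually.of_forall fun y => Continuous.aestronglyMeasurable ?_
    exact hcF.comp (by fun_prop : Continuous fun s : ℝ => (y, s))
  · exact (hcF.comp (by fun_prop : Continuous fun s : ℝ => (x, s))).intervalIntegrable _ _
  · exact (hcF'.comp (by fun_prop : Continuous fun s : ℝ => (x, s))).aestronglyMeasurable
  · refine Filter.Eventually.of_forall fun s hs y hy => hC (y, s) ⟨hy, ?_⟩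
    rw [Set.uIoc_of_le zero_le_one] at hs
    exact ⟨hs.1.le, hs.2⟩
  · exact intervalIntegrable_const
  · refine Filter.Eventually.of_forall fun s _ y _ => ?_
    have : Differentiable ℝ (fun y => F y s) :=
      (hF.differentiable (by simp)).comp (by fun_prop : Differentiable ℝ fun y : E => (y, s))
    exact (this y).hasFDerivAt

theorem contDiff_integral_unit_nat {E : Type} [NormedAddCommGroup E] [NormedSpace ℝ E]
    [FiniteDimensional ℝ E] (n : ℕ) :
    ∀ {G : Type} [NormedAddCommGroup G] [NormedSpace ℝ G] {F : E → ℝ → G},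
      ContDiff ℝ ∞ (Function.uncurry F) →
      ContDiff ℝ n (fun y => ∫ s in (0 : ℝ)..1, F y s) := by
  induction n with
  | zero =>
    intro G _ _ F hF
    rw [Nat.cast_zero, contDiff_zero]
    exact continuous_iff_continuousAt.2 fun x =>
      (hasFDerivAt_integral_unit (hF.of_le (by simp)) x).continuousAt
  | succ n ih =>
    intro G _ _ F hF
    push_cast
    rw [contDiff_succ_iff_fderiv]
    refine ⟨fun x => (hasFDerivAt_integral_unit (hF.of_le (by simp)) x).differentiableAt,
      by simp, ?_⟩
    have : fderiv ℝ (fun y => ∫ s in (0 : ℝ)..1, F y s) =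
        fun x => ∫ s in (0 : ℝ)..1, fderiv ℝ (fun y => F y s) x :=
      funext fun x => (hasFDerivAt_integral_unit (hF.of_le (by simp)) x).fderiv
    rw [this]
    refine ih (F := fun x s => fderiv ℝ (fun y => F y s) x) ?_
    have hF' : ContDiff ℝ ∞ (Function.uncurry fun (p : E × ℝ) (y : E) => F y p.2) :=
      hF.comp (by fun_prop : ContDiff ℝ ∞ fun q : (E × ℝ) × E => (q.2, q.1.2))
    exact hF'.fderiv (m := ∞) contDiff_fst (by simp)

theorem contDiff_integral_unit {E G : Type} [NormedAddCommGroup E] [NormedSpace ℝ E]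
    [FiniteDimensional ℝ E] [NormedAddCommGroup G] [NormedSpace ℝ G] {F : E → ℝ → G}
    (hF : ContDiff ℝ ∞ (Function.uncurry F)) :
    ContDiff ℝ ∞ (fun y => ∫ s in (0 : ℝ)..1, F y s) :=
  contDiff_infty.2 fun n => contDiff_integral_unit_nat n hF

/-- The weighted average of `G` along the segment from `x` to `x - t eᵢ`. -/
noncomputable def segAvg (c : ℝ → ℝ) (i : Fin 2) (t : ℝ) (G : Plane → ℝ) (x : Plane) : ℝ :=
  ∫ s in (0 : ℝ)..1, c s * G (x - (s * t) • EuclideanSpace.single i 1)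

section segAvg

variable {c : ℝ → ℝ} {i : Fin 2} {t : ℝ} {G : Plane → ℝ}

theorem contDiff_segAvg_integrand (hc : ContDiff ℝ ∞ c) (hG : ContDiff ℝ ∞ G) :
    ContDiff ℝ ∞ (Function.uncurry fun (x : Plane) (s : ℝ) =>
      c s * G (x - (s * t) • EuclideanSpace.single i 1)) := by
  unfold Function.uncurry
  fun_prop

theorem contDiff_segAvg (hc : ContDiff ℝ ∞ c) (hG : ContDiff ℝ ∞ G) :
    ContDiff ℝ ∞ (segAvg c i t G) :=
  contDiff_integral_unit (contDiff_segAvg_integrand hc hG)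

theorem pderiv_segAvg (hc : ContDiff ℝ ∞ c) (hG : ContDiff ℝ ∞ G) (k : Fin 2) :
    pderiv k (segAvg c i t G) = segAvg c i t (pderiv k G) := by
  funext x
  have h := hasFDerivAt_integral_unit ((contDiff_segAvg_integrand (i := i) (t := t) hc hG).of_le
    (by simp)) x
  have e : ∀ s, fderiv ℝ (fun y => c s * G (y - (s * t) • EuclideanSpace.single i 1)) x =
      c s • fderiv ℝ G (x - (s * t) • EuclideanSpace.single i 1) := by
    intro s
    rw [fderiv_const_mul, fderiv_comp_sub]
    exact (contDiff_differentiable hG).differentiableAt.comp x (by fun_prop)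
  unfold pderiv
  rw [show segAvg c i t G = fun y => ∫ s in (0 : ℝ)..1,
    c s * G (y - (s * t) • EuclideanSpace.single i 1) from rfl, h.fderiv]
  simp_rw [e]
  rw [ContinuousLinearMap.intervalIntegral_apply]
  · rfl
  · refine Continuous.intervalIntegrable ?_ _ _
    exact hc.continuous.smul ((hG.continuous_fderiv (by simp)).comp (by fun_prop))

theorem abs_segAvg_le {B : ℝ} (hc : ∀ s ∈ Set.Icc (0 : ℝ) 1, |c s| ≤ 1) (x : Plane)
    (hG : ∀ s ∈ Set.Icc (0 : ℝ) 1, |G (x - (s * t) • EuclideanSpace.single i 1)| ≤ B) :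
    |segAvg c i t G x| ≤ B := by
  have h := intervalIntegral.norm_integral_le_of_norm_le_const (a := (0 : ℝ)) (b := 1) (C := B)
    (f := fun s => c s * G (x - (s * t) • EuclideanSpace.single i 1)) (by
      intro s hs
      rw [Set.uIoc_of_le zero_le_one] at hs
      have hs' : s ∈ Set.Icc (0 : ℝ) 1 := ⟨hs.1.le, hs.2⟩
      rw [Real.norm_eq_abs, abs_mul]
      have := mul_le_mul (hc s hs') (hG s hs') (abs_nonneg _) zero_le_one
      simpa using this)
  simpa [segAvg] using h

theorem segAvg_eq_zero (x : Plane)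
    (hG : ∀ s ∈ Set.Icc (0 : ℝ) 1, G (x - (s * t) • EuclideanSpace.single i 1) = 0) :
    segAvg c i t G x = 0 := by
  unfold segAvg
  rw [intervalIntegral.integral_congr (g := fun _ => 0)]
  · simp
  · intro s hs
    rw [Set.uIcc_of_le zero_le_one] at hs
    simp [hG s hs]

theorem hasDerivAt_segment (hG : ContDiff ℝ ∞ G) (x : Plane) (s : ℝ) :
    HasDerivAt (fun s : ℝ => G (x - (s * t) • EuclideanSpace.single i 1))
      (-(t * pderiv i G (x - (s * t) • EuclideanSpace.single i 1))) s := by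
  have h1 : HasDerivAt (fun s : ℝ => x - (s * t) • (EuclideanSpace.single i 1 : Plane))
      (-(t • (EuclideanSpace.single i 1 : Plane))) s := by
    have := (((hasDerivAt_id s).mul_const t).smul_const
      (EuclideanSpace.single i 1 : Plane)).const_sub x
    simpa using this
  have := ((contDiff_differentiable hG) _).hasFDerivAt.comp_hasDerivAt s h1
  simpa [pderiv, Function.comp_def] using this

/-- The derivative of the average along the direction of averaging is a difference quotient. -/
theorem mul_segAvg_one_pderiv (hG : ContDiff ℝ ∞ G) (x : Plane) :
    t * segAvg (fun _ => 1) i t (pderiv i G) x =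
      G x - G (x - t • EuclideanSpace.single i 1) := by
  have h := intervalIntegral.integral_eq_sub_of_hasDerivAt (a := (0 : ℝ)) (b := 1)
    (fun s _ => hasDerivAt_segment (i := i) (t := t) hG x s)
    (Continuous.intervalIntegrable (by
      have := (contDiff_pderiv hG i).continuous
      fun_prop) _ _)
  rw [intervalIntegral.integral_neg, intervalIntegral.integral_const_mul] at h
  simp only [one_mul, zero_mul, zero_smul, sub_zero] at h
  simp only [segAvg, one_mul]
  linarith

/-- The difference between a function and its average is a derivative. -/
theorem sub_segAvg_one (hG : ContDiff ℝ ∞ G) (x : Plane) :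
    G x - segAvg (fun _ => 1) i t G x =
      t * segAvg (fun s => 1 - s) i t (pderiv i G) x := by
  have h := intervalIntegral.integral_mul_deriv_eq_deriv_mul (a := (0 : ℝ)) (b := 1)
    (u := fun s => 1 - s) (u' := fun _ => -1)
    (fun s _ => by simpa using (hasDerivAt_id s).const_sub 1)
    (fun s _ => hasDerivAt_segment (i := i) (t := t) hG x s)
    intervalIntegrable_const
    (Continuous.intervalIntegrable (by
      have := (contDiff_pderiv hG i).continuous
      fun_prop) _ _)
  simp only [sub_self, zero_mul, sub_zero, zero_smul, one_mul, zero_sub, neg_mul,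
    intervalIntegral.integral_neg, sub_neg_eq_add] at h
  simp only [segAvg, one_mul]
  rw [← intervalIntegral.integral_const_mul]
  have e : ∫ s in (0 : ℝ)..1, t * ((1 - s) * pderiv i G (x - (s * t) • EuclideanSpace.single i 1))
      = -∫ s in (0 : ℝ)..1, (1 - s) *
        -(t * pderiv i G (x - (s * t) • EuclideanSpace.single i 1)) := by
    rw [← intervalIntegral.integral_neg]
    congr 1
    funext s
    ring
  rw [e, h]
  ring

end segAvg

/-! ### The plane as a product -/

/-- The plane as the product of its coordinate axes. -/
noncomputable def planeEquiv : Plane ≃ᵐ ℝ × ℝ :=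
  (MeasurableEquiv.toLp 2 (Fin 2 → ℝ)).symm.trans MeasurableEquiv.finTwoArrow

theorem measurePreserving_planeEquiv : MeasurePreserving planeEquiv volume volume :=
  (EuclideanSpace.volume_preserving_symm_measurableEquiv_toLp (Fin 2)).trans
    (volume_preserving_finTwoArrow ℝ)

/-- The points with coordinates in given sets. -/
def box (I J : Set ℝ) : Set Plane := {x | x 0 ∈ I ∧ x 1 ∈ J}

theorem box_eq_preimage (I J : Set ℝ) : box I J = planeEquiv ⁻¹' (I ×ˢ J) := rfl

theorem volume_box (I J : Set ℝ) : volume (box I J) = volume I * volume J := by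
  rw [box_eq_preimage, measurePreserving_planeEquiv.measure_preimage_equiv, Measure.volume_eq_prod,
    Measure.prod_prod]

theorem measurableSet_box {I J : Set ℝ} (hI : MeasurableSet I) (hJ : MeasurableSet J) :
    MeasurableSet (box I J) :=
  planeEquiv.measurable (hI.prod hJ)

theorem continuous_coord (i : Fin 2) : Continuous fun x : Plane => x i := by fun_prop

theorem isCompact_box {a b c d : ℝ} : IsCompact (box (Set.Icc a b) (Set.Icc c d)) := by
  have h : IsCompact ((EuclideanSpace.equiv (Fin 2) ℝ).symm ''
      Set.Icc ![a, c] ![b, d]) :=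
    isCompact_Icc.image (EuclideanSpace.equiv (Fin 2) ℝ).symm.continuous
  refine h.of_isClosed_subset ?_ ?_
  · exact ((isClosed_Icc.preimage (continuous_coord 0)).inter
      (isClosed_Icc.preimage (continuous_coord 1)))
  · rintro x ⟨h0, h1⟩
    refine ⟨EuclideanSpace.equiv (Fin 2) ℝ x, ?_, by simp⟩
    constructor <;> intro i <;> fin_cases i
    · exact h0.1
    · exact h1.1
    · exact h0.2
    · exact h1.2

theorem unitSquare_eq_box : unitSquare = box (Set.Ioo 0 1) (Set.Ioo 0 1) := by
  ext x
  simp [unitSquare, box, Fin.forall_fin_two]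

theorem measurableSet_unitSquare : MeasurableSet unitSquare :=
  unitSquare_eq_box ▸ measurableSet_box measurableSet_Ioo measurableSet_Ioo

theorem isOpen_unitSquare : IsOpen unitSquare := by
  rw [unitSquare_eq_box]
  exact (isOpen_Ioo.preimage (continuous_coord 0)).inter (isOpen_Ioo.preimage (continuous_coord 1))

theorem volume_unitSquare : volume unitSquare = 1 := by
  rw [unitSquare_eq_box, volume_box]; simp

instance : IsFiniteMeasure (volume.restrict unitSquare) :=
  ⟨by rw [Measure.restrict_apply_univ, volume_unitSquare]; exact ENNReal.one_lt_top⟩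

theorem convex_unitSquare : Convex ℝ unitSquare := by
  intro x hx y hy a b ha hb hab i
  have h := (convex_Ioo (0 : ℝ) 1) (hx i) (hy i) ha hb hab
  exact h

theorem ae_closure_unitSquare : ∀ᵐ x : Plane, x ∈ closure unitSquare → x ∈ unitSquare := by
  have h := convex_unitSquare.addHaar_frontier volume
  rw [isOpen_unitSquare.frontier_eq, measure_eq_zero_iff_ae_notMem] at h
  filter_upwards [h] with x hx h1
  by_contra h2
  exact hx ⟨h1, h2⟩

/-! ### The total variation as a bound for integrals of derivatives -/

/-- The vector field with a single component. -/
noncomputable def axisField (i : Fin 2) (ψ : Plane → ℝ) (x : Plane) : Plane :=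
  EuclideanSpace.single i (ψ x)

theorem divergence_axisField (i : Fin 2) (ψ : Plane → ℝ) :
    divergence (axisField i ψ) = pderiv i ψ := by
  funext x
  have h : ∀ k, pderiv k (fun y => axisField i ψ y k) x = if k = i then pderiv i ψ x else 0 := by
    intro k
    by_cases hk : k = i
    · subst hk
      simp [axisField]
    · simp [axisField, hk, pderiv]
  simp [divergence, h]

theorem contDiff_axisField {n : ℕ∞} {i : Fin 2} {ψ : Plane → ℝ} (h : ContDiff ℝ n ψ) :
    ContDiff ℝ n (axisField i ψ) := by
  have e : axisField i ψ = fun x => ψ x • (EuclideanSpace.single i 1 : Plane) := by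
    funext x
    ext k
    simp [axisField]
  rw [e]
  exact h.smul contDiff_const

theorem integral_mul_pderiv_le {Ω : Set Plane} {f ψ : Plane → ℝ} (hf : totalVariation Ω f < ⊤)
    (hψ : IsTest ψ) (hs : tsupport ψ ⊆ Ω) {B : ℝ} (hB : 0 < B) (hb : ∀ x, |ψ x| ≤ B) (i : Fin 2) :
    ∫ x in Ω, f x * pderiv i ψ x ≤ B * (totalVariation Ω f).toReal := by
  have hsupp : Function.support (axisField i fun x => B⁻¹ * ψ x) ⊆ Function.support ψ := by
    intro x hx h0
    apply hx
    simp [axisField, h0]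
  have hadm : ContDiff ℝ 1 (axisField i fun x => B⁻¹ * ψ x) ∧
      HasCompactSupport (axisField i fun x => B⁻¹ * ψ x) ∧
      tsupport (axisField i fun x => B⁻¹ * ψ x) ⊆ Ω ∧
      ∀ x, ‖axisField i (fun x => B⁻¹ * ψ x) x‖ ≤ 1 := by
    refine ⟨contDiff_axisField (n := 1) ((hψ.const_mul _).1.of_le (by simp)),
      hψ.2.mono' (hsupp.trans (subset_tsupport _)), (closure_mono hsupp).trans hs, fun x => ?_⟩
    rw [axisField, PiLp.norm_single, Real.norm_eq_abs, abs_mul, abs_inv, abs_of_pos hB,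
      inv_mul_le_one₀ hB]
    exact hb x
  have h1 : ENNReal.ofReal (∫ x in Ω, f x * divergence (axisField i fun x => B⁻¹ * ψ x) x) ≤
      totalVariation Ω f := by
    unfold totalVariation
    exact le_iSup₂_of_le _ hadm le_rfl
  have h2 : ∫ x in Ω, f x * divergence (axisField i fun x => B⁻¹ * ψ x) x =
      B⁻¹ * ∫ x in Ω, f x * pderiv i ψ x := by
    rw [divergence_axisField, ← integral_const_mul]
    congr 1
    funext x
    rw [pderiv_const_mul hψ.1]
    ring
  rw [h2] at h1
  have h3 := (ENNReal.ofReal_le_iff_le_toReal hf.ne).1 h1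
  rwa [inv_mul_le_iff₀ hB] at h3

theorem tsupport_subset_of_forall_eq_zero {f : Plane → ℝ} {K : Set Plane} (hK : IsCompact K)
    (h : ∀ x ∉ K, f x = 0) : tsupport f ⊆ K :=
  closure_minimal (fun x hx => by_contra fun hn => hx (h x hn)) hK.isClosed

/-- If `σ = 1 - 2χ`, the integral of `σ` against the difference of a test function and its
average over segments of length `t` is controlled by `t` times the variation of `χ`. -/
theorem integral_sub_segAvg_le {Ω K : Set Plane} {χ G : Plane → ℝ} (hχ : IntegrableOn χ Ω)
    (hΩ : volume Ω < ⊤) (htv : totalVariation Ω χ < ⊤) (hG : ContDiff ℝ ∞ G)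
    (hG1 : ∀ x, |G x| ≤ 1) (hK : IsCompact K) (hKΩ : K ⊆ Ω) {t : ℝ} (ht : 0 < t) (i : Fin 2)
    (h0 : ∀ x ∉ K, ∀ s ∈ Set.Icc (0 : ℝ) 1, G (x - (s * t) • EuclideanSpace.single i 1) = 0) :
    ∫ x in Ω, (1 - 2 * χ x) * (G x - segAvg (fun _ => 1) i t G x) ≤
      2 * (t * (totalVariation Ω χ).toReal) := by
  set ψ : Plane → ℝ := fun x => -t * segAvg (fun s => 1 - s) i t G x with hψdef
  have hcs : ContDiff ℝ ∞ fun s : ℝ => 1 - s := by fun_prop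
  have hψ0 : ∀ x ∉ K, ψ x = 0 := fun x hx => by
    rw [hψdef]
    simp only [segAvg_eq_zero (c := fun s => 1 - s) x (h0 x hx), mul_zero]
  have hψ : IsTest ψ := ⟨contDiff_const.mul (contDiff_segAvg hcs hG),
    HasCompactSupport.intro hK hψ0⟩
  have hsupp : tsupport ψ ⊆ Ω := (tsupport_subset_of_forall_eq_zero hK hψ0).trans hKΩ
  have hb : ∀ x, |ψ x| ≤ t := by
    intro x
    rw [hψdef]
    simp only [abs_mul, abs_neg, abs_of_pos ht]
    refine mul_le_of_le_one_right ht.le (abs_segAvg_le (fun s hs => ?_) x fun s _ => hG1 _)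
    rw [abs_le]
    constructor <;> linarith [hs.1, hs.2]
  have hpd : ∀ x, G x - segAvg (fun _ => 1) i t G x = -pderiv i ψ x := by
    intro x
    rw [sub_segAvg_one hG, ← pderiv_segAvg hcs hG, hψdef,
      pderiv_const_mul (contDiff_segAvg hcs hG)]
    ring
  have hint : ∫ x in Ω, pderiv i ψ x = 0 := by
    rw [setIntegral_eq_integral_of_forall_compl_eq_zero, integral_pderiv hψ]
    intro x hx
    by_contra hne
    exact hx (hsupp (tsupport_fderiv_apply_subset ℝ _ (subset_tsupport _ hne)))
  have hcont : Continuous (pderiv i ψ) := (contDiff_pderiv hψ.1 i).continuous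
  obtain ⟨C, hC⟩ := hcont.bounded_above_of_compact_support (hψ.pderiv i).2
  have hfin : IsFiniteMeasure (volume.restrict Ω) := ⟨by rwa [Measure.restrict_apply_univ]⟩
  have hi1 : IntegrableOn (fun x => χ x * pderiv i ψ x) Ω :=
    Integrable.mul_bdd hχ hcont.aestronglyMeasurable (Filter.Eventually.of_forall hC)
  have hi2 : IntegrableOn (pderiv i ψ) Ω := (hψ.pderiv i).integrable.integrableOn
  have key : ∫ x in Ω, (1 - 2 * χ x) * (G x - segAvg (fun _ => 1) i t G x) =
      2 * ∫ x in Ω, χ x * pderiv i ψ x := by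
    have : ∀ x, (1 - 2 * χ x) * (G x - segAvg (fun _ => 1) i t G x) =
        2 * (χ x * pderiv i ψ x) - pderiv i ψ x := fun x => by rw [hpd]; ring
    simp_rw [this]
    rw [integral_sub (hi1.const_mul 2) hi2, hint, sub_zero, integral_const_mul]
  rw [key]
  have := integral_mul_pderiv_le htv hψ hsupp ht hb i
  linarith

/-! ### Test functions close to a sign function -/

theorem exists_isTest_integral_ge {σ : Plane → ℝ} (hσ : IntegrableOn σ unitSquare)
    (h1 : ∀ᵐ x ∂volume.restrict unitSquare, σ x ^ 2 = 1) :
    ∃ θ : Plane → ℝ, IsTest θ ∧ (∀ x, |θ x| ≤ 1) ∧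
      (∀ x ∉ box (Set.Icc (1 / 64) (63 / 64)) (Set.Icc (1 / 64) (63 / 64)), θ x = 0) ∧
      3 / 4 ≤ ∫ x in unitSquare, σ x * θ x := by
  classical
  set Q : Set Plane := box (Set.Icc (1 / 32) (31 / 32)) (Set.Icc (1 / 32) (31 / 32)) with hQ
  have hQm : MeasurableSet Q := measurableSet_box measurableSet_Icc measurableSet_Icc
  have hQΩ : Q ⊆ unitSquare := by
    rw [unitSquare_eq_box]
    rintro x ⟨h0, h1⟩
    constructor <;> constructor <;> linarith [h0.1, h0.2, h1.1, h1.2]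
  -- a representative with values in `[-1, 1]`
  set f : Plane → ℝ := Q.indicator fun x => max (-1) (min (σ x) 1) with hf
  have hf1 : ∀ x, |f x| ≤ 1 := by
    intro x
    rw [hf]
    by_cases hx : x ∈ Q
    · rw [Set.indicator_of_mem hx, abs_le]
      exact ⟨le_max_left _ _, max_le (by norm_num) (min_le_right _ _)⟩
    · rw [Set.indicator_of_notMem hx]; simp
  have hf0 : ∀ x ∉ Q, f x = 0 := fun x hx => Set.indicator_of_notMem hx _
  have hσm : AEStronglyMeasurable (fun x => max (-1) (min (σ x) 1)) (volume.restrict Q) := by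
    have := (hσ.mono_set hQΩ).aestronglyMeasurable
    exact aestronglyMeasurable_const.sup (this.inf aestronglyMeasurable_const)
  have hQfin : volume Q < ⊤ :=
    (measure_mono hQΩ).trans_lt (volume_unitSquare ▸ ENNReal.one_lt_top)
  have hfint : Integrable f := by
    rw [hf, integrable_indicator_iff hQm]
    have : IsFiniteMeasure (volume.restrict Q) := ⟨by rwa [Measure.restrict_apply_univ]⟩
    refine Integrable.of_bound hσm 1 (ae_of_all _ fun x => ?_)
    rw [Real.norm_eq_abs, abs_le]
    exact ⟨le_max_left _ _, max_le (by norm_num) (min_le_right _ _)⟩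
  let φ : ℕ → ContDiffBump (0 : Plane) := fun k =>
    ⟨1 / (2 * (k + 128)), 1 / (k + 128), by positivity, by
      rw [div_lt_div_iff₀ (by positivity) (by positivity)]
      have : (0 : ℝ) ≤ k := by positivity
      linarith⟩
  let F : ℕ → Plane → ℝ := fun k =>
    convolution ((φ k).normed volume) f (ContinuousLinearMap.lsmul ℝ ℝ) volume
  have hφ0 : Filter.Tendsto (fun k => (φ k).rOut) Filter.atTop (nhds 0) := by
    have h := tendsto_one_div_add_atTop_nhds_zero_nat (𝕜 := ℝ)
    have h2 := (Filter.tendsto_add_atTop_iff_nat 127).2 h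
    refine h2.congr fun k => ?_
    show 1 / (((k + 127 : ℕ) : ℝ) + 1) = 1 / ((k : ℝ) + 128)
    push_cast; ring
  have hlim : ∀ᵐ x, Filter.Tendsto (fun k => F k x) Filter.atTop (nhds (f x)) := by
    refine ContDiffBump.ae_convolution_tendsto_right_of_locallyIntegrable (K := 2) hφ0
      (Filter.Eventually.of_forall fun k => ?_) hfint.locallyIntegrable
    show 1 / ((k : ℝ) + 128) ≤ 2 * (1 / (2 * ((k : ℝ) + 128)))
    apply le_of_eq; field_simp
  have hF1 : ∀ k x, |F k x| ≤ 1 := by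
    intro k x
    have h2 := dist_convolution_le (f := (φ k).normed volume) (g := f) (x₀ := x)
      (R := (φ k).rOut) (ε := 1) (z₀ := (0 : ℝ)) (μ := volume) zero_le_one
      (φ k).support_normed_eq.subset (φ k).nonneg_normed (φ k).integral_normed
      hfint.aestronglyMeasurable (fun y _ => by simpa using hf1 y)
    simpa using h2
  have hF0 : ∀ k, ∀ x ∉ box (Set.Icc (1 / 64) (63 / 64)) (Set.Icc (1 / 64) (63 / 64)),
      F k x = 0 := by
    intro k x hx
    by_contra hne
    obtain ⟨a, ha, b, hb, rfl⟩ := support_convolution_subset _ hne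
    have hbQ : b ∈ Q := by
      by_contra hb'
      exact hb (hf0 b hb')
    rw [(φ k).support_normed_eq, mem_ball_zero_iff] at ha
    have hr : (φ k).rOut ≤ 1 / 128 := by
      show 1 / ((k : ℝ) + 128) ≤ 1 / 128
      apply one_div_le_one_div_of_le <;> norm_num
    have hc : ∀ i, |a i| ≤ 1 / 128 := fun i => by
      have := PiLp.norm_apply_le a i
      rw [Real.norm_eq_abs] at this
      linarith
    apply hx
    have e0 := abs_le.1 (hc 0)
    have e1 := abs_le.1 (hc 1)
    obtain ⟨⟨q1, q2⟩, q3, q4⟩ := hbQ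
    refine ⟨⟨?_, ?_⟩, ?_, ?_⟩ <;> simp only [PiLp.add_apply] <;> linarith
  have hFs : ∀ k, ContDiff ℝ ∞ (F k) := fun k =>
    (φ k).hasCompactSupport_normed.contDiff_convolution_left _ (φ k).contDiff_normed
      hfint.locallyIntegrable
  have hFc : ∀ k, HasCompactSupport (F k) := fun k => HasCompactSupport.intro isCompact_box (hF0 k)
  have hσ1 : ∀ᵐ x ∂volume.restrict unitSquare, |σ x| ≤ 1 := by
    filter_upwards [h1] with x hx
    exact (sq_le_one_iff_abs_le_one _).1 hx.le
  have hconv : Filter.Tendsto (fun k => ∫ x in unitSquare, σ x * F k x) Filter.atTop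
      (nhds (∫ x in unitSquare, σ x * f x)) := by
    refine tendsto_integral_of_dominated_convergence (fun _ => 1) (fun k => ?_)
      (integrable_const _) (fun k => ?_) ?_
    · exact hσ.aestronglyMeasurable.mul (hFs k).continuous.aestronglyMeasurable
    · filter_upwards [hσ1] with x hx
      rw [Real.norm_eq_abs, abs_mul]
      exact mul_le_one₀ hx (abs_nonneg _) (hF1 k x)
    · filter_upwards [ae_restrict_of_ae hlim] with x hx
      exact hx.const_mul _
  have hval : ∫ x in unitSquare, σ x * f x = (15 / 16) ^ 2 := by
    have : ∫ x in unitSquare, σ x * f x = ∫ x in unitSquare, Q.indicator (fun _ => (1 : ℝ)) x := by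
      refine integral_congr_ae ?_
      filter_upwards [h1] with x hx
      by_cases hxQ : x ∈ Q
      · rw [hf, Set.indicator_of_mem hxQ, Set.indicator_of_mem hxQ]
        rcases mul_self_eq_one_iff.1 ((sq _).symm.trans hx) with h | h <;> rw [h] <;> norm_num
      · rw [hf0 x hxQ, Set.indicator_of_notMem hxQ, mul_zero]
    rw [this, setIntegral_indicator hQm, Set.inter_eq_self_of_subset_right hQΩ]
    simp only [integral_const, smul_eq_mul, mul_one, Measure.real, Measure.restrict_apply_univ]
    rw [hQ, volume_box, Real.volume_Icc, ENNReal.toReal_mul, ENNReal.toReal_ofReal (by norm_num)]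
    norm_num
  have hev := hconv.eventually (lt_mem_nhds (show (3 / 4 : ℝ) < _ by rw [hval]; norm_num))
  obtain ⟨k, hk⟩ := hev.exists
  exact ⟨F k, ⟨hFs k, hFc k⟩, hF1 k, hF0 k, hk.le⟩

/-! ### The lower bound -/

/-- A test function whose second derivatives are controlled anisotropically, and whose second
derivative in the first direction resembles `σ = 1 - 2χ`. -/
theorem exists_isTest_second_derivatives {χ : Plane → ℝ} (hχ : χ ∈ PhaseIndicators unitSquare)
    {h : ℝ} (h0 : 0 < h) (hh : h ≤ 1 / 256)
    (htv : h * (totalVariation unitSquare χ).toReal ≤ 1 / 16) :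
    ∃ ψ : Plane → ℝ, IsTest ψ ∧ (∀ x ∈ unitSquare, |pderiv 0 (pderiv 0 ψ) x| ≤ 1) ∧
      (∀ x, |pderiv 0 (pderiv 1 ψ) x| ≤ 4 / h) ∧ (∀ x, |pderiv 1 (pderiv 1 ψ) x| ≤ 4 / h ^ 2) ∧
      1 / 2 ≤ ∫ x in unitSquare, (1 - 2 * χ x) * pderiv 0 (pderiv 0 ψ) x := by
  obtain ⟨hχi, hχtv, hχ01⟩ := hχ
  have hσi : IntegrableOn (fun x => 1 - 2 * χ x) unitSquare :=
    (integrable_const (1 : ℝ)).sub (hχi.const_mul 2)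
  have hσsq : ∀ᵐ x ∂volume.restrict unitSquare, (1 - 2 * χ x) ^ 2 = 1 := by
    filter_upwards [hχ01] with x hx
    rcases hx with hx | hx <;> rw [hx] <;> norm_num
  obtain ⟨θ, hθ, hθ1, hθ0, hθint⟩ := exists_isTest_integral_ge hσi hσsq
  have hc1 : ContDiff ℝ ∞ fun _ : ℝ => (1 : ℝ) := contDiff_const
  have hone : ∀ s ∈ Set.Icc (0 : ℝ) 1, |(fun _ : ℝ => (1 : ℝ)) s| ≤ 1 := by simp
  -- abbreviations
  let A : (Plane → ℝ) → Plane → ℝ := segAvg (fun _ => 1) 1 h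
  let P : (Plane → ℝ) → Plane → ℝ := segAvg (fun _ => 1) 0 1
  have hAs : ∀ {G : Plane → ℝ}, ContDiff ℝ ∞ G → ContDiff ℝ ∞ (A G) := fun hG =>
    contDiff_segAvg hc1 hG
  have hPs : ∀ {G : Plane → ℝ}, ContDiff ℝ ∞ G → ContDiff ℝ ∞ (P G) := fun hG =>
    contDiff_segAvg hc1 hG
  have hAd : ∀ {G : Plane → ℝ} (k), ContDiff ℝ ∞ G → pderiv k (A G) = A (pderiv k G) :=
    fun k hG => pderiv_segAvg hc1 hG k
  have hPd : ∀ {G : Plane → ℝ} (k), ContDiff ℝ ∞ G → pderiv k (P G) = P (pderiv k G) :=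
    fun k hG => pderiv_segAvg hc1 hG k
  have hAb : ∀ {G : Plane → ℝ} {B : ℝ}, (∀ x, |G x| ≤ B) → ∀ x, |A G x| ≤ B :=
    fun hG x => abs_segAvg_le hone x fun _ _ => hG _
  have hPb : ∀ {G : Plane → ℝ} {B : ℝ}, (∀ x, |G x| ≤ B) → ∀ x, |P G x| ≤ B :=
    fun hG x => abs_segAvg_le hone x fun _ _ => hG _
  have hAdiff : ∀ {G : Plane → ℝ}, ContDiff ℝ ∞ G → ∀ x,
      h * A (pderiv 1 G) x = G x - G (x - h • EuclideanSpace.single 1 1) :=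
    fun hG x => mul_segAvg_one_pderiv hG x
  have hPdiff : ∀ {G : Plane → ℝ}, ContDiff ℝ ∞ G → ∀ x,
      P (pderiv 0 G) x = G x - G (x - EuclideanSpace.single 0 1) := fun hG x => by
    have := mul_segAvg_one_pderiv (i := 0) (t := 1) hG x
    simpa using this
  have hdiffb : ∀ {G : Plane → ℝ} {B : ℝ}, (∀ x, |G x| ≤ B) → ∀ x y, |G x - G y| ≤ 2 * B := by
    intro G B hG x y
    have h1 := abs_le.1 (hG x)
    have h2 := abs_le.1 (hG y)
    rw [abs_le]; constructor <;> linarith [h1.1, h1.2, h2.1, h2.2]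
  have hAdb : ∀ {G : Plane → ℝ} {B : ℝ}, ContDiff ℝ ∞ G → (∀ x, |G x| ≤ B) →
      ∀ x, |A (pderiv 1 G) x| ≤ 2 * B / h := by
    intro G B hG hB x
    have e : |A (pderiv 1 G) x| * h = |h * A (pderiv 1 G) x| := by
      rw [abs_mul, abs_of_pos h0, mul_comm]
    rw [le_div_iff₀ h0, e, hAdiff hG]
    exact hdiffb hB _ _
  -- supports
  let K : ℝ → Set Plane := fun r => box (Set.Icc (1 / 64) (63 / 64)) (Set.Icc (1 / 64) (63 / 64 + r))
  have hAsupp : ∀ {G : Plane → ℝ} {r : ℝ}, (∀ x ∉ K r, G x = 0) → ∀ x ∉ K (r + h),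
      ∀ s ∈ Set.Icc (0 : ℝ) 1, G (x - (s * h) • EuclideanSpace.single 1 1) = 0 := by
    intro G r hG x hx s hs
    apply hG
    contrapose! hx
    obtain ⟨⟨q1, q2⟩, q3, q4⟩ := hx
    have hs1 : 0 ≤ s * h := mul_nonneg hs.1 h0.le
    have hs2 : s * h ≤ h := mul_le_of_le_one_left h0.le hs.2
    simp at q1 q2 q3 q4
    refine ⟨⟨?_, ?_⟩, ?_, ?_⟩ <;> norm_num <;> linarith
  have hθK : ∀ x ∉ K 0, θ x = 0 := by simpa [K] using hθ0
  have hAθK : ∀ x ∉ K (0 + h), A θ x = 0 := fun x hx => segAvg_eq_zero x (hAsupp hθK x hx)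
  have hgK : ∀ x ∉ K (0 + h + h), A (A θ) x = 0 := fun x hx =>
    segAvg_eq_zero x (hAsupp hAθK x hx)
  have hKc : ∀ r, IsCompact (K r) := fun r => isCompact_box
  have hKΩ : ∀ r, r ≤ 1 / 128 → K r ⊆ unitSquare := by
    intro r hr x hx
    rw [unitSquare_eq_box]
    obtain ⟨⟨q1, q2⟩, q3, q4⟩ := hx
    constructor <;> constructor <;> linarith
  have hΩfin : volume unitSquare < ⊤ := volume_unitSquare ▸ ENNReal.one_lt_top
  have hθs := hθ.1
  -- `σ` against the averages
  have i1 := integral_sub_segAvg_le hχi hΩfin hχtv hθs hθ1 (hKc _)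
    (hKΩ (0 + h) (by linarith)) h0 1 (hAsupp hθK)
  have i2 := integral_sub_segAvg_le hχi hΩfin hχtv (hAs hθs) (hAb hθ1) (hKc _)
    (hKΩ (0 + h + h) (by linarith)) h0 1 (hAsupp hAθK)
  have hint : ∀ {G : Plane → ℝ}, ContDiff ℝ ∞ G → (∀ x, |G x| ≤ 1) →
      IntegrableOn (fun x => (1 - 2 * χ x) * G x) unitSquare := fun hG hB =>
    Integrable.mul_bdd (c := 1) hσi hG.continuous.aestronglyMeasurable
      (Filter.Eventually.of_forall hB)
  have hg : 1 / 2 ≤ ∫ x in unitSquare, (1 - 2 * χ x) * A (A θ) x := by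
    have e1 : ∫ x in unitSquare, (1 - 2 * χ x) * (θ x - A θ x) =
        (∫ x in unitSquare, (1 - 2 * χ x) * θ x) - ∫ x in unitSquare, (1 - 2 * χ x) * A θ x := by
      rw [← integral_sub (hint hθs hθ1) (hint (hAs hθs) (hAb hθ1))]
      congr 1; funext x; ring
    have e2 : ∫ x in unitSquare, (1 - 2 * χ x) * (A θ x - A (A θ) x) =
        (∫ x in unitSquare, (1 - 2 * χ x) * A θ x) -
          ∫ x in unitSquare, (1 - 2 * χ x) * A (A θ) x := by
      rw [← integral_sub (hint (hAs hθs) (hAb hθ1)) (hint (hAs (hAs hθs)) (hAb (hAb hθ1)))]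
      congr 1; funext x; ring
    change ∫ x in unitSquare, (1 - 2 * χ x) * (θ x - A θ x) ≤ _ at i1
    change ∫ x in unitSquare, (1 - 2 * χ x) * (A θ x - A (A θ) x) ≤ _ at i2
    rw [e1] at i1
    rw [e2] at i2
    linarith
  set g := A (A θ) with hgdef
  have hgs : ContDiff ℝ ∞ g := hAs (hAs hθs)
  have h00 : ∀ x, pderiv 0 (pderiv 0 (P (P g))) x = (g x - g (x - EuclideanSpace.single 0 1)) -
      (g (x - EuclideanSpace.single 0 1) -
        g (x - EuclideanSpace.single 0 1 - EuclideanSpace.single 0 1)) := by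
    intro x
    have d0 := contDiff_pderiv hgs 0
    rw [hPd 0 (hPs hgs), hPd 0 hgs, hPd 0 (hPs d0), hPd 0 d0, ← hPd 0 d0, hPdiff (hPs d0),
      hPdiff hgs, hPdiff hgs]
  have h00Ω : ∀ x ∈ unitSquare, pderiv 0 (pderiv 0 (P (P g))) x = g x := by
    intro x hx
    have hz : ∀ y : Plane, y 0 < 0 → g y = 0 := by
      intro y hy
      apply hgK
      rintro ⟨⟨q1, q2⟩, q3⟩
      linarith
    have hx1 := (hx 0).2
    rw [h00, hz (x - EuclideanSpace.single 0 1) (by simpa using hx1),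
      hz (x - EuclideanSpace.single 0 1 - EuclideanSpace.single 0 1) (by simp; linarith)]
    ring
  have hPc : ∀ {G : Plane → ℝ} {a : ℝ}, (∀ x ∉ box (Set.Icc (1 / 64) a) (Set.Icc (1 / 64) 1), G x = 0) →
      ∀ x ∉ box (Set.Icc (1 / 64) (a + 1)) (Set.Icc (1 / 64) 1), P G x = 0 := by
    intro G a hG x hx
    refine segAvg_eq_zero x fun s hs => hG _ ?_
    contrapose! hx
    obtain ⟨⟨q1, q2⟩, q3, q4⟩ := hx
    simp at q1 q2 q3 q4
    refine ⟨⟨?_, ?_⟩, ?_, ?_⟩ <;> norm_num <;> linarith [hs.1, hs.2]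
  have hgK' : ∀ x ∉ box (Set.Icc (1 / 64) 1) (Set.Icc (1 / 64) 1), g x = 0 := by
    intro x hx
    apply hgK
    contrapose! hx
    obtain ⟨⟨q1, q2⟩, q3, q4⟩ := hx
    exact ⟨⟨q1, by linarith⟩, q3, by linarith⟩
  refine ⟨P (P g), ⟨hPs (hPs hgs), HasCompactSupport.intro isCompact_box (hPc (hPc hgK'))⟩,
    fun x hx => ?_, ?_, ?_, ?_⟩
  · rw [h00Ω x hx]
    exact hAb (hAb hθ1) x
  · have e : pderiv 0 (pderiv 1 (P (P g))) = P (P (pderiv 0 (pderiv 1 g))) := by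
      rw [hPd 1 (hPs hgs), hPd 1 hgs, hPd 0 (hPs (contDiff_pderiv hgs 1)),
        hPd 0 (contDiff_pderiv hgs 1)]
    have b1 : ∀ x, |pderiv 1 g x| ≤ 2 * 1 / h := by
      rw [hgdef, hAd 1 (hAs hθs)]
      exact hAdb (hAs hθs) (hAb hθ1)
    have b2 : ∀ x, |P (pderiv 0 (pderiv 1 g)) x| ≤ 2 * (2 * 1 / h) := by
      intro x
      rw [hPdiff (contDiff_pderiv hgs 1)]
      exact hdiffb b1 _ _
    rw [e]
    intro x
    refine (hPb b2 x).trans (le_of_eq ?_)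
    ring
  · have e : pderiv 1 (pderiv 1 (P (P g))) = P (P (pderiv 1 (pderiv 1 g))) := by
      rw [hPd 1 (hPs hgs), hPd 1 hgs, hPd 1 (hPs (contDiff_pderiv hgs 1)),
        hPd 1 (contDiff_pderiv hgs 1)]
    have b1 : ∀ x, |pderiv 1 (pderiv 1 g) x| ≤ 2 * (2 * 1 / h) / h := by
      have d1 := contDiff_pderiv hθs 1
      rw [hgdef, hAd 1 (hAs hθs), hAd 1 hθs, hAd 1 (hAs d1)]
      exact hAdb (hAs d1) (hAdb hθs hθ1)
    rw [e]
    intro x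
    refine (hPb (hPb b1) x).trans (le_of_eq ?_)
    field_simp
    ring
  · rw [setIntegral_congr_fun measurableSet_unitSquare
      (g := fun x => (1 - 2 * χ x) * g x) fun x hx => by simp only [h00Ω x hx]]
    exact hg

theorem locallyIntegrable_of_admissible {Ω : Set Plane} {F : Mat2} {E : Plane → Mat2}
    (hE : E ∈ Admissible Ω F) (i j : Fin 2) : LocallyIntegrable fun x => E x i j :=
  (hE.1 i j).1

/-- Testing `curl curl E = 0` with a test function, after subtracting the boundary data. -/
theorem integral_eq_zero_of_admissible {E : Plane → Mat2} (hE : E ∈ Admissible unitSquare 1)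
    {ψ : Plane → ℝ} (hψ : IsTest ψ) :
    IntegrableOn (fun x => (E x 1 1 - 1) * pderiv 0 (pderiv 0 ψ) x
        - (E x 0 1 + E x 1 0) * pderiv 0 (pderiv 1 ψ) x
        + (E x 0 0 - 1) * pderiv 1 (pderiv 1 ψ) x) unitSquare ∧
    ∫ x in unitSquare, ((E x 1 1 - 1) * pderiv 0 (pderiv 0 ψ) x
        - (E x 0 1 + E x 1 0) * pderiv 0 (pderiv 1 ψ) x
        + (E x 0 0 - 1) * pderiv 1 (pderiv 1 ψ) x) = 0 := by
  have hmul : ∀ (i j k l : Fin 2), Integrable fun x => E x i j * pderiv k (pderiv l ψ) x :=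
    fun i j k l => (locallyIntegrable_of_admissible hE i j).integrable_smul_right_of_hasCompactSupport
      ((hψ.pderiv l).pderiv k).1.continuous ((hψ.pderiv l).pderiv k).2
  have hsum : Integrable fun x => E x 1 1 * pderiv 0 (pderiv 0 ψ) x
      - (E x 0 1 + E x 1 0) * pderiv 0 (pderiv 1 ψ) x + E x 0 0 * pderiv 1 (pderiv 1 ψ) x := by
    simp_rw [add_mul]
    exact ((hmul 1 1 0 0).sub ((hmul 0 1 0 1).add (hmul 1 0 0 1))).add (hmul 0 0 1 1)
  have hlap : Integrable fun x => pderiv 0 (pderiv 0 ψ) x + pderiv 1 (pderiv 1 ψ) x :=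
    ((hψ.pderiv 0).pderiv 0).integrable.add ((hψ.pderiv 1).pderiv 1).integrable
  have e : (fun x => (E x 1 1 - 1) * pderiv 0 (pderiv 0 ψ) x
        - (E x 0 1 + E x 1 0) * pderiv 0 (pderiv 1 ψ) x
        + (E x 0 0 - 1) * pderiv 1 (pderiv 1 ψ) x) = fun x =>
      (E x 1 1 * pderiv 0 (pderiv 0 ψ) x - (E x 0 1 + E x 1 0) * pderiv 0 (pderiv 1 ψ) x
        + E x 0 0 * pderiv 1 (pderiv 1 ψ) x) -
      (pderiv 0 (pderiv 0 ψ) x + pderiv 1 (pderiv 1 ψ) x) := by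
    funext x; ring
  refine ⟨by rw [e]; exact (hsum.sub hlap).integrableOn, ?_⟩
  rw [setIntegral_eq_integral_of_ae_compl_eq_zero]
  · rw [e, integral_sub hsum hlap, hE.2.1 ψ hψ, integral_add ((hψ.pderiv 0).pderiv 0).integrable
      ((hψ.pderiv 1).pderiv 1).integrable, integral_pderiv (hψ.pderiv 0),
      integral_pderiv (hψ.pderiv 1)]
    simp
  · filter_upwards [hE.2.2, ae_closure_unitSquare] with x hx hcl hxΩ
    rw [hx fun h => hxΩ (hcl h)]
    simp

theorem frobSq_sub_well (α s : ℝ) (M : Mat2) :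
    frobSq (M - well α s) = (M 0 0 - 1) ^ 2 + M 0 1 ^ 2 + M 1 0 ^ 2 +
      (M 1 1 - 1 - α * (1 - 2 * s)) ^ 2 := by
  simp [frobSq, well, Fin.sum_univ_two]
  ring

theorem mul_abs_le_of_sq {α h e w : ℝ} (hα : 0 < α) (h0 : 0 < h) (hw : |w| ≤ 4 / h ^ 2) :
    |e * w| ≤ α / 32 + 128 / (α * h ^ 4) * e ^ 2 := by
  have h2 : (0 : ℝ) < h ^ 2 := by positivity
  have e1 : |e * w| ≤ |e| * (4 / h ^ 2) := by
    rw [abs_mul]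
    exact mul_le_mul_of_nonneg_left hw (abs_nonneg _)
  refine e1.trans ?_
  have key : 0 ≤ α / 32 * (1 - 64 / (α * h ^ 2) * |e|) ^ 2 := by positivity
  have e2 : α / 32 * (1 - 64 / (α * h ^ 2) * |e|) ^ 2 =
      α / 32 + 128 / (α * h ^ 4) * |e| ^ 2 - |e| * (4 / h ^ 2) := by
    field_simp
    ring
  rw [sq_abs] at e2
  linarith

/-- If the interfaces of `χ` are short on the scale `1 / h`, the elastic energy is at least of
order `h ^ 4`. -/
theorem elasticEnergy_ge {α h : ℝ} (hα : 0 < α) (h0 : 0 < h) (hh : h ≤ 1 / 256)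
    {χ : Plane → ℝ} (hχ : χ ∈ PhaseIndicators unitSquare) {E : Plane → Mat2}
    (hE : E ∈ Admissible unitSquare 1)
    (htv : h * (totalVariation unitSquare χ).toReal ≤ 1 / 16) :
    ENNReal.ofReal (α ^ 2 / 512 * h ^ 4) ≤ elasticEnergy unitSquare α E χ := by
  obtain ⟨ψ, hψ, hb00, hb01, hb11, hint⟩ := exists_isTest_second_derivatives hχ h0 hh htv
  rcases eq_or_ne (elasticEnergy unitSquare α E χ) ⊤ with htop | htop
  · rw [htop]; exact le_top
  set W : Plane → ℝ := fun x => frobSq (E x - well α (χ x)) with hW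
  have hW0 : ∀ x, 0 ≤ W x := fun x => by
    rw [hW]; exact Finset.sum_nonneg fun i _ => Finset.sum_nonneg fun j _ => sq_nonneg _
  have hEm : ∀ i j, AEStronglyMeasurable (fun x => E x i j) (volume.restrict unitSquare) :=
    fun i j => (locallyIntegrable_of_admissible hE i j).aestronglyMeasurable.restrict
  have hWm : AEStronglyMeasurable W (volume.restrict unitSquare) := by
    have : W = fun x => (E x 0 0 - 1) ^ 2 + E x 0 1 ^ 2 + E x 1 0 ^ 2 +
      (E x 1 1 - 1 - α * (1 - 2 * χ x)) ^ 2 := funext fun x => frobSq_sub_well _ _ _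
    rw [this]
    have hc (c : ℝ) : AEStronglyMeasurable (fun _ : Plane => c) (volume.restrict unitSquare) :=
      aestronglyMeasurable_const
    exact (((((hEm 0 0).sub (hc 1)).pow 2).add ((hEm 0 1).pow 2)).add ((hEm 1 0).pow 2)).add
      ((((hEm 1 1).sub (hc 1)).sub ((hc α).mul ((hc 1).sub
        ((hc 2).mul hχ.1.aestronglyMeasurable)))).pow 2)
  have hWi : IntegrableOn W unitSquare :=
    ⟨hWm, (hasFiniteIntegral_iff_ofReal (ae_of_all _ hW0)).2 (lt_top_iff_ne_top.2 htop)⟩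
  obtain ⟨hI, hI0⟩ := integral_eq_zero_of_admissible hE hψ
  set J : Plane → ℝ := fun x => (E x 1 1 - 1) * pderiv 0 (pderiv 0 ψ) x
        - (E x 0 1 + E x 1 0) * pderiv 0 (pderiv 1 ψ) x
        + (E x 0 0 - 1) * pderiv 1 (pderiv 1 ψ) x with hJ
  have hh1 : h ^ 2 ≤ h := by nlinarith
  have hpt : ∀ x ∈ unitSquare, α * ((1 - 2 * χ x) * pderiv 0 (pderiv 0 ψ) x) ≤
      J x + (α / 8 + 128 / (α * h ^ 4) * W x) := by
    intro x hx
    have c0 : |pderiv 0 (pderiv 0 ψ) x| ≤ 4 / h ^ 2 := (hb00 x hx).trans (by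
      rw [le_div_iff₀ (by positivity)]; nlinarith)
    have c1 : |pderiv 0 (pderiv 1 ψ) x| ≤ 4 / h ^ 2 := (hb01 x).trans
      (div_le_div_of_nonneg_left (by norm_num) (by positivity) hh1)
    have m1 := (abs_le.1 (mul_abs_le_of_sq (e := E x 1 1 - 1 - α * (1 - 2 * χ x)) hα h0 c0)).1
    have m2 := (abs_le.1 (mul_abs_le_of_sq (e := E x 0 1) hα h0 c1)).2
    have m3 := (abs_le.1 (mul_abs_le_of_sq (e := E x 1 0) hα h0 c1)).2
    have m4 := (abs_le.1 (mul_abs_le_of_sq (e := E x 0 0 - 1) hα h0 (hb11 x))).1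
    have hWx : W x = (E x 0 0 - 1) ^ 2 + E x 0 1 ^ 2 + E x 1 0 ^ 2 +
      (E x 1 1 - 1 - α * (1 - 2 * χ x)) ^ 2 := frobSq_sub_well _ _ _
    rw [hWx, hJ]
    dsimp only
    linarith
  have hσi : IntegrableOn (fun x => 1 - 2 * χ x) unitSquare :=
    (integrable_const (1 : ℝ)).sub (hχ.1.const_mul 2)
  have hσψ : IntegrableOn (fun x => (1 - 2 * χ x) * pderiv 0 (pderiv 0 ψ) x) unitSquare := by
    refine Integrable.mul_bdd (c := 1) hσi
      ((hψ.pderiv 0).pderiv 0).1.continuous.aestronglyMeasurable ?_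
    filter_upwards [ae_restrict_mem measurableSet_unitSquare] with x hx using hb00 x hx
  have hR : IntegrableOn (fun x => α / 8 + 128 / (α * h ^ 4) * W x) unitSquare :=
    (integrable_const (α / 8)).add (hWi.const_mul (128 / (α * h ^ 4)))
  have hmono := setIntegral_mono_on (hσψ.const_mul α) (g := fun x => J x + _) (hI.add hR)
    measurableSet_unitSquare hpt
  rw [integral_const_mul, integral_add hI hR, hI0, integral_add (integrable_const (α / 8))
    (hWi.const_mul (128 / (α * h ^ 4))), integral_const_mul, integral_const] at hmono
  have hvol : (volume.restrict unitSquare).real Set.univ = 1 := by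
    rw [Measure.real, Measure.restrict_apply_univ, volume_unitSquare]; rfl
  rw [hvol, one_smul] at hmono
  have hel : elasticEnergy unitSquare α E χ = ENNReal.ofReal (∫ x in unitSquare, W x) :=
    (ofReal_integral_eq_lintegral_ofReal hWi (ae_of_all _ hW0)).symm
  rw [hel]
  apply ENNReal.ofReal_le_ofReal
  have h1 : α * (3 / 8) ≤ 128 / (α * h ^ 4) * ∫ x in unitSquare, W x := by nlinarith
  rw [div_mul_eq_mul_div, le_div_iff₀ (by positivity)] at h1
  have : 0 ≤ α ^ 2 * h ^ 4 := by positivity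
  nlinarith

theorem minEnergy_ge {α ε : ℝ} (hα : 0 < α) (hε : 0 < ε) (hε1 : ε ≤ (1 / 256) ^ 5) :
    ENNReal.ofReal (min (α ^ 2 / 512) (1 / 16) * ε ^ (4 / 5 : ℝ)) ≤
      minEnergy unitSquare 1 α ε := by
  set h : ℝ := ε ^ (1 / 5 : ℝ) with hh
  have h0 : 0 < h := Real.rpow_pos_of_pos hε _
  have h5 : h ^ 5 = ε := by
    rw [hh, ← Real.rpow_natCast, ← Real.rpow_mul hε.le]; norm_num
  have h4 : ε ^ (4 / 5 : ℝ) = h ^ 4 := by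
    rw [hh, ← Real.rpow_natCast, ← Real.rpow_mul hε.le]; norm_num
  have hle : h ≤ 1 / 256 := by
    rw [← h5] at hε1
    exact le_of_pow_le_pow_left₀ (by norm_num) (by norm_num) hε1
  have hp4 : 0 < h ^ 4 := by positivity
  refine le_iInf₂ fun χ hχ => le_iInf fun u => le_iInf fun E => le_iInf₂ fun _ hE => ?_
  rw [h4]
  rcases le_or_gt (h * (totalVariation unitSquare χ).toReal) (1 / 16) with htv | htv
  · refine le_trans ?_ (le_add_right (elasticEnergy_ge hα h0 hle hχ hE htv))
    exact ENNReal.ofReal_le_ofReal (mul_le_mul_of_nonneg_right (min_le_left _ _) hp4.le)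
  · refine le_trans ?_ (le_add_left le_rfl)
    rw [← ENNReal.ofReal_toReal hχ.2.1.ne, ← ENNReal.ofReal_mul hε.le]
    apply ENNReal.ofReal_le_ofReal
    calc min (α ^ 2 / 512) (1 / 16) * h ^ 4 ≤ 1 / 16 * h ^ 4 :=
          mul_le_mul_of_nonneg_right (min_le_right _ _) hp4.le
      _ ≤ (h * (totalVariation unitSquare χ).toReal) * h ^ 4 :=
          mul_le_mul_of_nonneg_right htv.le hp4.le
      _ = ε * (totalVariation unitSquare χ).toReal := by rw [← h5]; ring

/-! ### Displacements with diagonal strain, from a scalar potential -/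

theorem hasWeakPDeriv_of_contDiff {f : Plane → ℝ} (hf : ContDiff ℝ ∞ f) (i : Fin 2) :
    HasWeakPDeriv i f (pderiv i f) :=
  ⟨hf.continuous.locallyIntegrable, (contDiff_pderiv hf i).continuous.locallyIntegrable,
    fun _ hφ => integral_mul_pderiv hf hφ i⟩

theorem memWLoc_of_contDiff (k : ℕ) : ∀ {f : Plane → ℝ}, ContDiff ℝ ∞ f → MemWLoc k f := by
  induction k with
  | zero => exact fun hf => hf.continuous.locallyIntegrable
  | succ k ih =>
    exact fun hf => ⟨hf.continuous.locallyIntegrable, fun i =>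
      ⟨_, hasWeakPDeriv_of_contDiff hf i, ih (contDiff_pderiv hf i)⟩⟩

theorem isSymGrad_of_contDiff {u : Plane → Plane} {E : Plane → Mat2}
    (hu : ∀ i, ContDiff ℝ ∞ fun x => u x i)
    (hE : ∀ x i j, E x i j = (pderiv j (fun y => u y i) x + pderiv i (fun y => u y j) x) / 2) :
    IsSymGrad u E := by
  refine ⟨fun i => (hu i).continuous.locallyIntegrable, fun i j => ?_, fun i j φ hφ => ?_⟩
  · simp_rw [hE]
    exact (((contDiff_pderiv (hu i) j).add
      (contDiff_pderiv (hu j) i)).continuous.div_const 2).locallyIntegrable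
  · have h1 := integral_mul_pderiv (hu i) hφ j
    have h2 := integral_mul_pderiv (hu j) hφ i
    have i1 := (IsTest.mul_left (hu i) (hφ.pderiv j)).integrable
    have i2 := (IsTest.mul_left (hu j) (hφ.pderiv i)).integrable
    have i3 := (IsTest.mul_left (contDiff_pderiv (hu i) j) hφ).integrable
    have i4 := (IsTest.mul_left (contDiff_pderiv (hu j) i) hφ).integrable
    rw [integral_div, integral_add i1 i2, h1, h2]
    have e : ∀ x, E x i j * φ x = (pderiv j (fun y => u y i) x * φ x +
        pderiv i (fun y => u y j) x * φ x) / 2 := fun x => by rw [hE]; ring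
    simp_rw [e]
    rw [integral_div, integral_add i3 i4]
    ring

theorem integral_pderiv_pderiv_mul {f φ : Plane → ℝ} (hf : ContDiff ℝ ∞ f) (hφ : IsTest φ)
    (i : Fin 2) :
    ∫ x, f x * pderiv i (pderiv i φ) x = ∫ x, pderiv i (pderiv i f) x * φ x := by
  rw [integral_mul_pderiv hf (hφ.pderiv i), integral_mul_pderiv (contDiff_pderiv hf i) hφ, neg_neg]

theorem pderiv_eq_zero_of_notMem_closure {Ω : Set Plane} {f : Plane → ℝ}
    (h0 : ∀ x ∉ closure Ω, f x = 0) (i : Fin 2) : ∀ x ∉ closure Ω, pderiv i f x = 0 := by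
  intro x hx
  have : f =ᶠ[nhds x] fun _ => 0 := by
    filter_upwards [isClosed_closure.isOpen_compl.mem_nhds hx] with y hy using h0 y hy
  simp [pderiv, this.fderiv_eq]

theorem pderiv_coord (i j : Fin 2) (x : Plane) :
    pderiv j (fun y : Plane => y i) x = if i = j then 1 else 0 := by
  have : HasFDerivAt (fun y : Plane => y i) (EuclideanSpace.proj (𝕜 := ℝ) i : Plane →L[ℝ] ℝ) x :=
    (EuclideanSpace.proj (𝕜 := ℝ) i : Plane →L[ℝ] ℝ).hasFDerivAt
  simp [pderiv, this.fderiv]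

/-- Up to the identity, the strain of the displacement `x + α (-∂₀w, ∂₁w)`. -/
noncomputable def potentialStrain (α : ℝ) (w : Plane → ℝ) (x : Plane) : Mat2 :=
  !![1 - α * pderiv 0 (pderiv 0 w) x, 0; 0, 1 + α * pderiv 1 (pderiv 1 w) x]

noncomputable def potentialDisplacement (α : ℝ) (w : Plane → ℝ) (x : Plane) : Plane :=
  !₂[x 0 - α * pderiv 0 w x, x 1 + α * pderiv 1 w x]

theorem isSymGrad_potential (α : ℝ) {w : Plane → ℝ} (hw : ContDiff ℝ ∞ w) :
    IsSymGrad (potentialDisplacement α w) (potentialStrain α w) := by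
  have hc : ∀ i, ContDiff ℝ ∞ fun x : Plane => x i := fun i => by fun_prop
  have h0 : ContDiff ℝ ∞ fun x => α * pderiv 0 w x := contDiff_const.mul (contDiff_pderiv hw 0)
  have h1 : ContDiff ℝ ∞ fun x => α * pderiv 1 w x := contDiff_const.mul (contDiff_pderiv hw 1)
  have e0 : (fun x => potentialDisplacement α w x 0) = fun x => x 0 - α * pderiv 0 w x := rfl
  have e1 : (fun x => potentialDisplacement α w x 1) = fun x => x 1 + α * pderiv 1 w x := rfl
  have d0 : ∀ k x, pderiv k (fun x => potentialDisplacement α w x 0) x =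
      (if 0 = k then 1 else 0) - α * pderiv k (pderiv 0 w) x := by
    intro k x
    rw [e0, pderiv_sub (hc 0) h0, pderiv_coord, pderiv_const_mul (contDiff_pderiv hw 0)]
  have d1 : ∀ k x, pderiv k (fun x => potentialDisplacement α w x 1) x =
      (if 1 = k then 1 else 0) + α * pderiv k (pderiv 1 w) x := by
    intro k x
    rw [e1, pderiv_add (hc 1) h1, pderiv_coord, pderiv_const_mul (contDiff_pderiv hw 1)]
  refine isSymGrad_of_contDiff (fun i => ?_) fun x i j => ?_
  · fin_cases i
    · exact (hc 0).sub h0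
    · exact (hc 1).add h1
  · have hcomm := congrFun (pderiv_comm hw 0 1) x
    fin_cases i <;> fin_cases j <;> simp [potentialStrain, d0, d1, hcomm]

theorem potentialStrain_mem_admissible (α : ℝ) {Ω : Set Plane} {w : Plane → ℝ} (hw : IsTest w)
    (h0 : ∀ x ∉ closure Ω, w x = 0) : potentialStrain α w ∈ Admissible Ω 1 := by
  have h00 := (hw.pderiv 0).pderiv 0
  have h11 := (hw.pderiv 1).pderiv 1
  refine ⟨fun i j => memWLoc_of_contDiff 2 ?_, fun φ hφ => ?_, ae_of_all _ fun x hx => ?_⟩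
  · fin_cases i <;> fin_cases j
    · exact contDiff_const.sub (contDiff_const.mul h00.1)
    · exact contDiff_const
    · exact contDiff_const
    · exact contDiff_const.add (contDiff_const.mul h11.1)
  · have p00 := (hφ.pderiv 0).pderiv 0
    have p11 := (hφ.pderiv 1).pderiv 1
    have e : ∀ x, (potentialStrain α w x 1 1 * pderiv 0 (pderiv 0 φ) x
        - (potentialStrain α w x 0 1 + potentialStrain α w x 1 0) * pderiv 0 (pderiv 1 φ) x
        + potentialStrain α w x 0 0 * pderiv 1 (pderiv 1 φ) x) =
        (pderiv 0 (pderiv 0 φ) x + pderiv 1 (pderiv 1 φ) x) +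
        (α * (pderiv 1 (pderiv 1 w) x * pderiv 0 (pderiv 0 φ) x) -
          α * (pderiv 0 (pderiv 0 w) x * pderiv 1 (pderiv 1 φ) x)) := by
      intro x
      simp [potentialStrain]
      ring
    have i1 := (IsTest.mul_left h11.1 p00).const_mul α
    have i2 := (IsTest.mul_left h00.1 p11).const_mul α
    simp_rw [e]
    have j1 : Integrable fun x => pderiv 0 (pderiv 0 φ) x + pderiv 1 (pderiv 1 φ) x :=
      p00.integrable.add p11.integrable
    rw [integral_add j1 (i1.sub i2).integrable,
      integral_add p00.integrable p11.integrable, integral_pderiv (hφ.pderiv 0),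
      integral_pderiv (hφ.pderiv 1), integral_sub i1.integrable i2.integrable,
      integral_const_mul, integral_const_mul, integral_pderiv_pderiv_mul h11.1 hφ,
      integral_pderiv_pderiv_mul h00.1 hφ]
    have hcomm : pderiv 0 (pderiv 0 (pderiv 1 (pderiv 1 w))) =
        pderiv 1 (pderiv 1 (pderiv 0 (pderiv 0 w))) := by
      rw [pderiv_comm (hw.pderiv 1).1 0 1, pderiv_comm hw.1 0 1,
        pderiv_comm ((hw.pderiv 0).pderiv 1).1 0 1, pderiv_comm (hw.pderiv 0).1 0 1]
    rw [hcomm]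
    ring
  · have a0 := pderiv_eq_zero_of_notMem_closure (pderiv_eq_zero_of_notMem_closure h0 0) 0 x hx
    have a1 := pderiv_eq_zero_of_notMem_closure (pderiv_eq_zero_of_notMem_closure h0 1) 1 x hx
    ext i j
    fin_cases i <;> fin_cases j <;> simp [potentialStrain, a0, a1]

theorem minEnergy_le_of_potential (α ε : ℝ) {Ω : Set Plane} {w : Plane → ℝ} (hw : IsTest w)
    (h0 : ∀ x ∉ closure Ω, w x = 0) {χ : Plane → ℝ} (hχ : χ ∈ PhaseIndicators Ω) :
    minEnergy Ω 1 α ε ≤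
      (∫⁻ x in Ω, ENNReal.ofReal (α ^ 2 * (pderiv 0 (pderiv 0 w) x ^ 2 +
        (pderiv 1 (pderiv 1 w) x - (1 - 2 * χ x)) ^ 2))) +
      ENNReal.ofReal ε * totalVariation Ω χ := by
  have h : minEnergy Ω 1 α ε ≤ energy Ω α ε (potentialStrain α w) χ :=
    (iInf₂_le χ hχ).trans ((iInf₂_le (potentialDisplacement α w) (potentialStrain α w)).trans
      (iInf₂_le (isSymGrad_potential α hw.1) (potentialStrain_mem_admissible α hw h0)))
  refine h.trans (le_of_eq ?_)
  unfold energy elasticEnergy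
  congr 2
  funext x
  rw [frobSq_sub_well]
  congr 1
  simp [potentialStrain]
  ring

/-! ### Total variation of sets whose slices are intervals -/

theorem abs_setIntegral_deriv_le {S : Set ℝ} (hS : S.OrdConnected) {a b : ℝ}
    (hab : S ⊆ Set.Icc a b) {g g' : ℝ → ℝ} (hg : ∀ s, HasDerivAt g (g' s) s)
    (hg' : Continuous g') (hb : ∀ s, |g s| ≤ 1) : |∫ s in S, g' s| ≤ 2 := by
  rcases S.eq_empty_or_nonempty with rfl | hne
  · simp
  have hbb : BddBelow S := bddBelow_Icc.mono hab
  have hba : BddAbove S := bddAbove_Icc.mono hab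
  have hle : sInf S ≤ sSup S := csInf_le_csSup hne hbb hba
  have hsub : S ⊆ Set.Icc (sInf S) (sSup S) := fun s hs => ⟨csInf_le hbb hs, le_csSup hba hs⟩
  have hsup : Set.Ioo (sInf S) (sSup S) ⊆ S := by
    rintro s ⟨h1, h2⟩
    obtain ⟨p, hp, hps⟩ := exists_lt_of_csInf_lt hne h1
    obtain ⟨q, hq, hqs⟩ := exists_lt_of_lt_csSup hne h2
    exact hS.out hp hq ⟨hps.le, hqs.le⟩
  have hae : S =ᵐ[volume] Set.Ioc (sInf S) (sSup S) :=
    Filter.EventuallyLE.antisymm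
      (hsub.eventuallyLE.trans Ioc_ae_eq_Icc.symm.le) (Ioo_ae_eq_Ioc.symm.le.trans hsup.eventuallyLE)
  rw [setIntegral_congr_set hae, ← intervalIntegral.integral_of_le hle,
    intervalIntegral.integral_eq_sub_of_hasDerivAt (fun s _ => hg s)
      (hg'.intervalIntegrable _ _)]
  have h1 := abs_le.1 (hb (sSup S))
  have h2 := abs_le.1 (hb (sInf S))
  rw [abs_le]; constructor <;> linarith [h1.1, h1.2, h2.1, h2.2]

/-- The point with given coordinates. -/
noncomputable def pt (s t : ℝ) : Plane := !₂[s, t]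

theorem planeEquiv_symm_apply (p : ℝ × ℝ) : planeEquiv.symm p = pt p.1 p.2 := by
  rw [MeasurableEquiv.symm_apply_eq]; rfl

@[simp] theorem pt_zero (s t : ℝ) : pt s t 0 = s := rfl

@[simp] theorem pt_one (s t : ℝ) : pt s t 1 = t := rfl

theorem pt_eta (x : Plane) : pt (x 0) (x 1) = x := by
  ext i; fin_cases i <;> rfl

theorem continuous_pt : Continuous fun p : ℝ × ℝ => pt p.1 p.2 := by
  unfold pt
  refine (PiLp.continuous_toLp 2 _).comp (continuous_pi fun i => ?_)
  fin_cases i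
  · exact continuous_fst
  · exact continuous_snd

theorem hasDerivAt_pt_left (s t : ℝ) :
    HasDerivAt (fun s => pt s t) (EuclideanSpace.single 0 1) s := by
  have e : (fun s => pt s t) = fun s : ℝ => s • (EuclideanSpace.single 0 1 : Plane) + pt 0 t := by
    funext s
    ext i; fin_cases i <;> simp [pt]
  rw [e]
  simpa using ((hasDerivAt_id s).smul_const (EuclideanSpace.single 0 1 : Plane)).add_const (pt 0 t)

theorem hasDerivAt_pt_right (s t : ℝ) :
    HasDerivAt (fun t => pt s t) (EuclideanSpace.single 1 1) t := by
  have e : (fun t => pt s t) = fun t : ℝ => t • (EuclideanSpace.single 1 1 : Plane) + pt s 0 := by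
    funext s
    ext i; fin_cases i <;> simp [pt]
  rw [e]
  simpa using ((hasDerivAt_id t).smul_const (EuclideanSpace.single 1 1 : Plane)).add_const (pt s 0)

theorem hasDerivAt_comp_pt_left {f : Plane → ℝ} (hf : Differentiable ℝ f) (s t : ℝ) :
    HasDerivAt (fun s => f (pt s t)) (pderiv 0 f (pt s t)) s :=
  HasFDerivAt.comp_hasDerivAt (f := fun s => pt s t) s (hf (pt s t)).hasFDerivAt
    (hasDerivAt_pt_left s t)

theorem hasDerivAt_comp_pt_right {f : Plane → ℝ} (hf : Differentiable ℝ f) (s t : ℝ) :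
    HasDerivAt (fun t => f (pt s t)) (pderiv 1 f (pt s t)) t :=
  HasFDerivAt.comp_hasDerivAt (f := fun t => pt s t) t (hf (pt s t)).hasFDerivAt
    (hasDerivAt_pt_right s t)

theorem integral_plane (f : Plane → ℝ) :
    ∫ x, f x = ∫ p : ℝ × ℝ, f (pt p.1 p.2) := by
  rw [← (measurePreserving_planeEquiv.symm planeEquiv).integral_comp'
    (g := f)]
  simp_rw [planeEquiv_symm_apply]

theorem integrable_plane {f : Plane → ℝ} (hf : Integrable f) :
    Integrable (fun p : ℝ × ℝ => f (pt p.1 p.2)) := by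
  have := (measurePreserving_planeEquiv.symm planeEquiv).integrable_comp_of_integrable hf
  simpa [Function.comp_def, planeEquiv_symm_apply] using this

theorem abs_integral_le_of_slices {F : ℝ → ℝ} {B a b : ℝ} (hab : a ≤ b) (h0 : ∀ s ∉ Set.Icc a b, F s = 0)
    (hB : ∀ s, |F s| ≤ B) : |∫ s, F s| ≤ B * (b - a) := by
  rw [← setIntegral_eq_integral_of_forall_compl_eq_zero h0]
  have := norm_setIntegral_le_of_norm_le_const (μ := volume) (s := Set.Icc a b) (f := F)
    (C := B) (by rw [Real.volume_Icc]; exact ENNReal.ofReal_lt_top) (fun x _ => hB x)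
  rwa [Measure.real, Real.volume_Icc, ENNReal.toReal_ofReal (by linarith)] at this

/-- A planar set whose horizontal and vertical slices are intervals. -/
structure IsSliceConnected (A : Set Plane) : Prop where
  measurableSet : MeasurableSet A
  horizontal : ∀ t, {s | pt s t ∈ A}.OrdConnected
  vertical : ∀ s, {t | pt s t ∈ A}.OrdConnected

theorem IsSliceConnected.setIntegral_divergence_le {A : Set Plane} (hA : IsSliceConnected A)
    {a b c d : ℝ} (hab : a ≤ b) (hcd : c ≤ d) (hbox : A ⊆ box (Set.Icc a b) (Set.Icc c d))
    {Φ : Plane → Plane} (hΦ : ContDiff ℝ 1 Φ) (hc : HasCompactSupport Φ) (h1 : ∀ x, ‖Φ x‖ ≤ 1) :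
    ∫ x in A, divergence Φ x ≤ 2 * ((b - a) + (d - c)) := by
  have hcomp : ∀ i, ContDiff ℝ 1 fun x => Φ x i := fun i => by fun_prop
  have hcs : ∀ i, HasCompactSupport fun x => Φ x i := fun i =>
    hc.comp_left (g := fun y : Plane => y i) rfl
  have hdc : ∀ i, Continuous (pderiv i fun x => Φ x i) := fun i =>
    ((hcomp i).continuous_fderiv one_ne_zero).clm_apply continuous_const
  have hdi : ∀ i, Integrable (pderiv i fun x => Φ x i) := fun i =>
    (hdc i).integrable_of_hasCompactSupport ((hcs i).fderiv_apply (𝕜 := ℝ) _)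
  have hb : ∀ i x, |Φ x i| ≤ 1 := fun i x => (PiLp.norm_apply_le (Φ x) i).trans (h1 x)
  have hind : ∀ i, Integrable (A.indicator (pderiv i fun x => Φ x i)) := fun i =>
    (hdi i).indicator hA.measurableSet
  have hder0 : ∀ s t, HasDerivAt (fun s => Φ (pt s t) 0) (pderiv 0 (fun x => Φ x 0) (pt s t)) s :=
    fun s t => hasDerivAt_comp_pt_left ((hcomp 0).differentiable one_ne_zero) s t
  have hder1 : ∀ s t, HasDerivAt (fun t => Φ (pt s t) 1) (pderiv 1 (fun x => Φ x 1) (pt s t)) t :=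
    fun s t => hasDerivAt_comp_pt_right ((hcomp 1).differentiable one_ne_zero) s t
  have hm0 : ∀ t, MeasurableSet {s | pt s t ∈ A} := fun t =>
    (hA.horizontal t).measurableSet
  have hm1 : ∀ s, MeasurableSet {t | pt s t ∈ A} := fun s =>
    (hA.vertical s).measurableSet
  have key0 : |∫ x, A.indicator (pderiv 0 fun x => Φ x 0) x| ≤ 2 * (d - c) := by
    rw [integral_plane, Measure.volume_eq_prod, integral_prod_symm _ (integrable_plane (hind 0))]
    refine abs_integral_le_of_slices hcd (fun t ht => ?_) fun t => ?_
    · refine (integral_congr_ae (ae_of_all _ fun s => ?_)).trans (integral_zero ℝ ℝ)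
      exact Set.indicator_of_notMem (fun h => ht (hbox h).2) _
    · have e : ∀ s, A.indicator (pderiv 0 fun x => Φ x 0) (pt s t) =
          {s | pt s t ∈ A}.indicator (fun s => pderiv 0 (fun x => Φ x 0) (pt s t)) s :=
        fun s => by simp [Set.indicator]
      simp_rw [e]
      rw [integral_indicator (hm0 t)]
      exact abs_setIntegral_deriv_le (hA.horizontal t) (a := a) (b := b) (fun s hs => (hbox hs).1)
        (fun s => hder0 s t) ((hdc 0).comp (continuous_pt.comp (by fun_prop : Continuous
          fun s : ℝ => (s, t)))) fun s => hb 0 _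
  have key1 : |∫ x, A.indicator (pderiv 1 fun x => Φ x 1) x| ≤ 2 * (b - a) := by
    rw [integral_plane, Measure.volume_eq_prod, integral_prod _ (integrable_plane (hind 1))]
    refine abs_integral_le_of_slices hab (fun s hs => ?_) fun s => ?_
    · refine (integral_congr_ae (ae_of_all _ fun t => ?_)).trans (integral_zero ℝ ℝ)
      exact Set.indicator_of_notMem (fun h => hs (hbox h).1) _
    · have e : ∀ t, A.indicator (pderiv 1 fun x => Φ x 1) (pt s t) =
          {t | pt s t ∈ A}.indicator (fun t => pderiv 1 (fun x => Φ x 1) (pt s t)) t :=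
        fun s => by simp [Set.indicator]
      simp_rw [e]
      rw [integral_indicator (hm1 s)]
      exact abs_setIntegral_deriv_le (hA.vertical s) (a := c) (b := d) (fun t ht => (hbox ht).2)
        (fun t => hder1 s t) ((hdc 1).comp (continuous_pt.comp (by fun_prop : Continuous
          fun t : ℝ => (s, t)))) fun t => hb 1 _
  rw [integral_indicator hA.measurableSet] at key0 key1
  have e : ∫ x in A, divergence Φ x = (∫ x in A, pderiv 0 (fun x => Φ x 0) x) +
      ∫ x in A, pderiv 1 (fun x => Φ x 1) x := by
    rw [← integral_add (hdi 0).integrableOn (hdi 1).integrableOn]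
    simp [divergence, Fin.sum_univ_two]
  rw [e]
  linarith [(abs_le.1 key0).2, (abs_le.1 key1).2]

/-- The total variation of the indicator of a finite disjoint union of sets with connected slices
is bounded by the perimeters of boxes containing them. -/
theorem totalVariation_indicator_le {ι : Type*} {Ω : Set Plane}
    (s : Finset ι) {A : ι → Set Plane}
    (hA : ∀ i ∈ s, IsSliceConnected (A i)) (hAΩ : ∀ i ∈ s, A i ⊆ Ω)
    (hd : Set.PairwiseDisjoint (s : Set ι) A) {B : ι → ℝ}
    (hbox : ∀ i ∈ s, ∃ a b c d : ℝ, a ≤ b ∧ c ≤ d ∧ A i ⊆ box (Set.Icc a b) (Set.Icc c d) ∧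
      2 * ((b - a) + (d - c)) ≤ B i) :
    totalVariation Ω ((⋃ i ∈ s, A i).indicator fun _ => 1) ≤ ENNReal.ofReal (∑ i ∈ s, B i) := by
  refine iSup₂_le fun Φ hΦ => ENNReal.ofReal_le_ofReal ?_
  obtain ⟨h1, h2, -, h4⟩ := hΦ
  have hUm : MeasurableSet (⋃ i ∈ s, A i) := s.measurableSet_biUnion fun i hi => (hA i hi).1
  have hUΩ : (⋃ i ∈ s, A i) ⊆ Ω := Set.iUnion₂_subset hAΩ
  have e : ∀ x, (⋃ i ∈ s, A i).indicator (fun _ => (1 : ℝ)) x * divergence Φ x =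
      (⋃ i ∈ s, A i).indicator (divergence Φ) x := fun x => by
    by_cases hx : x ∈ ⋃ i ∈ s, A i
    · rw [Set.indicator_of_mem hx, Set.indicator_of_mem hx, one_mul]
    · rw [Set.indicator_of_notMem hx, Set.indicator_of_notMem hx, zero_mul]
  simp_rw [e]
  have hdiv : Integrable (divergence Φ) := by
    unfold divergence
    refine integrable_finsetSum _ fun i _ => ?_
    have hcomp : ContDiff ℝ 1 fun x => Φ x i := by fun_prop
    exact ((hcomp.continuous_fderiv one_ne_zero).clm_apply
      continuous_const).integrable_of_hasCompactSupport
      ((h2.comp_left (g := fun y : Plane => y i) rfl).fderiv_apply (𝕜 := ℝ) _)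
  rw [setIntegral_indicator hUm, Set.inter_eq_self_of_subset_right hUΩ,
    integral_biUnion_finset s (fun i hi => (hA i hi).1) hd fun i _ => hdiv.integrableOn]
  refine Finset.sum_le_sum fun i hi => ?_
  obtain ⟨a, b, c, d, hab, hcd, hsub, hB⟩ := hbox i hi
  exact ((hA i hi).setIntegral_divergence_le hab hcd hsub h1 h2 h4).trans hB

/-! ### Second derivatives of functions of one variable -/

/-- The second derivative. -/
noncomputable def d2 (f : ℝ → ℝ) : ℝ → ℝ := deriv (deriv f)

theorem contDiff_deriv_infty {f : ℝ → ℝ} (hf : ContDiff ℝ ∞ f) : ContDiff ℝ ∞ (deriv f) :=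
  (contDiff_infty_iff_deriv.1 hf).2

theorem differentiable_infty {f : ℝ → ℝ} (hf : ContDiff ℝ ∞ f) : Differentiable ℝ f :=
  hf.differentiable (by simp)

theorem contDiff_d2 {f : ℝ → ℝ} (hf : ContDiff ℝ ∞ f) : ContDiff ℝ ∞ (d2 f) :=
  contDiff_deriv_infty (contDiff_deriv_infty hf)

theorem d2_add {f g : ℝ → ℝ} (hf : ContDiff ℝ ∞ f) (hg : ContDiff ℝ ∞ g) (s : ℝ) :
    d2 (fun s => f s + g s) s = d2 f s + d2 g s := by
  have : deriv (fun s => f s + g s) = fun s => deriv f s + deriv g s := funext fun s =>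
    deriv_fun_add (differentiable_infty hf s) (differentiable_infty hg s)
  rw [d2, this]
  exact deriv_fun_add (differentiable_infty (contDiff_deriv_infty hf) s)
    (differentiable_infty (contDiff_deriv_infty hg) s)

theorem d2_sum {ι : Type*} (u : Finset ι) {f : ι → ℝ → ℝ} (hf : ∀ i, ContDiff ℝ ∞ (f i)) (s : ℝ) :
    d2 (fun s => ∑ i ∈ u, f i s) s = ∑ i ∈ u, d2 (f i) s := by
  have : deriv (fun s => ∑ i ∈ u, f i s) = fun s => ∑ i ∈ u, deriv (f i) s := funext fun s =>
    deriv_fun_sum fun i _ => differentiable_infty (hf i) s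
  rw [d2, this]
  exact deriv_fun_sum fun i _ => differentiable_infty (contDiff_deriv_infty (hf i)) s

theorem d2_const_mul (c : ℝ) (f : ℝ → ℝ) (s : ℝ) :
    d2 (fun s => c * f s) s = c * d2 f s := by
  have : deriv (fun s => c * f s) = fun s => c * deriv f s := funext fun s =>
    deriv_const_mul_field c
  rw [d2, this]
  exact deriv_const_mul_field c

theorem d2_affine {f : ℝ → ℝ} (hf : ContDiff ℝ ∞ f) (a b s : ℝ) :
    d2 (fun s => f (a * s + b)) s = a ^ 2 * d2 f (a * s + b) := by
  have key : ∀ {g : ℝ → ℝ}, ContDiff ℝ ∞ g → ∀ s,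
      HasDerivAt (fun s => g (a * s + b)) (deriv g (a * s + b) * a) s := by
    intro g hg s
    have h1 : HasDerivAt (fun s => a * s + b) a s := by
      simpa using ((hasDerivAt_id s).const_mul a).add_const b
    exact HasDerivAt.comp s (differentiable_infty hg (a * s + b)).hasDerivAt h1
  have : deriv (fun s => f (a * s + b)) = fun s => deriv f (a * s + b) * a := funext fun s =>
    (key hf s).deriv
  rw [d2, this, ((key (contDiff_deriv_infty hf) s).mul_const a).deriv, d2]
  ring

theorem d2_eq_of_eventuallyEq {f g : ℝ → ℝ} {s : ℝ} (h : f =ᶠ[nhds s] g) : d2 f s = d2 g s :=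
  h.deriv.deriv_eq

theorem d2_eq_zero_of_eqOn {f : ℝ → ℝ} {U : Set ℝ} (hU : IsOpen U) (h : ∀ s ∈ U, f s = 0) {s : ℝ}
    (hs : s ∈ U) : d2 f s = 0 := by
  rw [d2_eq_of_eventuallyEq (g := fun _ => 0) (Filter.eventually_of_mem (hU.mem_nhds hs) h)]
  simp [d2]

theorem d2_mul_comp {η τ R : ℝ → ℝ} (hη : ContDiff ℝ ∞ η) (hτ : ContDiff ℝ ∞ τ)
    (hR : ContDiff ℝ ∞ R) (c d x : ℝ) :
    d2 (fun x => η x * R (c - d * τ x)) x =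
      d2 η x * R (c - d * τ x) - 2 * d * deriv η x * deriv τ x * deriv R (c - d * τ x) +
      η x * (d ^ 2 * deriv τ x ^ 2 * d2 R (c - d * τ x) - d * d2 τ x * deriv R (c - d * τ x)) := by
  have hin : ∀ x, HasDerivAt (fun x => c - d * τ x) (-(d * deriv τ x)) x := fun x =>
    ((differentiable_infty hτ x).hasDerivAt.const_mul d).const_sub c
  have hcomp : ∀ {g : ℝ → ℝ}, ContDiff ℝ ∞ g → ∀ x,
      HasDerivAt (fun x => g (c - d * τ x)) (deriv g (c - d * τ x) * -(d * deriv τ x)) x :=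
    fun hg x => HasDerivAt.comp x (differentiable_infty hg _).hasDerivAt (hin x)
  have hη' := contDiff_deriv_infty hη
  have hτ' := contDiff_deriv_infty hτ
  have hR' := contDiff_deriv_infty hR
  have h1 : deriv (fun x => η x * R (c - d * τ x)) = fun x =>
      deriv η x * R (c - d * τ x) + η x * (deriv R (c - d * τ x) * -(d * deriv τ x)) :=
    funext fun x => ((differentiable_infty hη x).hasDerivAt.mul (hcomp hR x)).deriv
  have h2 := ((differentiable_infty hη' x).hasDerivAt.mul (hcomp hR x)).add
    ((differentiable_infty hη x).hasDerivAt.mul ((hcomp hR' x).mul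
      (((differentiable_infty hτ' x).hasDerivAt.const_mul d).neg)))
  rw [d2, h1]
  refine h2.deriv.trans ?_
  simp only [d2, Pi.mul_apply, Pi.neg_apply]
  ring

/-! ### Ramps: smooth functions with second derivative close to a step function -/

/-- A smooth approximation of `s ↦ max s 0 ^ 2 / 2`, equal to it outside `(0, 1)`. -/
noncomputable def startRamp (s : ℝ) : ℝ := s ^ 2 / 2 * smoothTransition s

/-- A smooth approximation of `s ↦ max s 0 ^ 2 / 2`, equal to it outside `(-1, 0)`. -/
noncomputable def endRamp (s : ℝ) : ℝ := s ^ 2 / 2 * smoothTransition (s + 1)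

theorem contDiff_smoothTransition : ContDiff ℝ ∞ smoothTransition :=
  Real.smoothTransition.contDiff

theorem contDiff_smoothTransition_comp {E : Type*} [NormedAddCommGroup E] [NormedSpace ℝ E]
    {f : E → ℝ} (hf : ContDiff ℝ ∞ f) : ContDiff ℝ ∞ fun x => smoothTransition (f x) :=
  contDiff_smoothTransition.comp hf

/-- Smooth functions vanishing to second order at the origin, with bounded second derivative. -/
structure IsRamp (K : ℝ) (r : ℝ → ℝ) : Prop where
  contDiff : ContDiff ℝ ∞ r
  d2_le : ∀ s, |d2 r s| ≤ K
  deriv_le : ∀ s, |deriv r s| ≤ K * |s|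
  le : ∀ s, |r s| ≤ K * |s| ^ 2

theorem d2_half_sq (s : ℝ) : d2 (fun s => s ^ 2 / 2) s = 1 := by
  have h : deriv (fun s : ℝ => s ^ 2 / 2) = fun s => s := funext fun s => by
    simp
  rw [d2, h]
  simp

theorem exists_isRamp_sq_mul (c : ℝ) :
    ∃ K, IsRamp K fun s => s ^ 2 / 2 * smoothTransition (s + c) := by
  set r : ℝ → ℝ := fun s => s ^ 2 / 2 * smoothTransition (s + c) with hr
  have hg : ContDiff ℝ ∞ fun s => smoothTransition (s + c) :=
    contDiff_smoothTransition_comp (by fun_prop)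
  have hs : ContDiff ℝ ∞ r := ContDiff.mul (by fun_prop) hg
  obtain ⟨K, hK⟩ := (isCompact_Icc (a := -c) (b := 1 - c)).exists_bound_of_continuousOn
    (contDiff_d2 hs).continuous.continuousOn
  have hd2 : ∀ s, |d2 r s| ≤ max K 1 := by
    intro s
    rcases lt_or_ge s (-c) with h1 | h1
    · rw [d2_eq_zero_of_eqOn isOpen_Iio (fun t ht => ?_) (Set.mem_Iio.2 h1)]
      · simp
      · rw [hr]
        simp only
        rw [Real.smoothTransition.zero_of_nonpos (by linarith [Set.mem_Iio.1 ht]), mul_zero]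
    rcases le_or_gt s (1 - c) with h2 | h2
    · exact (hK s ⟨h1, h2⟩).trans (le_max_left _ _)
    · rw [d2_eq_of_eventuallyEq (g := fun s => s ^ 2 / 2), d2_half_sq]
      · simp
      · filter_upwards [lt_mem_nhds h2] with t ht
        rw [hr]
        simp only
        rw [Real.smoothTransition.one_of_one_le (by linarith), mul_one]
  have hd0 : deriv r 0 = 0 := by
    have h := ((((hasDerivAt_id (0 : ℝ)).pow 2).div_const 2).mul
      (differentiable_infty hg 0).hasDerivAt)
    refine h.deriv.trans ?_
    simp
  have hr0 : r 0 = 0 := by simp [hr]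
  have hd1 : ∀ s, |deriv r s| ≤ max K 1 * |s| := by
    intro s
    have := Convex.norm_image_sub_le_of_norm_deriv_le (f := deriv r) (s := Set.univ) (C := max K 1)
      (fun x _ => differentiable_infty (contDiff_deriv_infty hs) x) (fun x _ => hd2 x)
      convex_univ (Set.mem_univ 0) (Set.mem_univ s)
    simpa [hd0] using this
  have hKpos : 0 ≤ max K 1 := zero_le_one.trans (le_max_right _ _)
  refine ⟨max K 1, hs, hd2, hd1, fun s => ?_⟩
  have := Convex.norm_image_sub_le_of_norm_deriv_le (f := r) (s := Set.Icc (-|s|) |s|)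
    (C := max K 1 * |s|) (fun x _ => differentiable_infty hs x)
    (fun x hx => (hd1 x).trans (mul_le_mul_of_nonneg_left (abs_le.2 hx) hKpos))
    (convex_Icc _ _) (x := 0) (by simp) (y := s) ⟨neg_abs_le s, le_abs_self s⟩
  simpa [hr0, sq, mul_assoc] using this

theorem IsRamp.mono {K K' : ℝ} {r : ℝ → ℝ} (h : IsRamp K r) (hK : K ≤ K') : IsRamp K' r :=
  ⟨h.1, fun s => (h.2 s).trans hK,
    fun s => (h.3 s).trans (mul_le_mul_of_nonneg_right hK (abs_nonneg _)),
    fun s => (h.4 s).trans (mul_le_mul_of_nonneg_right hK (by positivity))⟩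

theorem exists_isRamp : ∃ K, 0 ≤ K ∧ IsRamp K startRamp ∧ IsRamp K endRamp := by
  obtain ⟨K, hK⟩ := exists_isRamp_sq_mul 0
  obtain ⟨K', hK'⟩ := exists_isRamp_sq_mul 1
  refine ⟨max 0 (max K K'), le_max_left _ _, ?_, ?_⟩
  · simp only [add_zero] at hK
    exact hK.mono (by simp)
  · exact hK'.mono (by simp)

/-- The rescaling of a ramp which preserves the size of its second derivative. -/
noncomputable def scaled (r : ℝ → ℝ) (δ s : ℝ) : ℝ := δ ^ 2 * r (s / δ)

theorem IsRamp.scaled {K : ℝ} {r : ℝ → ℝ} (h : IsRamp K r) {δ : ℝ} (hδ : 0 < δ) :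
    IsRamp K (scaled r δ) := by
  have hder : deriv (SymGradTwoWell.scaled r δ) = fun s => δ * deriv r (s / δ) := by
    funext s
    have h1 := (HasDerivAt.comp s (differentiable_infty h.1 (s / δ)).hasDerivAt
      ((hasDerivAt_id s).div_const δ)).const_mul (δ ^ 2)
    refine h1.deriv.trans ?_
    field_simp
  have hd2 : ∀ s, d2 (SymGradTwoWell.scaled r δ) s = d2 r (s / δ) := by
    intro s
    rw [d2, hder]
    have h1 := (HasDerivAt.comp s (differentiable_infty (contDiff_deriv_infty h.1) (s / δ)).hasDerivAt
      ((hasDerivAt_id s).div_const δ)).const_mul δ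
    refine h1.deriv.trans ?_
    rw [d2]
    field_simp
  refine ⟨contDiff_const.mul (h.1.comp (by fun_prop)), fun s => (hd2 s).symm ▸ h.2 _, fun s => ?_,
    fun s => ?_⟩
  · rw [hder]
    simp only [abs_mul, abs_of_pos hδ]
    refine (mul_le_mul_of_nonneg_left (h.3 _) hδ.le).trans (le_of_eq ?_)
    rw [abs_div, abs_of_pos hδ]
    field_simp
  · rw [SymGradTwoWell.scaled, abs_mul, abs_of_pos (by positivity : 0 < δ ^ 2)]
    refine (mul_le_mul_of_nonneg_left (h.4 _) (by positivity)).trans (le_of_eq ?_)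
    rw [abs_div, abs_of_pos hδ]
    field_simp

theorem scaled_startRamp_of_nonpos {δ s : ℝ} (hδ : 0 < δ) (hs : s ≤ 0) :
    scaled startRamp δ s = 0 := by
  rw [scaled, startRamp, Real.smoothTransition.zero_of_nonpos (div_nonpos_of_nonpos_of_nonneg hs
    hδ.le)]
  ring

theorem scaled_startRamp_of_le {δ s : ℝ} (hδ : 0 < δ) (hs : δ ≤ s) :
    scaled startRamp δ s = s ^ 2 / 2 := by
  rw [scaled, startRamp, Real.smoothTransition.one_of_one_le ((one_le_div hδ).2 hs)]
  field_simp

theorem scaled_endRamp_of_le {δ s : ℝ} (hδ : 0 < δ) (hs : s ≤ -δ) : scaled endRamp δ s = 0 := by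
  have : s / δ ≤ -1 := by rw [div_le_iff₀ hδ]; linarith
  rw [scaled, endRamp, Real.smoothTransition.zero_of_nonpos (by linarith)]
  ring

theorem scaled_endRamp_of_nonneg {δ s : ℝ} (hδ : 0 < δ) (hs : 0 ≤ s) :
    scaled endRamp δ s = s ^ 2 / 2 := by
  have : 0 ≤ s / δ := by positivity
  rw [scaled, endRamp, Real.smoothTransition.one_of_one_le (by linarith)]
  field_simp

theorem d2_scaled_startRamp {δ s : ℝ} (hδ : 0 < δ) (hs : s ≤ 0 ∨ δ < s) :
    d2 (scaled startRamp δ) s = if 0 < s then 1 else 0 := by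
  have hneg : ∀ s < 0, d2 (scaled startRamp δ) s = 0 := fun s hs =>
    d2_eq_zero_of_eqOn isOpen_Iio (fun t ht => scaled_startRamp_of_nonpos hδ (le_of_lt ht)) hs
  rcases hs with hs | hs
  · rw [if_neg (not_lt.2 hs)]
    rcases hs.lt_or_eq with h | rfl
    · exact hneg s h
    · obtain ⟨K, -, hK, -⟩ := exists_isRamp
      have hc : Continuous (d2 (scaled startRamp δ)) := (contDiff_d2 (hK.scaled hδ).1).continuous
      have h1 : Set.EqOn (d2 (scaled startRamp δ)) (fun _ => 0) (closure (Set.Iio 0)) :=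
        Set.EqOn.closure (fun s hs => hneg s hs) hc continuous_const
      exact h1 (by simp)
  · rw [if_pos (hδ.trans hs), d2_eq_of_eventuallyEq (g := fun s => s ^ 2 / 2), d2_half_sq]
    filter_upwards [lt_mem_nhds hs] with _ ht using scaled_startRamp_of_le hδ (le_of_lt ht)

theorem d2_scaled_endRamp {δ s : ℝ} (hδ : 0 < δ) (hs : s < -δ) : d2 (scaled endRamp δ) s = 0 :=
  d2_eq_zero_of_eqOn isOpen_Iio (fun _ ht => scaled_endRamp_of_le hδ (le_of_lt ht)) hs

/-! ### The profile of a cell -/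

/-- The factor with which the second derivative of `profile` jumps at its transition points. -/
noncomputable def jump : Fin 6 → ℝ := ![1, -2, 2, -2, 2, -1]

/-- The transition points of `profile` at time `0`. -/
noncomputable def base : Fin 6 → ℝ := ![0, 1 / 4, 1 / 2, 1 / 2, 3 / 4, 1]

/-- The velocity of the transition points of `profile`. -/
noncomputable def slope : Fin 6 → ℝ := ![0, -1 / 8, -1 / 8, 1 / 8, 1 / 8, 0]

/-- The ramps composing `profile`. -/
noncomputable def kind : Fin 6 → ℝ → ℝ :=
  ![startRamp, startRamp, startRamp, startRamp, startRamp, endRamp]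

/-- A function on the unit cell with second derivative close to `±1`. The second derivative is
negative on two intervals of length `1 / 4`, which for `t = 0` join to `(1 / 4, 3 / 4)` and for
`t = 1` are the middle halves of the two halves of the cell. -/
noncomputable def profile (δ t z : ℝ) : ℝ :=
  ∑ i, jump i * scaled (kind i) δ (z - base i - slope i * t)

theorem abs_jump_le (i : Fin 6) : |jump i| ≤ 2 := by
  fin_cases i <;> simp [jump]

theorem abs_slope_le (i : Fin 6) : |slope i| ≤ 1 := by
  fin_cases i <;> simp [slope, abs_div] <;> norm_num

theorem position_mem {t : ℝ} (ht : t ∈ Set.Icc (0 : ℝ) 1) (i : Fin 6) :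
    base i + slope i * t ∈ Set.Icc (0 : ℝ) 1 := by
  obtain ⟨h0, h1⟩ := ht
  fin_cases i <;> simp [base, slope] <;> (try constructor) <;> linarith

theorem isRamp_kind {K : ℝ} (h1 : IsRamp K startRamp) (h2 : IsRamp K endRamp) (i : Fin 6) :
    IsRamp K (kind i) := by
  fin_cases i <;> simp only [kind] <;> first | exact h1 | exact h2

theorem contDiff_scaled_kind {δ : ℝ} (hδ : 0 < δ) (i : Fin 6) :
    ContDiff ℝ ∞ (scaled (kind i) δ) := by
  obtain ⟨K, -, h1, h2⟩ := exists_isRamp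
  exact ((isRamp_kind h1 h2 i).scaled hδ).1

theorem profile_of_nonpos {δ t z : ℝ} (hδ : 0 < δ) (hδ1 : δ ≤ 1 / 8) (ht : t ∈ Set.Icc (0 : ℝ) 1)
    (hz : z ≤ 0) : profile δ t z = 0 := by
  obtain ⟨h0, h1⟩ := ht
  simp only [profile, Fin.sum_univ_six, jump, base, slope, kind]
  simp
  rw [scaled_startRamp_of_nonpos hδ hz, scaled_startRamp_of_nonpos hδ (by linarith),
    scaled_startRamp_of_nonpos hδ (by linarith), scaled_startRamp_of_nonpos hδ (by linarith),
    scaled_startRamp_of_nonpos hδ (by linarith), scaled_endRamp_of_le hδ (by linarith)]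
  ring

theorem profile_of_one_le {δ t z : ℝ} (hδ : 0 < δ) (hδ1 : δ ≤ 1 / 8) (ht : t ∈ Set.Icc (0 : ℝ) 1)
    (hz : 1 ≤ z) : profile δ t z = 0 := by
  obtain ⟨h0, h1⟩ := ht
  simp only [profile, Fin.sum_univ_six, jump, base, slope, kind]
  simp
  rw [scaled_startRamp_of_le hδ (by linarith), scaled_startRamp_of_le hδ (by linarith),
    scaled_startRamp_of_le hδ (by linarith), scaled_startRamp_of_le hδ (by linarith),
    scaled_startRamp_of_le hδ (by linarith), scaled_endRamp_of_nonneg hδ (by linarith)]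
  ring

theorem contDiff_profile {E : Type*} [NormedAddCommGroup E] [NormedSpace ℝ E] {δ : ℝ} (hδ : 0 < δ)
    {f g : E → ℝ} (hf : ContDiff ℝ ∞ f) (hg : ContDiff ℝ ∞ g) :
    ContDiff ℝ ∞ fun x => profile δ (f x) (g x) :=
  ContDiff.sum fun i _ => contDiff_const.mul ((contDiff_scaled_kind hδ i).comp
    ((hg.sub contDiff_const).sub (contDiff_const.mul hf)))

theorem d2_profile {δ : ℝ} (hδ : 0 < δ) (t z : ℝ) :
    d2 (profile δ t) z = ∑ i, jump i * d2 (scaled (kind i) δ) (z - base i - slope i * t) := by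
  have e : profile δ t = fun z => ∑ i, jump i * (fun z => scaled (kind i) δ
      (1 * z + (-base i - slope i * t))) z := by
    funext z
    refine Finset.sum_congr rfl fun i _ => ?_
    congr 2
    ring
  have hs : ∀ i, ContDiff ℝ ∞ fun z : ℝ => scaled (kind i) δ (1 * z + (-base i - slope i * t)) :=
    fun i => (contDiff_scaled_kind hδ i).comp (by fun_prop)
  rw [e, d2_sum _ fun i => contDiff_const.mul (hs i)]
  refine Finset.sum_congr rfl fun i _ => ?_
  rw [d2_const_mul, d2_affine (contDiff_scaled_kind hδ i)]
  congr 2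
  rw [one_pow, one_mul]
  congr 1
  ring

/-- The indicator of the set where the second derivative of `profile` is negative. -/
noncomputable def needle (t z : ℝ) : ℝ :=
  if (1 / 4 - t / 8 < z ∧ z ≤ 1 / 2 - t / 8) ∨ (1 / 2 + t / 8 < z ∧ z ≤ 3 / 4 + t / 8) then 1 else 0

theorem eventually_d2_profile {t z : ℝ} (ht : t ∈ Set.Icc (0 : ℝ) 1) (hz : z ∈ Set.Ioo (0 : ℝ) 1) :
    ∀ᶠ δ in nhdsWithin (0 : ℝ) (Set.Ioi 0), d2 (profile δ t) z = 1 - 2 * needle t z := by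
  have hev : ∀ s : ℝ, ∀ᶠ δ in nhdsWithin (0 : ℝ) (Set.Ioi 0), s ≤ 0 ∨ δ < s := by
    intro s
    rcases le_or_gt s 0 with h | h
    · exact Filter.Eventually.of_forall fun _ => Or.inl h
    · filter_upwards [nhdsWithin_le_nhds (gt_mem_nhds h)] with δ hδ using Or.inr hδ
  have hend : ∀ᶠ δ in nhdsWithin (0 : ℝ) (Set.Ioi 0), δ < 1 - z :=
    nhdsWithin_le_nhds (gt_mem_nhds (by linarith [hz.2]))
  filter_upwards [self_mem_nhdsWithin, hev z, hev (z - 1 / 4 - (-1 / 8) * t),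
    hev (z - 1 / 2 - (-1 / 8) * t), hev (z - 1 / 2 - (1 / 8) * t), hev (z - 3 / 4 - (1 / 8) * t),
    hend] with δ hδ e0 e1 e2 e3 e4 e5
  have hδ' : 0 < δ := hδ
  rw [d2_profile hδ']
  simp only [Fin.sum_univ_six, jump, base, slope, kind, Matrix.cons_val_zero, Matrix.cons_val_one,
    Matrix.cons_val, sub_zero, zero_mul]
  rw [d2_scaled_startRamp hδ' e0, d2_scaled_startRamp hδ' e1, d2_scaled_startRamp hδ' e2,
    d2_scaled_startRamp hδ' e3, d2_scaled_startRamp hδ' e4, d2_scaled_endRamp hδ' (by linarith)]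
  obtain ⟨h0, h1⟩ := ht
  rw [if_pos hz.1, needle]
  have r1 : 0 < z - 1 / 4 - (-1 / 8) * t ↔ 1 / 4 - t / 8 < z := by
    constructor <;> intro h <;> linarith
  have r2 : 0 < z - 1 / 2 - (-1 / 8) * t ↔ 1 / 2 - t / 8 < z := by
    constructor <;> intro h <;> linarith
  have r3 : 0 < z - 1 / 2 - (1 / 8) * t ↔ 1 / 2 + t / 8 < z := by
    constructor <;> intro h <;> linarith
  have r4 : 0 < z - 3 / 4 - (1 / 8) * t ↔ 3 / 4 + t / 8 < z := by
    constructor <;> intro h <;> linarith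
  simp only [r1, r2, r3, r4]
  rcases le_or_gt z (1 / 4 - t / 8) with c1 | c1
  · rw [if_neg (not_lt.2 c1), if_neg (by linarith : ¬ 1 / 2 - t / 8 < z),
      if_neg (by linarith : ¬ 1 / 2 + t / 8 < z), if_neg (by linarith : ¬ 3 / 4 + t / 8 < z),
      if_neg]
    · norm_num
    · rintro (h | h) <;> linarith [h.1]
  rcases le_or_gt z (1 / 2 - t / 8) with c2 | c2
  · rw [if_pos c1, if_neg (not_lt.2 c2),
      if_neg (by linarith : ¬ 1 / 2 + t / 8 < z), if_neg (by linarith : ¬ 3 / 4 + t / 8 < z),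
      if_pos (Or.inl ⟨c1, c2⟩)]
    norm_num
  rcases le_or_gt z (1 / 2 + t / 8) with c3 | c3
  · rw [if_pos c1, if_pos c2, if_neg (not_lt.2 c3), if_neg (by linarith : ¬ 3 / 4 + t / 8 < z),
      if_neg]
    · norm_num
    · rintro (h | h) <;> linarith [h.1, h.2]
  rcases le_or_gt z (3 / 4 + t / 8) with c4 | c4
  · rw [if_pos c1, if_pos c2, if_pos c3, if_neg (not_lt.2 c4), if_pos (Or.inr ⟨c3, c4⟩)]
    norm_num
  · rw [if_pos c1, if_pos c2, if_pos c3, if_pos c4, if_neg]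
    · norm_num
    · rintro (h | h) <;> linarith [h.1, h.2]

/-- The pattern after the splitting of the needles is the pattern of the next generation. -/
theorem needle_one_eq {z : ℝ} (hz : z ∈ Set.Ioo (0 : ℝ) 1) :
    needle 1 z = needle 0 (Int.fract (2 * z)) := by
  obtain ⟨h0, h1⟩ := hz
  rcases lt_or_ge z (1 / 2) with h | h
  · have e : Int.fract (2 * z) = 2 * z := Int.fract_eq_self.2 ⟨by linarith, by linarith⟩
    rw [e, needle, needle]
    refine if_congr ?_ rfl rfl
    constructor
    · rintro (⟨a, b⟩ | ⟨a, b⟩)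
      · rcases le_or_gt z (1 / 4) with c | c
        · exact Or.inl ⟨by linarith, by linarith⟩
        · exact Or.inr ⟨by linarith, by linarith⟩
      · linarith
    · rintro (⟨a, b⟩ | ⟨a, b⟩) <;> exact Or.inl ⟨by linarith, by linarith⟩
  · have e : Int.fract (2 * z) = 2 * z - 1 := by
      rw [Int.fract_eq_iff]
      exact ⟨by linarith, by linarith, 1, by push_cast; ring⟩
    rw [e, needle, needle]
    refine if_congr ?_ rfl rfl
    constructor
    · rintro (⟨a, b⟩ | ⟨a, b⟩)
      · linarith
      · rcases le_or_gt z (3 / 4) with c | c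
        · exact Or.inl ⟨by linarith, by linarith⟩
        · exact Or.inr ⟨by linarith, by linarith⟩
    · rintro (⟨a, b⟩ | ⟨a, b⟩) <;> exact Or.inr ⟨by linarith, by linarith⟩

/-! ### The branching cell -/

/-- The cutoff of a generation, supported in `[4 / 9, 2]`. -/
noncomputable def window (x : ℝ) : ℝ := smoothTransition (9 / 4 * x - 1) - smoothTransition (x - 1)

/-- The time of the splitting, equal to `1` for `x ≤ 8 / 9` and to `0` for `x ≥ 1`. -/
noncomputable def clock (x : ℝ) : ℝ := smoothTransition (9 * (1 - x))

theorem contDiff_window : ContDiff ℝ ∞ window :=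
  (contDiff_smoothTransition_comp (by fun_prop)).sub (contDiff_smoothTransition_comp (by fun_prop))

theorem contDiff_clock : ContDiff ℝ ∞ clock := contDiff_smoothTransition_comp (by fun_prop)

theorem clock_mem (x : ℝ) : clock x ∈ Set.Icc (0 : ℝ) 1 :=
  ⟨Real.smoothTransition.nonneg _, Real.smoothTransition.le_one _⟩

theorem clock_of_one_le {x : ℝ} (hx : 1 ≤ x) : clock x = 0 :=
  Real.smoothTransition.zero_of_nonpos (by linarith)

theorem clock_of_le {x : ℝ} (hx : x ≤ 8 / 9) : clock x = 1 :=
  Real.smoothTransition.one_of_one_le (by linarith)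

theorem clock_antitone : Antitone clock := fun _ _ h =>
  Real.smoothTransition.monotone (by linarith)

theorem window_of_le {x : ℝ} (hx : x ≤ 4 / 9) : window x = 0 := by
  rw [window, Real.smoothTransition.zero_of_nonpos (by linarith),
    Real.smoothTransition.zero_of_nonpos (by linarith), sub_zero]

theorem window_of_two_le {x : ℝ} (hx : 2 ≤ x) : window x = 0 := by
  rw [window, Real.smoothTransition.one_of_one_le (by linarith),
    Real.smoothTransition.one_of_one_le (by linarith), sub_self]

theorem window_nonneg (x : ℝ) : 0 ≤ window x := by
  rcases le_or_gt x 0 with h | h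
  · rw [window_of_le (by linarith)]
  · exact sub_nonneg.2 (Real.smoothTransition.monotone (by linarith))

/-- The profile during a splitting, cut off by the window. -/
noncomputable def cell (δ x z : ℝ) : ℝ := window x * profile δ (clock x) z

theorem cell_eq_zero {δ x z : ℝ} (hδ : 0 < δ) (hδ1 : δ ≤ 1 / 8) (hz : z ∉ Set.Ioo (0 : ℝ) 1) :
    cell δ x z = 0 := by
  rw [cell]
  rcases le_or_gt z 0 with h | h
  · rw [profile_of_nonpos hδ hδ1 (clock_mem x) h, mul_zero]
  · rw [profile_of_one_le hδ hδ1 (clock_mem x) (not_lt.1 fun h1 => hz ⟨h, h1⟩), mul_zero]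

theorem contDiff_cell {E : Type*} [NormedAddCommGroup E] [NormedSpace ℝ E] {δ : ℝ} (hδ : 0 < δ)
    {f g : E → ℝ} (hf : ContDiff ℝ ∞ f) (hg : ContDiff ℝ ∞ g) :
    ContDiff ℝ ∞ fun x => cell δ (f x) (g x) :=
  (contDiff_window.comp hf).mul (contDiff_profile hδ (contDiff_clock.comp hf) hg)

theorem abs_d2_mul_comp_le {η₀ η₁ η₂ τ₁ τ₂ R₀ R₁ R₂ d H K : ℝ} (hd : |d| ≤ 1) (hH : 0 ≤ H)
    (h0 : |η₀| ≤ H) (h1 : |η₁| ≤ H) (h2 : |η₂| ≤ H) (ht1 : |τ₁| ≤ H) (ht2 : |τ₂| ≤ H)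
    (r0 : |R₀| ≤ K) (r1 : |R₁| ≤ K) (r2 : |R₂| ≤ K) :
    |η₂ * R₀ - 2 * d * η₁ * τ₁ * R₁ + η₀ * (d ^ 2 * τ₁ ^ 2 * R₂ - d * τ₂ * R₁)| ≤
      K * (H + 3 * H ^ 2 + H ^ 3) := by
  have e1 : |η₂ * R₀| ≤ H * K := by rw [abs_mul]; gcongr
  have e2 : |d * η₁ * τ₁ * R₁| ≤ 1 * H * H * K := by simp only [abs_mul]; gcongr
  have e3 : |η₀ * (d ^ 2 * τ₁ ^ 2 * R₂)| ≤ H * (1 ^ 2 * H ^ 2 * K) := by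
    simp only [abs_mul, abs_pow]; gcongr
  have e4 : |η₀ * (d * τ₂ * R₁)| ≤ H * (1 * H * K) := by simp only [abs_mul]; gcongr
  have a1 := abs_le.1 e1
  have a2 := abs_le.1 e2
  have a3 := abs_le.1 e3
  have a4 := abs_le.1 e4
  rw [abs_le]
  constructor <;> nlinarith [a1.1, a1.2, a2.1, a2.2, a3.1, a3.2, a4.1, a4.2]

theorem exists_bound_d2_cell : ∃ C, 0 ≤ C ∧ ∀ δ, 0 < δ → δ ≤ 1 / 8 → ∀ x z,
    |d2 (fun x => cell δ x z) x| ≤ if x ≤ 2 ∧ z ∈ Set.Ioo (0 : ℝ) 1 then C else 0 := by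
  obtain ⟨K, hK0, hs, he⟩ := exists_isRamp
  have hbd : ∀ f : ℝ → ℝ, Continuous f → ∃ H, ∀ x ∈ Set.Icc (0 : ℝ) 2, |f x| ≤ H := fun f hf =>
    isCompact_Icc.exists_bound_of_continuousOn hf.continuousOn
  obtain ⟨H0, hH0⟩ := hbd _ contDiff_window.continuous
  obtain ⟨H1, hH1⟩ := hbd _ (contDiff_deriv_infty contDiff_window).continuous
  obtain ⟨H2, hH2⟩ := hbd _ (contDiff_d2 contDiff_window).continuous
  obtain ⟨H3, hH3⟩ := hbd _ (contDiff_deriv_infty contDiff_clock).continuous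
  obtain ⟨H4, hH4⟩ := hbd _ (contDiff_d2 contDiff_clock).continuous
  set H := |H0| + |H1| + |H2| + |H3| + |H4| with hH
  have n0 := abs_nonneg H0
  have n1 := abs_nonneg H1
  have n2 := abs_nonneg H2
  have n3 := abs_nonneg H3
  have n4 := abs_nonneg H4
  have hHnn : 0 ≤ H := by positivity
  refine ⟨12 * (K * (H + 3 * H ^ 2 + H ^ 3)), by positivity, fun δ hδ hδ1 x z => ?_⟩
  rcases lt_or_ge x 0 with hx0 | hx0
  · rw [d2_eq_zero_of_eqOn (U := Set.Iio 0) isOpen_Iio (fun y hy => ?_) hx0, abs_zero]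
    · split_ifs <;> positivity
    · rw [cell, window_of_le (by linarith [Set.mem_Iio.1 hy]), zero_mul]
  rcases lt_or_ge 2 x with hx2 | hx2
  · rw [d2_eq_zero_of_eqOn (U := Set.Ioi 2) isOpen_Ioi (fun y hy => ?_) hx2, abs_zero]
    · split_ifs <;> positivity
    · rw [cell, window_of_two_le (le_of_lt hy), zero_mul]
  by_cases hz : z ∈ Set.Ioo (0 : ℝ) 1
  swap
  · rw [d2_eq_zero_of_eqOn (U := Set.univ) isOpen_univ (fun y _ => cell_eq_zero hδ hδ1 hz)
      (Set.mem_univ x), abs_zero, if_neg fun h => hz h.2]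
  rw [if_pos ⟨hx2, hz⟩]
  have hx : x ∈ Set.Icc (0 : ℝ) 2 := ⟨hx0, hx2⟩
  have e : (fun x => cell δ x z) = fun x => ∑ i, jump i *
      (fun x => window x * scaled (kind i) δ ((z - base i) - slope i * clock x)) x := by
    funext x
    rw [cell, profile, Finset.mul_sum]
    exact Finset.sum_congr rfl fun i _ => by ring
  have hterm : ∀ i, ContDiff ℝ ∞ fun x =>
      window x * scaled (kind i) δ ((z - base i) - slope i * clock x) := fun i =>
    contDiff_window.mul ((contDiff_scaled_kind hδ i).comp
      (contDiff_const.sub (contDiff_const.mul contDiff_clock)))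
  rw [e, d2_sum _ fun i => contDiff_const.mul (hterm i)]
  have hone : ∀ i, |d2 (fun x => jump i *
      (fun x => window x * scaled (kind i) δ ((z - base i) - slope i * clock x)) x) x| ≤
      2 * (K * (H + 3 * H ^ 2 + H ^ 3)) := by
    intro i
    rw [d2_const_mul, abs_mul]
    refine mul_le_mul (abs_jump_le i) ?_ (abs_nonneg _) zero_le_two
    rw [d2_mul_comp contDiff_window contDiff_clock (contDiff_scaled_kind hδ i)]
    have hr := (isRamp_kind hs he i).scaled hδ
    have hpos := position_mem (clock_mem x) i
    have hs1 : |z - base i - slope i * clock x| ≤ 1 := by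
      rw [abs_le]; constructor <;> linarith [hz.1, hz.2, hpos.1, hpos.2]
    have l0 := le_abs_self H0
    have l1 := le_abs_self H1
    have l2 := le_abs_self H2
    have l3 := le_abs_self H3
    have l4 := le_abs_self H4
    refine abs_d2_mul_comp_le (abs_slope_le i) hHnn ((hH0 x hx).trans (by linarith))
      ((hH1 x hx).trans (by linarith)) ((hH2 x hx).trans (by linarith))
      ((hH3 x hx).trans (by linarith)) ((hH4 x hx).trans (by linarith)) ?_ ?_ (hr.d2_le _)
    · refine (hr.le _).trans (mul_le_of_le_one_right hK0 (pow_le_one₀ (abs_nonneg _) hs1))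
    · exact (hr.deriv_le _).trans (mul_le_of_le_one_right hK0 hs1)
  refine (Finset.abs_sum_le_sum_abs _ _).trans ((Finset.sum_le_sum fun i _ => hone i).trans ?_)
  simp only [Finset.sum_const, Finset.card_univ, Fintype.card_fin, nsmul_eq_mul]
  apply le_of_eq
  push_cast
  ring

theorem exists_bound_d2_profile : ∃ C, 0 ≤ C ∧ ∀ δ, 0 < δ → ∀ t z, |d2 (profile δ t) z| ≤ C := by
  obtain ⟨K, hK0, hs, he⟩ := exists_isRamp
  refine ⟨12 * K, by positivity, fun δ hδ t z => ?_⟩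
  rw [d2_profile hδ]
  have hone : ∀ i, |jump i * d2 (scaled (kind i) δ) (z - base i - slope i * t)| ≤ 2 * K := by
    intro i
    rw [abs_mul]
    exact mul_le_mul (abs_jump_le i) (((isRamp_kind hs he i).scaled hδ).d2_le _) (abs_nonneg _)
      zero_le_two
  refine (Finset.abs_sum_le_sum_abs _ _).trans ((Finset.sum_le_sum fun i _ => hone i).trans ?_)
  simp only [Finset.sum_const, Finset.card_univ, Fintype.card_fin, nsmul_eq_mul]
  apply le_of_eq
  push_cast
  ring

/-! ### The branching potential -/

/-- The superposition of the generations `0, …, N` of cells of width `1 / (n 2 ^ j)`. -/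
noncomputable def layers (δ : ℝ) (n N : ℕ) (x y : ℝ) : ℝ :=
  ∑ j ∈ Finset.range (N + 1), ∑ k ∈ Finset.range (n * 2 ^ j),
    (((n * 2 ^ j : ℕ) : ℝ) ^ 2)⁻¹ * cell δ ((9 / 4) ^ j * x) ((n * 2 ^ j : ℕ) * y - k)

/-- The potential, branching towards both vertical sides of the unit square. -/
noncomputable def branching (δ : ℝ) (n N : ℕ) (p : Plane) : ℝ :=
  layers δ n N (3 * p 0) (p 1) + layers δ n N (3 - 3 * p 0) (p 1)

theorem contDiff_layers {E : Type*} [NormedAddCommGroup E] [NormedSpace ℝ E] {δ : ℝ} (hδ : 0 < δ)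
    (n N : ℕ) {f g : E → ℝ} (hf : ContDiff ℝ ∞ f) (hg : ContDiff ℝ ∞ g) :
    ContDiff ℝ ∞ fun p => layers δ n N (f p) (g p) :=
  ContDiff.sum fun _ _ => ContDiff.sum fun _ _ => contDiff_const.mul
    (contDiff_cell hδ (contDiff_const.mul hf) ((contDiff_const.mul hg).sub contDiff_const))

theorem layers_eq_zero_of_notMem {δ : ℝ} (hδ : 0 < δ) (hδ1 : δ ≤ 1 / 8) (n N : ℕ) (x : ℝ) {y : ℝ}
    (hy : y ∉ Set.Ioo (0 : ℝ) 1) : layers δ n N x y = 0 := by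
  refine Finset.sum_eq_zero fun j _ => Finset.sum_eq_zero fun k hk => ?_
  rw [cell_eq_zero hδ hδ1, mul_zero]
  rintro ⟨h1, h2⟩
  have hk' : (k : ℝ) + 1 ≤ (n * 2 ^ j : ℕ) := by exact_mod_cast Finset.mem_range.1 hk
  have hk0 : (0 : ℝ) ≤ k := Nat.cast_nonneg k
  have hM : (0 : ℝ) < (n * 2 ^ j : ℕ) := by linarith
  refine hy ⟨?_, ?_⟩
  · by_contra h
    nlinarith [not_lt.1 h]
  · by_contra h
    nlinarith [not_lt.1 h]

theorem layers_eq_zero_of_nonpos (δ : ℝ) (n N : ℕ) {x : ℝ} (hx : x ≤ 0) (y : ℝ) :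
    layers δ n N x y = 0 := by
  refine Finset.sum_eq_zero fun j _ => Finset.sum_eq_zero fun k _ => ?_
  have : (9 / 4 : ℝ) ^ j * x ≤ 0 := mul_nonpos_of_nonneg_of_nonpos (by positivity) hx
  rw [cell, window_of_le (by linarith), zero_mul, mul_zero]

theorem layers_eq_zero_of_two_le (δ : ℝ) (n N : ℕ) {x : ℝ} (hx : 2 ≤ x) (y : ℝ) :
    layers δ n N x y = 0 := by
  refine Finset.sum_eq_zero fun j _ => Finset.sum_eq_zero fun k _ => ?_
  have h1 : (1 : ℝ) ≤ (9 / 4) ^ j := one_le_pow₀ (by norm_num)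
  rw [cell, window_of_two_le (by nlinarith), zero_mul, mul_zero]

theorem branching_eq_zero {δ : ℝ} (hδ : 0 < δ) (hδ1 : δ ≤ 1 / 8) (n N : ℕ) {p : Plane}
    (hp : p ∉ unitSquare) : branching δ n N p = 0 := by
  rw [branching]
  by_cases hy : p 1 ∈ Set.Ioo (0 : ℝ) 1
  · have hx : p 0 ≤ 0 ∨ 1 ≤ p 0 := by
      by_contra! h
      exact hp (unitSquare_eq_box ▸ ⟨h, hy⟩)
    rcases hx with h | h
    · rw [layers_eq_zero_of_nonpos _ _ _ (by linarith), layers_eq_zero_of_two_le _ _ _ (by linarith),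
        add_zero]
    · rw [layers_eq_zero_of_two_le _ _ _ (by linarith), layers_eq_zero_of_nonpos _ _ _ (by linarith),
        add_zero]
  · rw [layers_eq_zero_of_notMem hδ hδ1 _ _ _ hy, layers_eq_zero_of_notMem hδ hδ1 _ _ _ hy, add_zero]

theorem isTest_branching {δ : ℝ} (hδ : 0 < δ) (hδ1 : δ ≤ 1 / 8) (n N : ℕ) :
    IsTest (branching δ n N) := by
  refine ⟨(contDiff_layers hδ n N (by fun_prop) (by fun_prop)).add
    (contDiff_layers hδ n N (by fun_prop) (by fun_prop)),
    HasCompactSupport.intro (isCompact_box (a := 0) (b := 1) (c := 0) (d := 1)) fun p hp =>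
      branching_eq_zero hδ hδ1 n N fun h => hp ?_⟩
  rw [unitSquare_eq_box] at h
  exact ⟨Set.Ioo_subset_Icc_self h.1, Set.Ioo_subset_Icc_self h.2⟩

theorem pderiv_zero_zero {f : Plane → ℝ} (hf : ContDiff ℝ ∞ f) (x : Plane) :
    pderiv 0 (pderiv 0 f) x = d2 (fun s => f (pt s (x 1))) (x 0) := by
  have h1 : deriv (fun s => f (pt s (x 1))) = fun s => pderiv 0 f (pt s (x 1)) := funext fun s =>
    (hasDerivAt_comp_pt_left (contDiff_differentiable hf) s (x 1)).deriv
  rw [d2, h1, (hasDerivAt_comp_pt_left (contDiff_differentiable (contDiff_pderiv hf 0)) _ _).deriv,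
    pt_eta]

theorem pderiv_one_one {f : Plane → ℝ} (hf : ContDiff ℝ ∞ f) (x : Plane) :
    pderiv 1 (pderiv 1 f) x = d2 (fun t => f (pt (x 0) t)) (x 1) := by
  have h1 : deriv (fun t => f (pt (x 0) t)) = fun t => pderiv 1 f (pt (x 0) t) := funext fun t =>
    (hasDerivAt_comp_pt_right (contDiff_differentiable hf) (x 0) t).deriv
  rw [d2, h1, (hasDerivAt_comp_pt_right (contDiff_differentiable (contDiff_pderiv hf 1)) _ _).deriv,
    pt_eta]

theorem pderiv_zero_zero_branching {δ : ℝ} (hδ : 0 < δ) (hδ1 : δ ≤ 1 / 8) (n N : ℕ) (p : Plane) :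
    pderiv 0 (pderiv 0 (branching δ n N)) p =
      9 * (d2 (fun x => layers δ n N x (p 1)) (3 * p 0) +
        d2 (fun x => layers δ n N x (p 1)) (3 - 3 * p 0)) := by
  have hL : ContDiff ℝ ∞ fun x => layers δ n N x (p 1) :=
    contDiff_layers hδ n N contDiff_id contDiff_const
  rw [pderiv_zero_zero (isTest_branching hδ hδ1 n N).1]
  have e : (fun s => branching δ n N (pt s (p 1))) = fun s =>
      (fun x => layers δ n N x (p 1)) (3 * s + 0) +
        (fun x => layers δ n N x (p 1)) (-3 * s + 3) := by
    funext s
    simp only [branching, pt_zero, pt_one]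
    congr 2 <;> ring
  have h1 : ContDiff ℝ ∞ fun s => (fun x => layers δ n N x (p 1)) (3 * s + 0) :=
    hL.comp (by fun_prop : ContDiff ℝ ∞ fun s : ℝ => 3 * s + 0)
  have h2 : ContDiff ℝ ∞ fun s => (fun x => layers δ n N x (p 1)) (-3 * s + 3) :=
    hL.comp (by fun_prop : ContDiff ℝ ∞ fun s : ℝ => -3 * s + 3)
  rw [e, d2_add h1 h2, d2_affine hL, d2_affine hL]
  rw [show 3 * p 0 + 0 = 3 * p 0 by ring, show -3 * p 0 + 3 = 3 - 3 * p 0 by ring]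
  ring

theorem pderiv_one_one_branching {δ : ℝ} (hδ : 0 < δ) (hδ1 : δ ≤ 1 / 8) (n N : ℕ) (p : Plane) :
    pderiv 1 (pderiv 1 (branching δ n N)) p =
      d2 (fun y => layers δ n N (3 * p 0) y) (p 1) +
        d2 (fun y => layers δ n N (3 - 3 * p 0) y) (p 1) := by
  have hL : ∀ x, ContDiff ℝ ∞ fun y => layers δ n N x y := fun x =>
    contDiff_layers hδ n N contDiff_const contDiff_id
  have e : (fun t => branching δ n N (pt (p 0) t)) = fun t =>
      layers δ n N (3 * p 0) t + layers δ n N (3 - 3 * p 0) t := rfl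
  rw [pderiv_one_one (isTest_branching hδ hδ1 n N).1, e, d2_add (hL _) (hL _)]

/-- A sum over cells has at most one nonzero term. -/
theorem sum_cells {M : ℕ} {f : ℝ → ℝ} {y : ℝ} (hy : y ∈ Set.Ioo (0 : ℝ) 1)
    (hf : ∀ k : ℕ, M * y - k ∉ Set.Ioo (0 : ℝ) 1 → f (M * y - k) = 0) (hM : 0 < M) :
    ∑ k ∈ Finset.range M, f (M * y - k) = f (Int.fract (M * y)) := by
  have hM' : (0 : ℝ) < M := by exact_mod_cast hM
  have h0 : (0 : ℝ) ≤ M * y := mul_nonneg hM'.le hy.1.le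
  have hfl : ((⌊(M : ℝ) * y⌋₊ : ℕ) : ℝ) = (⌊(M : ℝ) * y⌋ : ℤ) := natCast_floor_eq_intCast_floor h0
  have hlt : ⌊(M : ℝ) * y⌋₊ < M := by
    rw [Nat.floor_lt h0]
    nlinarith [hy.2]
  rw [Finset.sum_eq_single_of_mem _ (Finset.mem_range.2 hlt), hfl]
  · rfl
  · intro k _ hk
    refine hf k fun ⟨h1, h2⟩ => hk ?_
    exact ((Nat.floor_eq_iff h0).2 ⟨by linarith, by linarith⟩).symm

theorem d2_layers_left {δ : ℝ} (hδ : 0 < δ) (n N : ℕ) (x y : ℝ) :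
    d2 (fun x => layers δ n N x y) x =
      ∑ j ∈ Finset.range (N + 1), ∑ k ∈ Finset.range (n * 2 ^ j),
        (((n * 2 ^ j : ℕ) : ℝ) ^ 2)⁻¹ * (((9 / 4) ^ j) ^ 2 *
          d2 (fun x => cell δ x ((n * 2 ^ j : ℕ) * y - k)) ((9 / 4) ^ j * x)) := by
  have hc : ∀ z, ContDiff ℝ ∞ fun x => cell δ x z := fun z =>
    contDiff_cell hδ contDiff_id contDiff_const
  unfold layers
  have hterm : ∀ (j k : ℕ), ContDiff ℝ ∞ fun x : ℝ => (((n * 2 ^ j : ℕ) : ℝ) ^ 2)⁻¹ *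
      cell δ ((9 / 4) ^ j * x) ((n * 2 ^ j : ℕ) * y - k) := fun j k =>
    contDiff_const.mul ((hc _).comp (by fun_prop : ContDiff ℝ ∞ fun x : ℝ => (9 / 4) ^ j * x))
  rw [d2_sum _ fun j => ContDiff.sum fun k _ => hterm j k]
  refine Finset.sum_congr rfl fun j _ => ?_
  rw [d2_sum _ fun k => hterm j k]
  refine Finset.sum_congr rfl fun k _ => ?_
  rw [d2_const_mul]
  have := d2_affine (hc ((n * 2 ^ j : ℕ) * y - k)) ((9 / 4) ^ j) 0 x
  simp only [add_zero] at this
  rw [this]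

theorem d2_layers_right {δ : ℝ} (hδ : 0 < δ) {n : ℕ} (hn : 0 < n) (N : ℕ) (x y : ℝ) :
    d2 (fun y => layers δ n N x y) y =
      ∑ j ∈ Finset.range (N + 1), window ((9 / 4) ^ j * x) * ∑ k ∈ Finset.range (n * 2 ^ j),
        d2 (profile δ (clock ((9 / 4) ^ j * x))) ((n * 2 ^ j : ℕ) * y - k) := by
  have hc : ∀ t, ContDiff ℝ ∞ (profile δ t) := fun t =>
    contDiff_profile hδ contDiff_const contDiff_id
  unfold layers cell
  have hterm : ∀ (j k : ℕ), ContDiff ℝ ∞ fun y : ℝ => (((n * 2 ^ j : ℕ) : ℝ) ^ 2)⁻¹ *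
      (window ((9 / 4) ^ j * x) *
        profile δ (clock ((9 / 4) ^ j * x)) ((n * 2 ^ j : ℕ) * y - k)) := fun j k =>
    contDiff_const.mul (contDiff_const.mul ((hc _).comp
      (by fun_prop : ContDiff ℝ ∞ fun y : ℝ => ((n * 2 ^ j : ℕ) : ℝ) * y - k)))
  rw [d2_sum _ fun j => ContDiff.sum fun k _ => hterm j k]
  refine Finset.sum_congr rfl fun j _ => ?_
  rw [d2_sum _ fun k => hterm j k, Finset.mul_sum]
  refine Finset.sum_congr rfl fun k _ => ?_
  rw [d2_const_mul, d2_const_mul]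
  have := d2_affine (hc (clock ((9 / 4) ^ j * x))) ((n * 2 ^ j : ℕ) : ℝ) (-k) y
  simp only [← sub_eq_add_neg] at this
  rw [this]
  have hM : ((n * 2 ^ j : ℕ) : ℝ) ≠ 0 := by positivity
  field_simp

theorem abs_d2_layers_left_le {C δ : ℝ} (hδ : 0 < δ)
    (hC : ∀ x z, |d2 (fun x => cell δ x z) x| ≤ if x ≤ 2 ∧ z ∈ Set.Ioo (0 : ℝ) 1 then C else 0)
    (hC0 : 0 ≤ C) {n : ℕ} (hn : 0 < n) (N : ℕ) (x : ℝ) {y : ℝ} (hy : y ∈ Set.Ioo (0 : ℝ) 1) :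
    |d2 (fun x => layers δ n N x y) x| ≤ C * ((n : ℝ) ^ 2)⁻¹ * ∑ j ∈ Finset.range (N + 1),
      (81 / 64) ^ j * if (9 / 4) ^ j * x ≤ 2 then 1 else 0 := by
  rw [d2_layers_left hδ, Finset.mul_sum]
  refine (Finset.abs_sum_le_sum_abs _ _).trans (Finset.sum_le_sum fun j _ => ?_)
  set M := n * 2 ^ j with hM
  have hMpos : 0 < M := by positivity
  have hb : ∀ k : ℕ, |((M : ℝ) ^ 2)⁻¹ * (((9 / 4) ^ j) ^ 2 *
      d2 (fun x => cell δ x (M * y - k)) ((9 / 4) ^ j * x))| ≤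
      ((M : ℝ) ^ 2)⁻¹ * (((9 / 4) ^ j) ^ 2 * (fun z => if (9 / 4) ^ j * x ≤ 2 ∧
        z ∈ Set.Ioo (0 : ℝ) 1 then C else 0) (M * y - k)) := by
    intro k
    rw [abs_mul, abs_mul, abs_of_nonneg (by positivity : (0 : ℝ) ≤ ((M : ℝ) ^ 2)⁻¹),
      abs_of_nonneg (by positivity : (0 : ℝ) ≤ ((9 / 4) ^ j) ^ 2)]
    gcongr
    exact hC _ _
  refine (Finset.abs_sum_le_sum_abs _ _).trans ((Finset.sum_le_sum fun k _ => hb k).trans ?_)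
  rw [← Finset.mul_sum, ← Finset.mul_sum, sum_cells (f := fun z => if (9 / 4) ^ j * x ≤ 2 ∧
    z ∈ Set.Ioo (0 : ℝ) 1 then C else 0) hy (fun k hk => if_neg fun h => hk h.2) hMpos]
  have e1 : ((M : ℝ) ^ 2)⁻¹ * (((9 / 4 : ℝ) ^ j) ^ 2) = ((n : ℝ) ^ 2)⁻¹ * (81 / 64) ^ j := by
    have e2 : (81 / 64 : ℝ) ^ j = ((9 / 4) ^ j) ^ 2 / (2 ^ j) ^ 2 := by
      rw [← pow_mul, ← pow_mul, mul_comm j 2, pow_mul, pow_mul, ← div_pow]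
      norm_num
    rw [e2, hM]
    push_cast
    field_simp
  rw [← mul_assoc, e1]
  have hle : (if (9 / 4) ^ j * x ≤ 2 ∧ Int.fract ((M : ℝ) * y) ∈ Set.Ioo (0 : ℝ) 1 then C else 0) ≤
      C * if (9 / 4) ^ j * x ≤ 2 then 1 else 0 := by
    split_ifs with h1 h2 h2
    · rw [mul_one]
    · exact absurd h1.1 h2
    · rw [mul_one]; exact hC0
    · rw [mul_zero]
  calc _ ≤ ((n : ℝ) ^ 2)⁻¹ * (81 / 64) ^ j * (C * if (9 / 4) ^ j * x ≤ 2 then 1 else 0) := by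
        gcongr
    _ = _ := by ring

theorem Irrational.natCast_mul_sub_notMem_Icc {y : ℝ} (hy : Irrational y) {M : ℕ} (hM : 0 < M)
    (k : ℕ) (h : M * y - k ∉ Set.Ioo (0 : ℝ) 1) : M * y - k ∉ Set.Icc (0 : ℝ) 1 := by
  have hne : ∀ m : ℤ, (M : ℝ) * y - k ≠ m := by
    intro m e
    have h1 : Irrational ((M : ℝ) * y) := hy.natCast_mul hM.ne'
    refine h1 ⟨(m + k : ℤ), ?_⟩
    push_cast
    linarith
  rintro ⟨h1, h2⟩
  have n0 := hne 0
  have n1 := hne 1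
  push_cast at n0 n1
  exact h ⟨lt_of_le_of_ne h1 n0.symm, lt_of_le_of_ne h2 n1⟩

theorem d2_profile_eq_zero {δ t z : ℝ} (hδ : 0 < δ) (hδ1 : δ ≤ 1 / 8) (ht : t ∈ Set.Icc (0 : ℝ) 1)
    (hz : z ∉ Set.Icc (0 : ℝ) 1) : d2 (profile δ t) z = 0 := by
  refine d2_eq_zero_of_eqOn isClosed_Icc.isOpen_compl (fun s hs => ?_) hz
  rcases le_or_gt s 0 with h | h
  · exact profile_of_nonpos hδ hδ1 ht h
  · refine profile_of_one_le hδ hδ1 ht ?_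
    by_contra h1
    exact hs ⟨h.le, (not_le.1 h1).le⟩

theorem d2_layers_right_of_irrational {δ : ℝ} (hδ : 0 < δ) (hδ1 : δ ≤ 1 / 8) {n : ℕ} (hn : 0 < n)
    (N : ℕ) (x : ℝ) {y : ℝ} (hy : y ∈ Set.Ioo (0 : ℝ) 1) (hirr : Irrational y) :
    d2 (fun y => layers δ n N x y) y =
      ∑ j ∈ Finset.range (N + 1), window ((9 / 4) ^ j * x) *
        d2 (profile δ (clock ((9 / 4) ^ j * x))) (Int.fract ((n * 2 ^ j : ℕ) * y)) := by
  rw [d2_layers_right hδ hn]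
  refine Finset.sum_congr rfl fun j _ => ?_
  have hM : 0 < n * 2 ^ j := by positivity
  rw [sum_cells hy (fun k hk => d2_profile_eq_zero hδ hδ1 (clock_mem _)
    (Irrational.natCast_mul_sub_notMem_Icc hirr hM k hk)) hM]

theorem sum_window (N : ℕ) (x : ℝ) : ∑ j ∈ Finset.range (N + 1), window ((9 / 4) ^ j * x) =
    smoothTransition ((9 / 4) ^ (N + 1) * x - 1) - smoothTransition (x - 1) := by
  have h := Finset.sum_range_sub (fun j => smoothTransition ((9 / 4) ^ j * x - 1)) (N + 1)
  simp only [pow_zero, one_mul] at h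
  rw [← h]
  refine Finset.sum_congr rfl fun j _ => ?_
  rw [window, pow_succ]
  congr 3
  ring

theorem sum_window_le_one (N : ℕ) (x : ℝ) :
    ∑ j ∈ Finset.range (N + 1), window ((9 / 4) ^ j * x) ≤ 1 := by
  rw [sum_window]
  linarith [Real.smoothTransition.le_one ((9 / 4) ^ (N + 1) * x - 1),
    Real.smoothTransition.nonneg (x - 1)]

theorem abs_d2_layers_right_le {C δ : ℝ} (hδ : 0 < δ) (hδ1 : δ ≤ 1 / 8)
    (hC : ∀ t z, |d2 (profile δ t) z| ≤ C) (hC0 : 0 ≤ C) {n : ℕ} (hn : 0 < n) (N : ℕ) (x : ℝ)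
    {y : ℝ} (hy : y ∈ Set.Ioo (0 : ℝ) 1) (hirr : Irrational y) :
    |d2 (fun y => layers δ n N x y) y| ≤ C := by
  rw [d2_layers_right_of_irrational hδ hδ1 hn N x hy hirr]
  calc _ ≤ ∑ j ∈ Finset.range (N + 1), window ((9 / 4) ^ j * x) * C := by
        refine (Finset.abs_sum_le_sum_abs _ _).trans (Finset.sum_le_sum fun j _ => ?_)
        rw [abs_mul, abs_of_nonneg (window_nonneg _)]
        exact mul_le_mul_of_nonneg_left (hC _ _) (window_nonneg _)
    _ = (∑ j ∈ Finset.range (N + 1), window ((9 / 4) ^ j * x)) * C := by rw [Finset.sum_mul]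
    _ ≤ C := mul_le_of_le_one_left hC0 (sum_window_le_one N x)

/-! ### The limiting phase indicator -/

theorem smoothTransition_add_one_sub (u : ℝ) :
    smoothTransition u + smoothTransition (1 - u) = 1 := by
  have h := Real.smoothTransition.pos_denom u
  rw [smoothTransition, smoothTransition, show 1 - (1 - u) = u by ring,
    add_comm (expNegInvGlue (1 - u)), ← add_div, div_self h.ne']

/-- The limiting pattern in the `j`-th generation. -/
noncomputable def pattern (n j : ℕ) (x y : ℝ) : ℝ :=
  needle (clock ((9 / 4) ^ j * x)) (Int.fract ((n * 2 ^ j : ℕ) * y))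

theorem fract_mem_Ioo {y : ℝ} (hy : Irrational y) {M : ℕ} (hM : 0 < M) :
    Int.fract ((M : ℝ) * y) ∈ Set.Ioo (0 : ℝ) 1 := by
  refine ⟨lt_of_le_of_ne (Int.fract_nonneg _) fun h => ?_, Int.fract_lt_one _⟩
  have h1 : Irrational ((M : ℝ) * y) := hy.natCast_mul hM.ne'
  exact h1 ⟨⌊(M : ℝ) * y⌋, by
    have := Int.floor_add_fract ((M : ℝ) * y)
    rw [← h, add_zero] at this
    exact_mod_cast this⟩

theorem pattern_succ {n : ℕ} (hn : 0 < n) {j : ℕ} {x y : ℝ} (hy : Irrational y)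
    (h1 : 1 ≤ (9 / 4) ^ (j + 1) * x) (h2 : (9 / 4) ^ j * x ≤ 8 / 9) :
    pattern n j x y = pattern n (j + 1) x y := by
  have hM : 0 < n * 2 ^ j := by positivity
  rw [pattern, pattern, clock_of_one_le h1, clock_of_le h2, needle_one_eq (fract_mem_Ioo hy hM)]
  congr 1
  rw [Int.fract_eq_fract]
  refine ⟨-(2 * ⌊((n * 2 ^ j : ℕ) : ℝ) * y⌋), ?_⟩
  rw [Int.fract]
  push_cast
  ring

/-- Where the window of another generation is open, the pattern is the same. -/
theorem pattern_eq_of_window_ne_zero {n : ℕ} (hn : 0 < n) {i j : ℕ} {x y : ℝ} (hy : Irrational y)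
    (h1 : 2 / 3 < (9 / 4) ^ j * x) (h2 : (9 / 4) ^ j * x ≤ 3 / 2)
    (hi : window ((9 / 4) ^ i * x) ≠ 0) : pattern n i x y = pattern n j x y := by
  have hi1 : 4 / 9 < (9 / 4) ^ i * x := by
    by_contra h; exact hi (window_of_le (not_lt.1 h))
  have hi2 : (9 / 4) ^ i * x < 2 := by
    by_contra h; exact hi (window_of_two_le (not_lt.1 h))
  have hx : 0 < x := by
    by_contra h
    have : (9 / 4 : ℝ) ^ i * x ≤ 0 := mul_nonpos_of_nonneg_of_nonpos (by positivity) (not_lt.1 h)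
    linarith
  have hmono : ∀ a b : ℕ, a ≤ b → (9 / 4 : ℝ) ^ a * x ≤ (9 / 4) ^ b * x := fun a b hab =>
    mul_le_mul_of_nonneg_right (pow_le_pow_right₀ (by norm_num) hab) hx.le
  have hs : ∀ a : ℕ, (9 / 4 : ℝ) ^ (a + 1) * x = 9 / 4 * ((9 / 4) ^ a * x) := fun a => by
    rw [pow_succ]; ring
  rcases lt_trichotomy i j with h | rfl | h
  · obtain rfl | h' := (Nat.succ_le_of_lt h).eq_or_lt
    · have e := hs i
      simp only [Nat.succ_eq_add_one] at h1 h2 ⊢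
      exact pattern_succ hn hy (by linarith) (by linarith)
    · have := hmono (i + 1 + 1) j h'
      rw [hs, hs] at this
      linarith
  · rfl
  · obtain rfl | h' := (Nat.succ_le_of_lt h).eq_or_lt
    · have e := hs j
      simp only [Nat.succ_eq_add_one] at hi1 hi2 ⊢
      exact (pattern_succ hn hy (by linarith) (by linarith)).symm
    · have := hmono (j + 1 + 1) i h'
      rw [hs, hs] at this
      linarith

theorem eventually_d2_layers_right {n : ℕ} (hn : 0 < n) (N : ℕ) {x y ν : ℝ}
    (hy : y ∈ Set.Ioo (0 : ℝ) 1) (hirr : Irrational y)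
    (hν : ∀ i, window ((9 / 4) ^ i * x) ≠ 0 → pattern n i x y = ν) :
    ∀ᶠ δ in nhdsWithin (0 : ℝ) (Set.Ioi 0), d2 (fun y => layers δ n N x y) y =
      (smoothTransition ((9 / 4) ^ (N + 1) * x - 1) - smoothTransition (x - 1)) *
        (1 - 2 * ν) := by
  have h1 : ∀ᶠ δ in nhdsWithin (0 : ℝ) (Set.Ioi 0), ∀ j ∈ Finset.range (N + 1),
      d2 (profile δ (clock ((9 / 4) ^ j * x))) (Int.fract ((n * 2 ^ j : ℕ) * y)) =
        1 - 2 * pattern n j x y := by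
    rw [Filter.eventually_all_finset]
    exact fun j _ => eventually_d2_profile (clock_mem _) (fract_mem_Ioo hirr (by positivity))
  have h2 : ∀ᶠ δ in nhdsWithin (0 : ℝ) (Set.Ioi 0), δ ≤ 1 / 8 :=
    nhdsWithin_le_nhds (Iic_mem_nhds (by norm_num))
  filter_upwards [h1, h2, self_mem_nhdsWithin] with δ e hδ1 hδ
  rw [d2_layers_right_of_irrational hδ hδ1 hn N x hy hirr, ← sum_window, Finset.sum_mul]
  refine Finset.sum_congr rfl fun j hj => ?_
  rw [e j hj]
  by_cases hw : window ((9 / 4) ^ j * x) = 0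
  · rw [hw, zero_mul, zero_mul]
  · rw [hν j hw]

/-- Away from the vertical sides, the second vertical derivative of the potential converges to the
sign pattern. -/
theorem eventually_d2_add {n : ℕ} (hn : 0 < n) (N : ℕ) {j : ℕ} {x y : ℝ}
    (hy : y ∈ Set.Ioo (0 : ℝ) 1) (hirr : Irrational y) (hx : x ≤ 3 / 2)
    (hN : 2 ≤ (9 / 4) ^ (N + 1) * x) (h1 : 2 / 3 < (9 / 4) ^ j * x)
    (h2 : (9 / 4) ^ j * x ≤ 3 / 2) :
    ∀ᶠ δ in nhdsWithin (0 : ℝ) (Set.Ioi 0), d2 (fun y => layers δ n N x y) y +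
      d2 (fun y => layers δ n N (3 - x) y) y = 1 - 2 * pattern n j x y := by
  have hfar : ∀ i, window ((9 / 4) ^ i * (3 - x)) ≠ 0 →
      pattern n i (3 - x) y = pattern n 0 (3 - x) y := by
    intro i hi
    rcases Nat.eq_zero_or_pos i with rfl | hi0
    · rfl
    · exfalso
      apply hi
      apply window_of_two_le
      have : (9 / 4 : ℝ) ^ 1 ≤ (9 / 4) ^ i := pow_le_pow_right₀ (by norm_num) hi0
      nlinarith
  have hpow : (9 / 4 : ℝ) ≤ (9 / 4) ^ (N + 1) := by
    have : (9 / 4 : ℝ) ^ 1 ≤ (9 / 4) ^ (N + 1) := pow_le_pow_right₀ (by norm_num) (by omega)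
    simpa using this
  filter_upwards [eventually_d2_layers_right hn N hy hirr
    (fun i hi => pattern_eq_of_window_ne_zero hn hirr h1 h2 hi),
    eventually_d2_layers_right hn N hy hirr hfar] with δ e1 e2
  have hsum := smoothTransition_add_one_sub (x - 1)
  rw [show 1 - (x - 1) = 3 - x - 1 by ring] at hsum
  rw [e1, e2, Real.smoothTransition.one_of_one_le (by linarith : 1 ≤ (9 / 4) ^ (N + 1) * x - 1),
    Real.smoothTransition.one_of_one_le (by nlinarith : 1 ≤ (9 / 4) ^ (N + 1) * (3 - x) - 1)]
  rcases le_or_gt x 1 with hx1 | hx1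
  · rw [Real.smoothTransition.zero_of_nonpos (by linarith : x - 1 ≤ 0),
      Real.smoothTransition.one_of_one_le (by linarith : 1 ≤ 3 - x - 1)]
    ring
  · have hj : j = 0 := by
      by_contra hj
      have : (9 / 4 : ℝ) ^ 1 ≤ (9 / 4) ^ j := pow_le_pow_right₀ (by norm_num)
        (Nat.one_le_iff_ne_zero.2 hj)
      nlinarith
    subst hj
    have e : pattern n 0 x y = pattern n 0 (3 - x) y := by
      rw [pattern, pattern, clock_of_one_le (by simpa using hx1.le),
        clock_of_one_le (by simp; linarith)]
    rw [← e]
    linear_combination (1 - 2 * pattern n 0 x y) * (-hsum)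

theorem exists_generation {x : ℝ} (h0 : 0 < x) (h1 : x ≤ 3 / 2) :
    ∃ j : ℕ, 2 / 3 < (9 / 4) ^ j * x ∧ (9 / 4) ^ j * x ≤ 3 / 2 := by
  obtain ⟨j, hj1, hj2⟩ := exists_nat_pow_near (x := 3 / (2 * x)) (y := 9 / 4)
    (by rw [le_div_iff₀ (by positivity)]; linarith) (by norm_num)
  rw [le_div_iff₀ (by positivity)] at hj1
  rw [div_lt_iff₀ (by positivity), pow_succ] at hj2
  exact ⟨j, by linarith, by linarith⟩

theorem generation_unique {x : ℝ} {i j : ℕ} (hi1 : 2 / 3 < (9 / 4) ^ i * x)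
    (hi2 : (9 / 4) ^ i * x ≤ 3 / 2) (hj1 : 2 / 3 < (9 / 4) ^ j * x)
    (hj2 : (9 / 4) ^ j * x ≤ 3 / 2) : i = j := by
  have hx : 0 < x := by
    by_contra h
    have : (9 / 4 : ℝ) ^ i * x ≤ 0 := mul_nonpos_of_nonneg_of_nonpos (by positivity) (not_lt.1 h)
    linarith
  have key : ∀ a b : ℕ, a < b → 2 / 3 < (9 / 4) ^ a * x → (9 / 4) ^ b * x ≤ 3 / 2 → False := by
    intro a b hab h1 h2
    have : (9 / 4 : ℝ) ^ (a + 1) ≤ (9 / 4) ^ b := pow_le_pow_right₀ (by norm_num) hab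
    rw [pow_succ] at this
    nlinarith
  rcases lt_trichotomy i j with h | h | h
  · exact (key i j h hi1 hj2).elim
  · exact h
  · exact (key j i h hj1 hi2).elim

/-- The distance to the left or right side of the square, rescaled. -/
noncomputable def sideDist (right : Bool) (s : ℝ) : ℝ := if right then 3 - 3 * s else 3 * s

/-- The position of the needles in the unit cell. -/
noncomputable def needleStart (upper : Bool) (t : ℝ) : ℝ :=
  if upper then 1 / 2 + t / 8 else 1 / 4 - t / 8

/-- The half of the square next to one of its sides. -/
def halfLine (right : Bool) : Set ℝ := if right then Set.Ioo (1 / 2) 1 else Set.Ioc 0 (1 / 2)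

/-- The part of a needle in one generation. The index consists of the generation, the cell, the
side, and the position in the cell. -/
def needleSet (n : ℕ) (i : Σ _ : ℕ, ℕ × Bool × Bool) : Set Plane :=
  {p | p 0 ∈ halfLine i.2.2.1 ∧ (9 / 4) ^ i.1 * sideDist i.2.2.1 (p 0) ∈ Set.Ioc (2 / 3 : ℝ) (3 / 2) ∧
    p 1 ∈ Set.Ioo (0 : ℝ) 1 ∧
    ((n * 2 ^ i.1 : ℕ) : ℝ) * p 1 - i.2.1 -
      needleStart i.2.2.2 (clock ((9 / 4) ^ i.1 * sideDist i.2.2.1 (p 0))) ∈ Set.Ioc (0 : ℝ) (1 / 4)}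

/-- The indices of the needles up to the `N`-th generation. -/
def needleIndices (n N : ℕ) : Finset (Σ _ : ℕ, ℕ × Bool × Bool) :=
  (Finset.range (N + 1)).sigma fun j => Finset.range (n * 2 ^ j) ×ˢ Finset.univ

/-- The phase indicator of the branching construction. -/
noncomputable def branchingPhase (n N : ℕ) : Plane → ℝ :=
  (⋃ i ∈ needleIndices n N, needleSet n i).indicator fun _ => 1

theorem needleStart_mem (b : Bool) {t : ℝ} (ht : t ∈ Set.Icc (0 : ℝ) 1) :
    needleStart b t ∈ Set.Icc (1 / 8 : ℝ) (5 / 8) := by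
  obtain ⟨h0, h1⟩ := ht
  unfold needleStart
  split_ifs <;> constructor <;> linarith

theorem needle_eq_ite (t z : ℝ) : needle t z =
    if ∃ b, z - needleStart b t ∈ Set.Ioc (0 : ℝ) (1 / 4) then 1 else 0 := by
  rw [needle]
  refine if_congr ?_ rfl rfl
  simp only [Bool.exists_bool, needleStart, Set.mem_Ioc]
  constructor
  · rintro (⟨a, b⟩ | ⟨a, b⟩)
    · exact Or.inl ⟨by simp; linarith, by simp; linarith⟩
    · exact Or.inr ⟨by simp; linarith, by simp; linarith⟩
  · rintro (⟨a, b⟩ | ⟨a, b⟩) <;> simp at a b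
    · exact Or.inl ⟨by linarith, by linarith⟩
    · exact Or.inr ⟨by linarith, by linarith⟩

theorem halfLine_unique {a b : Bool} {s : ℝ} (ha : s ∈ halfLine a) (hb : s ∈ halfLine b) :
    a = b := by
  unfold halfLine at ha hb
  cases a <;> cases b <;> simp at ha hb ⊢ <;> linarith

theorem eq_floor_of_sub_mem {a : ℝ} {k : ℕ} (h : a - k ∈ Set.Ico (0 : ℝ) 1) :
    k = ⌊a⌋₊ ∧ a - k = Int.fract a := by
  obtain ⟨h1, h2⟩ := h
  have hk : (0 : ℝ) ≤ k := Nat.cast_nonneg k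
  refine ⟨((Nat.floor_eq_iff (by linarith)).2 ⟨by linarith, by linarith⟩).symm, ?_⟩
  exact (Int.fract_eq_iff.2 ⟨h1, h2, k, by push_cast; ring⟩).symm

theorem sub_mem_Ico_of_mem_needleSet {n : ℕ} {i : Σ _ : ℕ, ℕ × Bool × Bool} {p : Plane}
    (hp : p ∈ needleSet n i) : ((n * 2 ^ i.1 : ℕ) : ℝ) * p 1 - i.2.1 ∈ Set.Ico (0 : ℝ) 1 := by
  obtain ⟨-, -, -, h1, h2⟩ := hp
  obtain ⟨h3, h4⟩ := needleStart_mem i.2.2.2 (clock_mem ((9 / 4) ^ i.1 * sideDist i.2.2.1 (p 0)))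
  exact ⟨by linarith, by linarith⟩

theorem needleSet_unique {n : ℕ} {i i' : Σ _ : ℕ, ℕ × Bool × Bool} {p : Plane}
    (hp : p ∈ needleSet n i) (hp' : p ∈ needleSet n i') : i = i' := by
  have hk := (eq_floor_of_sub_mem (sub_mem_Ico_of_mem_needleSet hp)).1
  have hk' := (eq_floor_of_sub_mem (sub_mem_Ico_of_mem_needleSet hp')).1
  obtain ⟨j, k, b, c⟩ := i
  obtain ⟨j', k', b', c'⟩ := i'
  obtain ⟨s, g, -, q⟩ := hp
  obtain ⟨s', g', -, q'⟩ := hp'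
  simp only at hk hk' s s' g g' q q'
  obtain rfl := halfLine_unique s s'
  obtain rfl := generation_unique g.1 g.2 g'.1 g'.2
  obtain rfl := hk.trans hk'.symm
  have : c = c' := by
    have ht := clock_mem ((9 / 4) ^ j * sideDist b (p 0))
    obtain ⟨q1, q2⟩ := q
    obtain ⟨q1', q2'⟩ := q'
    unfold needleStart at q1 q2 q1' q2'
    cases c <;> cases c' <;> simp at q1 q2 q1' q2' ⊢ <;> linarith [ht.1]
  rw [this]

theorem branchingPhase_eq {n N : ℕ} (hn : 0 < n) {j : ℕ} {b : Bool} {p : Plane}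
    (hb : p 0 ∈ halfLine b) (hp1 : p 1 ∈ Set.Ioo (0 : ℝ) 1)
    (hN : 2 ≤ (9 / 4) ^ (N + 1) * sideDist b (p 0))
    (h1 : 2 / 3 < (9 / 4) ^ j * sideDist b (p 0)) (h2 : (9 / 4) ^ j * sideDist b (p 0) ≤ 3 / 2) :
    branchingPhase n N p = pattern n j (sideDist b (p 0)) (p 1) := by
  classical
  rw [branchingPhase, pattern, needle_eq_ite, Set.indicator_apply]
  refine if_congr ?_ rfl rfl
  set t := clock ((9 / 4) ^ j * sideDist b (p 0)) with ht
  constructor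
  · intro h
    obtain ⟨i, hi, hpi⟩ := Set.mem_iUnion₂.1 h
    have hfr := (eq_floor_of_sub_mem (sub_mem_Ico_of_mem_needleSet hpi)).2
    obtain ⟨j', k, b', c⟩ := i
    obtain ⟨s, g, -, q⟩ := hpi
    simp only at hfr s g q
    obtain rfl := halfLine_unique s hb
    obtain rfl := generation_unique g.1 g.2 h1 h2
    rw [hfr] at q
    exact ⟨c, q⟩
  · rintro ⟨c, hc⟩
    have h0 : (0 : ℝ) ≤ ((n * 2 ^ j : ℕ) : ℝ) * p 1 := mul_nonneg (Nat.cast_nonneg _) hp1.1.le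
    have hM : (0 : ℝ) < ((n * 2 ^ j : ℕ) : ℝ) := by positivity
    have hfl : ((⌊((n * 2 ^ j : ℕ) : ℝ) * p 1⌋₊ : ℕ) : ℝ) = (⌊((n * 2 ^ j : ℕ) : ℝ) * p 1⌋ : ℤ) :=
      natCast_floor_eq_intCast_floor h0
    refine Set.mem_iUnion₂.2 ⟨⟨j, ⌊((n * 2 ^ j : ℕ) : ℝ) * p 1⌋₊, b, c⟩, ?_, hb, ⟨h1, h2⟩, hp1, ?_⟩
    · rw [needleIndices, Finset.mem_sigma]
      refine ⟨?_, Finset.mem_product.2 ⟨Finset.mem_range.2 ?_, Finset.mem_univ _⟩⟩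
      · rw [Finset.mem_range]
        by_contra h
        have hx : 0 < sideDist b (p 0) := by
          by_contra hx
          have : (9 / 4 : ℝ) ^ j * sideDist b (p 0) ≤ 0 :=
            mul_nonpos_of_nonneg_of_nonpos (by positivity) (not_lt.1 hx)
          linarith
        have := mul_le_mul_of_nonneg_right
          (pow_le_pow_right₀ (by norm_num : (1 : ℝ) ≤ 9 / 4) (not_lt.1 h)) hx.le
        linarith
      · rw [Nat.floor_lt h0]
        nlinarith [hp1.2]
    · simp only
      rw [hfl]
      exact hc

/-! ### The surface energy of the construction -/

theorem ordConnected_preimage_needleStart (b c : Bool) (j : ℕ) {I : Set ℝ} (hI : I.OrdConnected) :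
    {s | needleStart c (clock ((9 / 4) ^ j * sideDist b s)) ∈ I}.OrdConnected := by
  have hanti : Antitone fun x : ℝ => clock ((9 / 4) ^ j * x) := fun x y hxy =>
    clock_antitone (mul_le_mul_of_nonneg_left hxy (by positivity))
  have h : Monotone (fun s => needleStart c (clock ((9 / 4) ^ j * sideDist b s))) ∨
      Antitone (fun s => needleStart c (clock ((9 / 4) ^ j * sideDist b s))) := by
    cases b <;> cases c
    · left; intro s s' hs
      have := hanti (show 3 * s ≤ 3 * s' by linarith)
      simp only [needleStart, sideDist] at this ⊢
      simp; linarith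
    · right; intro s s' hs
      have := hanti (show 3 * s ≤ 3 * s' by linarith)
      simp only [needleStart, sideDist] at this ⊢
      simp; linarith
    · right; intro s s' hs
      have := hanti (show 3 - 3 * s' ≤ 3 - 3 * s by linarith)
      simp only [needleStart, sideDist] at this ⊢
      simp; linarith
    · left; intro s s' hs
      have := hanti (show 3 - 3 * s' ≤ 3 - 3 * s by linarith)
      simp only [needleStart, sideDist] at this ⊢
      simp; linarith
  rcases h with h | h
  · exact hI.preimage_mono h
  · exact hI.preimage_anti h

theorem ordConnected_halfLine (b : Bool) : (halfLine b).OrdConnected := by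
  unfold halfLine
  split_ifs
  · exact Set.ordConnected_Ioo
  · exact Set.ordConnected_Ioc

theorem ordConnected_preimage_sideDist (b : Bool) (j : ℕ) {I : Set ℝ} (hI : I.OrdConnected) :
    {s | (9 / 4) ^ j * sideDist b s ∈ I}.OrdConnected := by
  have hp : (0 : ℝ) ≤ (9 / 4) ^ j := by positivity
  cases b
  · refine hI.preimage_mono fun s s' hs => ?_
    simp only [sideDist]
    refine mul_le_mul_of_nonneg_left ?_ hp
    simp; linarith
  · refine hI.preimage_anti fun s s' hs => ?_
    simp only [sideDist]
    refine mul_le_mul_of_nonneg_left ?_ hp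
    simp; linarith

theorem continuous_sideDist (b : Bool) : Continuous (sideDist b) := by
  unfold sideDist
  split_ifs <;> fun_prop

theorem continuous_needleStart (c : Bool) : Continuous (needleStart c) := by
  unfold needleStart
  split_ifs <;> fun_prop

theorem isSliceConnected_needleSet (n : ℕ) (i : Σ _ : ℕ, ℕ × Bool × Bool) :
    IsSliceConnected (needleSet n i) := by
  obtain ⟨j, k, b, c⟩ := i
  refine ⟨?_, fun t => ?_, fun s => ?_⟩
  · have h0 : Measurable fun p : Plane => p 0 := (continuous_coord 0).measurable
    have h1 : Measurable fun p : Plane => p 1 := (continuous_coord 1).measurable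
    have hs : Measurable fun p : Plane => (9 / 4) ^ j * sideDist b (p 0) :=
      ((continuous_sideDist b).measurable.comp h0).const_mul _
    have hc : Measurable fun p : Plane =>
        needleStart c (clock ((9 / 4) ^ j * sideDist b (p 0))) :=
      ((continuous_needleStart c).measurable.comp contDiff_clock.continuous.measurable).comp hs
    exact (h0 (ordConnected_halfLine b).measurableSet).inter
      ((hs measurableSet_Ioc).inter ((h1 measurableSet_Ioo).inter
        ((((h1.const_mul _).sub_const _).sub hc) measurableSet_Ioc)))
  · have e : {s | pt s t ∈ needleSet n ⟨j, k, b, c⟩} =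
        halfLine b ∩ {s | (9 / 4) ^ j * sideDist b s ∈ Set.Ioc (2 / 3 : ℝ) (3 / 2)} ∩
        {_s | t ∈ Set.Ioo (0 : ℝ) 1} ∩
        {s | needleStart c (clock ((9 / 4) ^ j * sideDist b s)) ∈
          Set.Ico (((n * 2 ^ j : ℕ) : ℝ) * t - k - 1 / 4) (((n * 2 ^ j : ℕ) : ℝ) * t - k)} := by
      ext s
      simp only [needleSet, pt_zero, pt_one, Set.mem_ofPred_eq, Set.mem_inter_iff, Set.mem_Ioc,
        Set.mem_Ico]
      constructor
      · rintro ⟨a1, a2, a3, a4, a5⟩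
        exact ⟨⟨⟨a1, a2⟩, a3⟩, by linarith, by linarith⟩
      · rintro ⟨⟨⟨a1, a2⟩, a3⟩, a4, a5⟩
        exact ⟨a1, a2, a3, by linarith, by linarith⟩
    rw [e]
    have hconst : {_s : ℝ | t ∈ Set.Ioo (0 : ℝ) 1}.OrdConnected := ⟨fun _ h _ _ _ _ => h⟩
    exact (((ordConnected_halfLine b).inter (ordConnected_preimage_sideDist b j
      Set.ordConnected_Ioc)).inter hconst).inter
      (ordConnected_preimage_needleStart b c j Set.ordConnected_Ico)
  · refine ⟨fun t ht t' ht' r hr => ?_⟩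
    obtain ⟨a1, a2, a3, a4, a5⟩ := ht
    obtain ⟨-, -, b3, b4, b5⟩ := ht'
    simp only [pt_zero, pt_one] at a1 a2 a3 a4 a5 b3 b4 b5
    have hM : (0 : ℝ) ≤ ((n * 2 ^ j : ℕ) : ℝ) := Nat.cast_nonneg _
    have m1 := mul_le_mul_of_nonneg_left hr.1 hM
    have m2 := mul_le_mul_of_nonneg_left hr.2 hM
    refine ⟨a1, a2, ⟨a3.1.trans_le hr.1, hr.2.trans_lt b3.2⟩, ?_, ?_⟩ <;>
      simp only [pt_zero, pt_one] <;> linarith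

theorem needleSet_subset_unitSquare (n : ℕ) (i : Σ _ : ℕ, ℕ × Bool × Bool) :
    needleSet n i ⊆ unitSquare := by
  rintro p ⟨h, -, h1, -⟩
  rw [unitSquare_eq_box]
  refine ⟨?_, h1⟩
  unfold halfLine at h
  split_ifs at h
  · exact ⟨by linarith [h.1], h.2⟩
  · exact ⟨h.1, by linarith [h.2]⟩

theorem needleSet_subset_box {n : ℕ} (hn : 0 < n) (i : Σ _ : ℕ, ℕ × Bool × Bool) :
    ∃ a b c d : ℝ, a ≤ b ∧ c ≤ d ∧ needleSet n i ⊆ box (Set.Icc a b) (Set.Icc c d) ∧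
      2 * ((b - a) + (d - c)) ≤ (4 / 9) ^ i.1 + 2 / (n * 2 ^ i.1 : ℕ) := by
  obtain ⟨j, k, b, c⟩ := i
  have hM : (0 : ℝ) < ((n * 2 ^ j : ℕ) : ℝ) := by positivity
  have hp : (0 : ℝ) < (4 / 9) ^ j := by positivity
  have hpow : (9 / 4 : ℝ) ^ j * (4 / 9) ^ j = 1 := by rw [← mul_pow]; norm_num
  have hinv : ∀ x : ℝ, (9 / 4) ^ j * x ≤ 3 / 2 → x ≤ 3 / 2 * (4 / 9) ^ j := by
    intro x hx
    have : x = ((9 / 4) ^ j * x) * (4 / 9) ^ j := by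
      rw [mul_right_comm, hpow, one_mul]
    rw [this]
    exact mul_le_mul_of_nonneg_right hx hp.le
  have hy : ∀ p ∈ needleSet n ⟨j, k, b, c⟩,
      p 1 ∈ Set.Icc ((k : ℝ) / (n * 2 ^ j : ℕ)) (((k : ℝ) + 1) / (n * 2 ^ j : ℕ)) := by
    intro p hp
    obtain ⟨q1, q2⟩ := sub_mem_Ico_of_mem_needleSet hp
    simp only at q1 q2
    constructor
    · rw [div_le_iff₀ hM]; linarith
    · rw [le_div_iff₀ hM]; linarith
  have hkd : (k : ℝ) / (n * 2 ^ j : ℕ) ≤ ((k : ℝ) + 1) / (n * 2 ^ j : ℕ) := by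
    gcongr; linarith
  have hlen : ((k : ℝ) + 1) / (n * 2 ^ j : ℕ) - (k : ℝ) / (n * 2 ^ j : ℕ) =
      1 / (n * 2 ^ j : ℕ) := by
    rw [← sub_div]; ring
  cases b
  · refine ⟨0, 1 / 2 * (4 / 9) ^ j, _, _, by positivity, hkd, fun p hp => ⟨?_, hy p hp⟩, ?_⟩
    · obtain ⟨h0, ⟨-, h1⟩, -⟩ := hp
      have := hinv _ h1
      simp [halfLine, sideDist] at h0 this
      constructor <;> linarith
    · rw [hlen]; apply le_of_eq; ring
  · refine ⟨1 - 1 / 2 * (4 / 9) ^ j, 1, _, _, by linarith, hkd, fun p hp => ⟨?_, hy p hp⟩, ?_⟩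
    · obtain ⟨h0, ⟨-, h1⟩, -⟩ := hp
      have := hinv _ h1
      simp [halfLine, sideDist] at h0 this
      constructor <;> linarith
    · rw [hlen]; apply le_of_eq; ring

theorem geom_sum_le_inv_one_sub {x : ℝ} (h0 : 0 ≤ x) (h1 : x < 1) (n : ℕ) :
    ∑ j ∈ Finset.range n, x ^ j ≤ (1 - x)⁻¹ :=
  (summable_geometric_of_lt_one h0 h1).sum_le_tsum _ (fun _ _ => pow_nonneg h0 _) |>.trans
    (tsum_geometric_of_lt_one h0 h1).le

theorem totalVariation_branchingPhase_le {n : ℕ} (hn : 0 < n) (N : ℕ) :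
    totalVariation unitSquare (branchingPhase n N) ≤ ENNReal.ofReal (36 * n + 8 * (N + 1)) := by
  refine (totalVariation_indicator_le (needleIndices n N)
    (fun i _ => isSliceConnected_needleSet n i) (fun i _ => needleSet_subset_unitSquare n i)
    (fun i _ i' _ hne => Set.disjoint_left.2 fun p hp hp' => hne (needleSet_unique hp hp'))
    (B := fun i => (4 / 9) ^ i.1 + 2 / (n * 2 ^ i.1 : ℕ))
    fun i _ => needleSet_subset_box hn i).trans (ENNReal.ofReal_le_ofReal ?_)
  rw [needleIndices, Finset.sum_sigma]
  have hterm : ∀ j ∈ Finset.range (N + 1),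
      ∑ _i ∈ Finset.range (n * 2 ^ j) ×ˢ (Finset.univ : Finset (Bool × Bool)),
        ((4 / 9 : ℝ) ^ j + 2 / (n * 2 ^ j : ℕ)) = 4 * n * (8 / 9) ^ j + 8 := by
    intro j _
    have hM : ((n * 2 ^ j : ℕ) : ℝ) ≠ 0 := by positivity
    rw [Finset.sum_const, Finset.card_product, Finset.card_range, nsmul_eq_mul]
    have e : (8 / 9 : ℝ) ^ j = 2 ^ j * (4 / 9) ^ j := by rw [← mul_pow]; norm_num
    simp only [Finset.card_univ, Fintype.card_prod, Fintype.card_bool]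
    rw [Nat.cast_mul, mul_add, e]
    have : ((n * 2 ^ j : ℕ) : ℝ) * ((2 * 2 : ℕ) : ℝ) * (2 / ((n * 2 ^ j : ℕ) : ℝ)) = 8 := by
      field_simp; norm_num
    rw [this]
    push_cast
    ring
  rw [Finset.sum_congr rfl hterm, Finset.sum_add_distrib, ← Finset.mul_sum]
  have hgeo : ∑ j ∈ Finset.range (N + 1), (8 / 9 : ℝ) ^ j ≤ 9 := by
    have h := geom_sum_le_inv_one_sub (x := 8 / 9) (by norm_num) (by norm_num) (N + 1)
    norm_num at h
    exact h
  simp only [Finset.sum_const, Finset.card_range, nsmul_eq_mul]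
  push_cast
  have hn0 : (0 : ℝ) ≤ n := Nat.cast_nonneg n
  nlinarith

theorem branchingPhase_mem {n : ℕ} (hn : 0 < n) (N : ℕ) :
    branchingPhase n N ∈ PhaseIndicators unitSquare := by
  have hm : MeasurableSet (⋃ i ∈ needleIndices n N, needleSet n i) :=
    Finset.measurableSet_biUnion _ fun i _ => (isSliceConnected_needleSet n i).1
  refine ⟨(integrable_const (1 : ℝ)).indicator hm,
    (totalVariation_branchingPhase_le hn N).trans_lt ENNReal.ofReal_lt_top, ae_of_all _ fun p => ?_⟩
  rw [branchingPhase]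
  by_cases hp : p ∈ ⋃ i ∈ needleIndices n N, needleSet n i
  · exact Or.inr (Set.indicator_of_mem hp _)
  · exact Or.inl (Set.indicator_of_notMem hp _)

theorem measurableSet_setOf_sideDist_le (b : Bool) (τ : ℝ) :
    MeasurableSet {p : Plane | sideDist b (p 0) ≤ τ} :=
  (isClosed_le ((continuous_sideDist b).comp (continuous_coord 0)) continuous_const).measurableSet

theorem volume_setOf_sideDist_le (b : Bool) {τ : ℝ} (hτ : 0 ≤ τ) :
    volume.restrict unitSquare {p | sideDist b (p 0) ≤ τ} ≤ ENNReal.ofReal τ := by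
  rw [Measure.restrict_apply (measurableSet_setOf_sideDist_le b τ), unitSquare_eq_box]
  have key : ∀ c d : ℝ, d - c = τ / 3 →
      {p : Plane | sideDist b (p 0) ≤ τ} ∩ box (Set.Ioo 0 1) (Set.Ioo 0 1) ⊆
        box (Set.Icc c d) (Set.Ioo 0 1) →
      volume ({p : Plane | sideDist b (p 0) ≤ τ} ∩ box (Set.Ioo 0 1) (Set.Ioo 0 1)) ≤
        ENNReal.ofReal τ := by
    intro c d hcd hsub
    refine (measure_mono hsub).trans ?_
    rw [volume_box, Real.volume_Icc, Real.volume_Ioo, hcd]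
    simp only [sub_zero, ENNReal.ofReal_one, mul_one]
    exact ENNReal.ofReal_le_ofReal (by linarith)
  cases b
  · refine key 0 (τ / 3) (by ring) ?_
    rintro p ⟨h1, h2, h3⟩
    simp only [Set.mem_ofPred_eq, sideDist, Bool.false_eq_true, if_false] at h1
    exact ⟨⟨h2.1.le, by linarith⟩, h3⟩
  · refine key (1 - τ / 3) 1 (by ring) ?_
    rintro p ⟨h1, h2, h3⟩
    simp only [Set.mem_ofPred_eq, sideDist, if_true] at h1
    exact ⟨⟨by linarith, h2.2.le⟩, h3⟩

theorem sq_d2_layers_left_le {C δ : ℝ} (hδ : 0 < δ)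
    (hC : ∀ x z, |d2 (fun x => cell δ x z) x| ≤ if x ≤ 2 ∧ z ∈ Set.Ioo (0 : ℝ) 1 then C else 0)
    (hC0 : 0 ≤ C) {n : ℕ} (hn : 0 < n) (N : ℕ) (x : ℝ) {y : ℝ} (hy : y ∈ Set.Ioo (0 : ℝ) 1) :
    d2 (fun x => layers δ n N x y) x ^ 2 ≤ ∑ j ∈ Finset.range (N + 1),
      5 * C ^ 2 * ((n : ℝ) ^ 4)⁻¹ * (32805 / 16384) ^ j *
        if (9 / 4) ^ j * x ≤ 2 then 1 else 0 := by
  have h := abs_d2_layers_left_le hδ hC hC0 hn N x hy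
  set S := ∑ j ∈ Finset.range (N + 1), (81 / 64 : ℝ) ^ j * if (9 / 4) ^ j * x ≤ 2 then 1 else 0
  set T := ∑ j ∈ Finset.range (N + 1),
    (32805 / 16384 : ℝ) ^ j * if (9 / 4) ^ j * x ≤ 2 then 1 else 0 with hT
  have hT0 : 0 ≤ T := Finset.sum_nonneg fun j _ => by split_ifs <;> positivity
  have hS : S ^ 2 ≤ 5 * T := by
    refine (Finset.sum_sq_le_sum_mul_sum_of_sq_le_mul _ (f := fun j => (4 / 5 : ℝ) ^ j)
      (g := fun j => (32805 / 16384 : ℝ) ^ j * if (9 / 4) ^ j * x ≤ 2 then 1 else 0)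
      (fun j _ => by positivity) (fun j _ => by split_ifs <;> positivity) fun j _ => ?_).trans
      (mul_le_mul_of_nonneg_right ?_ hT0)
    · split_ifs
      · rw [mul_one, mul_one, ← pow_mul, mul_comm j 2, pow_mul, ← mul_pow]
        norm_num
      · simp
    · have := geom_sum_le_inv_one_sub (x := 4 / 5) (by norm_num) (by norm_num) (N + 1)
      norm_num at this
      exact this
  have hsq : d2 (fun x => layers δ n N x y) x ^ 2 ≤ (C * ((n : ℝ) ^ 2)⁻¹ * S) ^ 2 := by
    rw [← sq_abs]
    exact pow_le_pow_left₀ (abs_nonneg _) h 2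
  calc _ ≤ (C * ((n : ℝ) ^ 2)⁻¹ * S) ^ 2 := hsq
    _ = C ^ 2 * ((n : ℝ) ^ 4)⁻¹ * S ^ 2 := by
        rw [mul_pow, mul_pow, inv_pow, ← pow_mul]
    _ ≤ C ^ 2 * ((n : ℝ) ^ 4)⁻¹ * (5 * T) := mul_le_mul_of_nonneg_left hS (by positivity)
    _ = _ := by
        rw [hT, Finset.mul_sum, Finset.mul_sum]
        exact Finset.sum_congr rfl fun j _ => by ring

theorem lintegral_sq_d2_layers_left_le {C δ : ℝ} (hδ : 0 < δ)
    (hC : ∀ x z, |d2 (fun x => cell δ x z) x| ≤ if x ≤ 2 ∧ z ∈ Set.Ioo (0 : ℝ) 1 then C else 0)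
    (hC0 : 0 ≤ C) {n : ℕ} (hn : 0 < n) (N : ℕ) (b : Bool) :
    ∫⁻ p in unitSquare, ENNReal.ofReal
      (d2 (fun x => layers δ n N x (p 1)) (sideDist b (p 0)) ^ 2) ≤
      ENNReal.ofReal (100 * C ^ 2 * ((n : ℝ) ^ 4)⁻¹) := by
  set K := 5 * C ^ 2 * ((n : ℝ) ^ 4)⁻¹ with hK
  have hK0 : 0 ≤ K := by positivity
  let A : ℕ → Set Plane := fun j => {p | sideDist b (p 0) ≤ 2 * (4 / 9) ^ j}
  have hA : ∀ j, MeasurableSet (A j) := fun j => measurableSet_setOf_sideDist_le b _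
  calc _ ≤ ∫⁻ p in unitSquare, ∑ j ∈ Finset.range (N + 1),
          (A j).indicator (fun _ => ENNReal.ofReal (K * (32805 / 16384) ^ j)) p := by
        refine setLIntegral_mono' measurableSet_unitSquare fun p hp => ?_
        rw [unitSquare_eq_box] at hp
        refine (ENNReal.ofReal_le_ofReal
          (sq_d2_layers_left_le hδ hC hC0 hn N (sideDist b (p 0)) hp.2)).trans ?_
        rw [ENNReal.ofReal_sum_of_nonneg fun j _ => by split_ifs <;> positivity]
        refine Finset.sum_le_sum fun j _ => ?_
        by_cases hj : (9 / 4) ^ j * sideDist b (p 0) ≤ 2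
        · have hm : p ∈ A j := by
            have h1 : (4 / 9 : ℝ) ^ j * (9 / 4) ^ j = 1 := by rw [← mul_pow]; norm_num
            have h2 : (0 : ℝ) < (4 / 9) ^ j := by positivity
            change sideDist b (p 0) ≤ 2 * (4 / 9) ^ j
            calc sideDist b (p 0) = (4 / 9) ^ j * ((9 / 4) ^ j * sideDist b (p 0)) := by
                  rw [← mul_assoc, h1, one_mul]
              _ ≤ _ := by rw [mul_comm 2]; exact mul_le_mul_of_nonneg_left hj h2.le
          rw [Set.indicator_of_mem hm, if_pos hj, mul_one]
        · rw [if_neg hj, mul_zero, ENNReal.ofReal_zero]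
          exact zero_le
    _ = ∑ j ∈ Finset.range (N + 1), ENNReal.ofReal (K * (32805 / 16384) ^ j) *
          volume.restrict unitSquare (A j) := by
        rw [lintegral_finsetSum _ fun j _ => measurable_const.indicator (hA j)]
        exact Finset.sum_congr rfl fun j _ => lintegral_indicator_const (hA j) _
    _ ≤ ∑ j ∈ Finset.range (N + 1), ENNReal.ofReal (K * 2 * (9 / 10) ^ j) := by
        refine Finset.sum_le_sum fun j _ => ?_
        refine (mul_le_mul_right (volume_setOf_sideDist_le b (by positivity)) _).trans ?_
        rw [← ENNReal.ofReal_mul (by positivity)]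
        refine ENNReal.ofReal_le_ofReal ?_
        calc _ = K * 2 * (3645 / 4096) ^ j := by
              rw [show (3645 / 4096 : ℝ) = 32805 / 16384 * (4 / 9) by norm_num, mul_pow]; ring
          _ ≤ _ := mul_le_mul_of_nonneg_left
              (pow_le_pow_left₀ (by norm_num) (by norm_num) j) (by positivity)
    _ ≤ _ := by
        rw [← ENNReal.ofReal_sum_of_nonneg fun j _ => by positivity, ← Finset.mul_sum]
        refine ENNReal.ofReal_le_ofReal ?_
        have h := geom_sum_le_inv_one_sub (x := 9 / 10) (by norm_num) (by norm_num) (N + 1)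
        norm_num at h
        calc _ ≤ K * 2 * 10 := mul_le_mul_of_nonneg_left h (by positivity)
          _ = _ := by rw [hK]; ring

theorem lintegral_sq_pderiv_zero_zero_branching_le : ∃ C : ℝ, 0 ≤ C ∧ ∀ δ, 0 < δ → δ ≤ 1 / 8 →
    ∀ n N : ℕ, 0 < n → ∫⁻ p in unitSquare,
      ENNReal.ofReal (pderiv 0 (pderiv 0 (branching δ n N)) p ^ 2) ≤
        ENNReal.ofReal (C * ((n : ℝ) ^ 4)⁻¹) := by
  obtain ⟨C, hC0, hC⟩ := exists_bound_d2_cell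
  refine ⟨32400 * C ^ 2, by positivity, fun δ hδ hδ1 n N hn => ?_⟩
  have hmeas : ∀ b, Measurable fun p : Plane => ENNReal.ofReal
      (d2 (fun x => layers δ n N x (p 1)) (sideDist b (p 0)) ^ 2) := by
    intro b
    have hL : ContDiff ℝ ∞ fun q : Plane => layers δ n N (q 0) (q 1) :=
      contDiff_layers hδ n N (by fun_prop) (by fun_prop)
    have e : (fun p : Plane => d2 (fun x => layers δ n N x (p 1)) (sideDist b (p 0))) =
        fun p => pderiv 0 (pderiv 0 fun q : Plane => layers δ n N (q 0) (q 1))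
          (pt (sideDist b (p 0)) (p 1)) := by
      funext p
      rw [pderiv_zero_zero hL]
      simp
    have hc : Continuous fun p : Plane =>
        d2 (fun x => layers δ n N x (p 1)) (sideDist b (p 0)) := by
      rw [e]
      refine (contDiff_pderiv (contDiff_pderiv hL 0) 0).continuous.comp ?_
      have hs := (continuous_sideDist b).comp (continuous_coord 0)
      unfold pt
      refine (PiLp.continuous_toLp 2 _).comp (continuous_pi fun i => ?_)
      fin_cases i
      · exact hs
      · exact continuous_coord 1
    exact ENNReal.measurable_ofReal.comp (hc.pow 2).measurable
  calc _ ≤ ∫⁻ p in unitSquare, ENNReal.ofReal 162 * (ENNReal.ofReal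
          (d2 (fun x => layers δ n N x (p 1)) (sideDist false (p 0)) ^ 2) +
          ENNReal.ofReal (d2 (fun x => layers δ n N x (p 1)) (sideDist true (p 0)) ^ 2)) := by
        refine lintegral_mono fun p => ?_
        dsimp only
        rw [← ENNReal.ofReal_add (sq_nonneg _) (sq_nonneg _), ← ENNReal.ofReal_mul (by norm_num),
          pderiv_zero_zero_branching hδ hδ1]
        refine ENNReal.ofReal_le_ofReal ?_
        simp only [sideDist, Bool.false_eq_true, if_false, if_true]
        nlinarith [sq_nonneg (d2 (fun x => layers δ n N x (p 1)) (3 * p 0) -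
          d2 (fun x => layers δ n N x (p 1)) (3 - 3 * p 0))]
    _ ≤ ENNReal.ofReal 162 * (ENNReal.ofReal (100 * C ^ 2 * ((n : ℝ) ^ 4)⁻¹) +
          ENNReal.ofReal (100 * C ^ 2 * ((n : ℝ) ^ 4)⁻¹)) := by
        rw [lintegral_const_mul' _ _ ENNReal.ofReal_ne_top, lintegral_add_left (hmeas _)]
        gcongr <;> exact lintegral_sq_d2_layers_left_le hδ (hC δ hδ hδ1) hC0 hn N _
    _ = _ := by
        rw [← ENNReal.ofReal_add (by positivity) (by positivity),
          ← ENNReal.ofReal_mul (by norm_num)]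
        congr 1
        ring

theorem ae_irrational_coord_one : ∀ᵐ p : Plane, Irrational (p 1) := by
  have h : ∀ᵐ y : ℝ, Irrational y := (Set.countable_range ((↑) : ℚ → ℝ)).ae_notMem volume
  have hq : Measure.QuasiMeasurePreserving (fun p : Plane => p 1) volume volume :=
    Measure.quasiMeasurePreserving_snd.comp measurePreserving_planeEquiv.quasiMeasurePreserving
  exact hq.ae h

theorem abs_one_sub_two_mul_branchingPhase (n N : ℕ) (p : Plane) :
    |1 - 2 * branchingPhase n N p| = 1 := by
  unfold branchingPhase
  rcases Set.indicator_eq_zero_or_self (⋃ i ∈ needleIndices n N, needleSet n i)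
    (fun _ => (1 : ℝ)) p with h | h <;> rw [h] <;> norm_num

theorem exists_halfLine {s : ℝ} (h0 : 0 < s) (h1 : s < 1) : ∃ b, s ∈ halfLine b := by
  rcases le_or_gt s (1 / 2) with h | h
  · exact ⟨false, by simp only [halfLine, Bool.false_eq_true, if_false]; exact ⟨h0, h⟩⟩
  · exact ⟨true, by simp only [halfLine, if_true]; exact ⟨h, h1⟩⟩

theorem eventually_pderiv_one_one_branching {n : ℕ} (hn : 0 < n) (N : ℕ) {p : Plane}
    (hp : p ∈ unitSquare) (hirr : Irrational (p 1))
    (hN : ∀ b, 2 ≤ (9 / 4) ^ (N + 1) * sideDist b (p 0)) :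
    ∀ᶠ δ in nhdsWithin (0 : ℝ) (Set.Ioi 0),
      pderiv 1 (pderiv 1 (branching δ n N)) p = 1 - 2 * branchingPhase n N p := by
  rw [unitSquare_eq_box] at hp
  obtain ⟨b, hb⟩ := exists_halfLine hp.1.1 hp.1.2
  have hx : sideDist b (p 0) ≤ 3 / 2 := by
    cases b <;> simp only [halfLine, sideDist, Bool.false_eq_true, if_false, if_true] at hb ⊢ <;>
      linarith [hb.1, hb.2]
  have h0 : 0 < sideDist b (p 0) := by
    by_contra h
    have := mul_nonpos_of_nonneg_of_nonpos (a := (9 / 4 : ℝ) ^ (N + 1)) (by positivity) (not_lt.1 h)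
    linarith [hN b]
  obtain ⟨j, h1, h2⟩ := exists_generation h0 hx
  rw [branchingPhase_eq hn hb hp.2 (hN b) h1 h2]
  have hlt : ∀ᶠ δ in nhdsWithin (0 : ℝ) (Set.Ioi 0), δ ∈ Set.Ioc (0 : ℝ) (1 / 8) :=
    Ioc_mem_nhdsGT (by norm_num)
  filter_upwards [eventually_d2_add hn N hp.2 hirr hx (hN b) h1 h2, hlt] with δ hδ hδ1
  rw [← hδ, pderiv_one_one_branching hδ1.1 hδ1.2]
  cases b
  · simp only [sideDist, Bool.false_eq_true, if_false]
  · simp only [sideDist, if_true, sub_sub_cancel]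
    exact add_comm _ _

theorem exists_lintegral_misfit_le : ∃ C : ℝ, 0 ≤ C ∧ ∀ n N : ℕ, 0 < n → ∃ δ, 0 < δ ∧ δ ≤ 1 / 8 ∧
    ∫⁻ p in unitSquare, ENNReal.ofReal
      ((pderiv 1 (pderiv 1 (branching δ n N)) p - (1 - 2 * branchingPhase n N p)) ^ 2) ≤
        ENNReal.ofReal (C * (4 / 9) ^ N) := by
  obtain ⟨K, hK0, hK⟩ := exists_bound_d2_profile
  refine ⟨1 + 4 * (2 * K + 1) ^ 2, by positivity, fun n N hn => ?_⟩
  set F : ℝ → Plane → ℝ≥0∞ := fun δ p => ENNReal.ofReal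
    ((pderiv 1 (pderiv 1 (branching δ n N)) p - (1 - 2 * branchingPhase n N p)) ^ 2) with hF
  set τ : ℝ := 2 * (4 / 9) ^ (N + 1) with hτ
  set B : Set Plane := {p | sideDist false (p 0) ≤ τ} ∪ {p | sideDist true (p 0) ≤ τ} with hB
  have hBm : MeasurableSet B :=
    (measurableSet_setOf_sideDist_le _ _).union (measurableSet_setOf_sideDist_le _ _)
  have hbound : ∀ δ, 0 < δ → δ ≤ 1 / 8 → ∀ᵐ p ∂volume.restrict unitSquare,
      F δ p ≤ ENNReal.ofReal ((2 * K + 1) ^ 2) := by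
    intro δ hδ hδ1
    filter_upwards [ae_restrict_mem measurableSet_unitSquare,
      ae_restrict_of_ae ae_irrational_coord_one] with p hp hirr
    rw [unitSquare_eq_box] at hp
    refine ENNReal.ofReal_le_ofReal (sq_le_sq.2 ?_)
    rw [pderiv_one_one_branching hδ hδ1, abs_of_nonneg (by positivity : 0 ≤ 2 * K + 1)]
    refine (abs_sub _ _).trans ?_
    rw [abs_one_sub_two_mul_branchingPhase]
    have h1 := abs_d2_layers_right_le hδ hδ1 (hK δ hδ) hK0 hn N (3 * p 0) hp.2 hirr
    have h2 := abs_d2_layers_right_le hδ hδ1 (hK δ hδ) hK0 hn N (3 - 3 * p 0) hp.2 hirr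
    linarith [abs_add_le (d2 (fun y => layers δ n N (3 * p 0) y) (p 1))
      (d2 (fun y => layers δ n N (3 - 3 * p 0) y) (p 1))]
  set d : ℕ → ℝ := fun k => 1 / 8 / (k + 1) with hd
  have hd0 : ∀ k, 0 < d k := fun k => by positivity
  have hd1 : ∀ k, d k ≤ 1 / 8 := fun k => div_le_self (by norm_num) (by
    have : (0 : ℝ) ≤ k := Nat.cast_nonneg k
    linarith)
  have hdlim : Filter.Tendsto d Filter.atTop (nhdsWithin 0 (Set.Ioi 0)) := by
    refine tendsto_nhdsWithin_iff.2 ⟨?_, Filter.Eventually.of_forall hd0⟩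
    have := (tendsto_one_div_add_atTop_nhds_zero_nat (𝕜 := ℝ)).const_mul (1 / 8)
    rw [mul_zero] at this
    exact this.congr fun k => by simp only [hd]; ring
  have hχ : AEMeasurable (branchingPhase n N) (volume.restrict unitSquare) :=
    (branchingPhase_mem hn N).1.aestronglyMeasurable.aemeasurable
  have hFm : ∀ δ, 0 < δ → δ ≤ 1 / 8 → AEMeasurable (F δ) (volume.restrict unitSquare) := by
    intro δ hδ hδ1
    have hw := contDiff_pderiv (contDiff_pderiv (isTest_branching hδ hδ1 n N).1 1) 1
    exact ENNReal.measurable_ofReal.comp_aemeasurable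
      ((hw.continuous.measurable.aemeasurable.sub ((hχ.const_mul 2).const_sub 1)).pow_const 2)
  have hlim : Filter.Tendsto (fun k => ∫⁻ p in Bᶜ, F (d k) p ∂volume.restrict unitSquare)
      Filter.atTop (nhds 0) := by
    have h := tendsto_lintegral_of_dominated_convergence' (μ := (volume.restrict unitSquare).restrict Bᶜ)
      (F := fun k => F (d k)) (f := fun _ => 0)
      (fun _ => ENNReal.ofReal ((2 * K + 1) ^ 2))
      (fun k => (hFm _ (hd0 k) (hd1 k)).restrict)
      (fun k => ae_restrict_of_ae (hbound _ (hd0 k) (hd1 k))) ?_ ?_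
    · simpa using h
    · rw [lintegral_const]
      exact ENNReal.mul_ne_top ENNReal.ofReal_ne_top (measure_ne_top _ _)
    · filter_upwards [ae_restrict_mem hBm.compl,
        ae_restrict_of_ae (ae_restrict_mem measurableSet_unitSquare),
        ae_restrict_of_ae (ae_restrict_of_ae ae_irrational_coord_one)] with p hpB hp hirr
      refine tendsto_const_nhds.congr' ?_
      have hN : ∀ b, 2 ≤ (9 / 4) ^ (N + 1) * sideDist b (p 0) := by
        have h1 : (9 / 4 : ℝ) ^ (N + 1) * (4 / 9) ^ (N + 1) = 1 := by rw [← mul_pow]; norm_num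
        have h2 : ∀ b, τ ≤ sideDist b (p 0) := by
          intro b
          by_contra h
          refine hpB ?_
          cases b
          · exact Or.inl (not_le.1 h).le
          · exact Or.inr (not_le.1 h).le
        intro b
        calc (2 : ℝ) = (9 / 4) ^ (N + 1) * τ := by rw [hτ, mul_left_comm, h1, mul_one]
          _ ≤ _ := mul_le_mul_of_nonneg_left (h2 b) (by positivity)
      filter_upwards [hdlim.eventually (eventually_pderiv_one_one_branching hn N hp hirr hN)]
        with k hk
      simp [hF, hk]
  have hpos : (0 : ℝ≥0∞) < ENNReal.ofReal ((4 / 9) ^ N) := ENNReal.ofReal_pos.2 (by positivity)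
  obtain ⟨k, hk⟩ := (hlim.eventually_le_const hpos).exists
  refine ⟨d k, hd0 k, hd1 k, ?_⟩
  have hbad : ∫⁻ p in B, F (d k) p ∂volume.restrict unitSquare ≤
      ENNReal.ofReal ((2 * K + 1) ^ 2 * (2 * τ)) := by
    calc _ ≤ ∫⁻ _ in B, ENNReal.ofReal ((2 * K + 1) ^ 2) ∂volume.restrict unitSquare :=
          lintegral_mono_ae (ae_restrict_of_ae (hbound _ (hd0 k) (hd1 k)))
      _ = ENNReal.ofReal ((2 * K + 1) ^ 2) * volume.restrict unitSquare B := setLIntegral_const _ _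
      _ ≤ ENNReal.ofReal ((2 * K + 1) ^ 2) * ENNReal.ofReal (2 * τ) := by
          refine mul_le_mul_right ?_ _
          have hτ0 : 0 ≤ τ := by positivity
          refine (measure_union_le _ _).trans ((add_le_add (volume_setOf_sideDist_le _ hτ0)
            (volume_setOf_sideDist_le _ hτ0)).trans (le_of_eq ?_))
          rw [← ENNReal.ofReal_add hτ0 hτ0, two_mul]
      _ = _ := (ENNReal.ofReal_mul (by positivity)).symm
  rw [← lintegral_add_compl _ hBm]
  refine (add_le_add hbad hk).trans ?_
  rw [← ENNReal.ofReal_add (by positivity) (by positivity)]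
  refine ENNReal.ofReal_le_ofReal ?_
  have h4 : (0 : ℝ) ≤ (2 * K + 1) ^ 2 * (4 / 9) ^ N := by positivity
  rw [hτ, pow_succ (4 / 9 : ℝ)]
  linarith

theorem four_ninths_pow_le {n : ℕ} (hn : 0 < n) : (4 / 9 : ℝ) ^ (4 * n) ≤ ((n : ℝ) ^ 4)⁻¹ := by
  have h1 : (n : ℝ) ≤ 2 ^ n := by exact_mod_cast n.lt_two_pow_self.le
  have h2 : (2 : ℝ) ^ n ≤ (9 / 4) ^ n := pow_le_pow_left₀ (by norm_num) (by norm_num) n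
  rw [mul_comm, pow_mul, show (4 / 9 : ℝ) = (9 / 4)⁻¹ by norm_num, inv_pow, inv_pow]
  exact inv_anti₀ (by positivity) (pow_le_pow_left₀ (by positivity) (h1.trans h2) 4)

theorem exists_minEnergy_le_of_branching {α : ℝ} (hα : α ^ 2 ≤ 1) : ∃ C : ℝ, 0 < C ∧
    ∀ n : ℕ, 0 < n → ∀ ε, 0 < ε →
      minEnergy unitSquare 1 α ε ≤ ENNReal.ofReal (C * ((n : ℝ) ^ 4)⁻¹ + C * (ε * n)) := by
  obtain ⟨C₁, hC₁, hbend⟩ := lintegral_sq_pderiv_zero_zero_branching_le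
  obtain ⟨C₂, hC₂, hmis⟩ := exists_lintegral_misfit_le
  refine ⟨C₁ + C₂ + 76, by positivity, fun n hn ε hε => ?_⟩
  obtain ⟨δ, hδ, hδ1, hm⟩ := hmis n (4 * n) hn
  have hw := isTest_branching hδ hδ1 n (4 * n)
  refine (minEnergy_le_of_potential α ε hw
    (fun x hx => branching_eq_zero hδ hδ1 _ _ fun h => hx (subset_closure h))
    (branchingPhase_mem hn (4 * n))).trans ?_
  have hn1 : (1 : ℝ) ≤ n := by exact_mod_cast hn
  have hel : (∫⁻ x in unitSquare, ENNReal.ofReal (α ^ 2 *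
      (pderiv 0 (pderiv 0 (branching δ n (4 * n))) x ^ 2 +
        (pderiv 1 (pderiv 1 (branching δ n (4 * n))) x -
          (1 - 2 * branchingPhase n (4 * n) x)) ^ 2))) ≤
      ENNReal.ofReal (C₁ * ((n : ℝ) ^ 4)⁻¹) + ENNReal.ofReal (C₂ * ((n : ℝ) ^ 4)⁻¹) := by
    have hmeas : Measurable fun x => ENNReal.ofReal
        (pderiv 0 (pderiv 0 (branching δ n (4 * n))) x ^ 2) :=
      ENNReal.measurable_ofReal.comp
        ((contDiff_pderiv (contDiff_pderiv hw.1 0) 0).continuous.pow 2).measurable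
    calc _ ≤ ∫⁻ x in unitSquare, (ENNReal.ofReal
            (pderiv 0 (pderiv 0 (branching δ n (4 * n))) x ^ 2) + ENNReal.ofReal
            ((pderiv 1 (pderiv 1 (branching δ n (4 * n))) x -
              (1 - 2 * branchingPhase n (4 * n) x)) ^ 2)) := by
          refine lintegral_mono fun x => ?_
          dsimp only
          rw [← ENNReal.ofReal_add (sq_nonneg _) (sq_nonneg _)]
          exact ENNReal.ofReal_le_ofReal (mul_le_of_le_one_left (by positivity) hα)
      _ = _ := lintegral_add_left hmeas _
      _ ≤ _ := add_le_add (hbend δ hδ hδ1 n _ hn) (hm.trans (ENNReal.ofReal_le_ofReal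
            (mul_le_mul_of_nonneg_left (four_ninths_pow_le hn) hC₂)))
  have htv : ENNReal.ofReal ε * totalVariation unitSquare (branchingPhase n (4 * n)) ≤
      ENNReal.ofReal (76 * (ε * n)) := by
    refine (mul_le_mul_right (totalVariation_branchingPhase_le hn _) _).trans ?_
    rw [← ENNReal.ofReal_mul hε.le]
    refine ENNReal.ofReal_le_ofReal ?_
    push_cast
    nlinarith
  refine (add_le_add hel htv).trans ?_
  have hn4 : 0 ≤ ((n : ℝ) ^ 4)⁻¹ := by positivity
  have hεn : 0 ≤ ε * n := by positivity
  rw [← ENNReal.ofReal_add (by positivity) (by positivity),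
    ← ENNReal.ofReal_add (by positivity) (by positivity)]
  refine ENNReal.ofReal_le_ofReal ?_
  have h1 : 0 ≤ C₁ * (ε * n) := by positivity
  have h2 : 0 ≤ C₂ * (ε * n) := by positivity
  linarith

theorem exists_minEnergy_le {α : ℝ} (hα : α ^ 2 ≤ 1) : ∃ C : ℝ, 0 < C ∧ ∀ ε, 0 < ε → ε ≤ 1 →
    minEnergy unitSquare 1 α ε ≤ ENNReal.ofReal (C * ε ^ (4 / 5 : ℝ)) := by
  obtain ⟨C, hC, h⟩ := exists_minEnergy_le_of_branching hα
  refine ⟨3 * C, by positivity, fun ε hε hε1 => ?_⟩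
  set r : ℝ := ε ^ (1 / 5 : ℝ) with hr
  have hr0 : 0 < r := Real.rpow_pos_of_pos hε _
  have hr1 : r ≤ 1 := Real.rpow_le_one hε.le hε1 (by norm_num)
  have hr4 : ε ^ (4 / 5 : ℝ) = r ^ 4 := by
    rw [hr, ← Real.rpow_natCast, ← Real.rpow_mul hε.le]; norm_num
  have hr5 : ε = r ^ 5 := by
    rw [hr, ← Real.rpow_natCast, ← Real.rpow_mul hε.le]; norm_num
  have hinv : 1 ≤ r⁻¹ := (one_le_inv₀ hr0).2 hr1
  set n := ⌈r⁻¹⌉₊ with hn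
  have hn0 : 0 < n := Nat.ceil_pos.2 (by positivity)
  have hle : r⁻¹ ≤ n := Nat.le_ceil _
  have hlt : (n : ℝ) < r⁻¹ + 1 := Nat.ceil_lt_add_one (by positivity)
  refine (h n hn0 ε hε).trans (ENNReal.ofReal_le_ofReal ?_)
  rw [hr4]
  have h1 : ((n : ℝ) ^ 4)⁻¹ ≤ r ^ 4 := by
    rw [← inv_pow]
    exact pow_le_pow_left₀ (by positivity) (inv_le_of_inv_le₀ hr0 hle) 4
  have h2 : ε * n ≤ 2 * r ^ 4 := by
    calc ε * n ≤ r ^ 5 * (2 * r⁻¹) := by rw [hr5]; gcongr; linarith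
      _ = _ := by field_simp
  nlinarith

end SymGradTwoWell

theorem proposition3p6 (α : ℝ) (hα₀ : 0 < α) (hα₁ : α < 1) :
    ∃ ε₀ : ℝ, 0 < ε₀ ∧ ∃ c : ℝ, 0 < c ∧ ∃ C : ℝ, 0 < C ∧
      ∀ ε : ℝ, 0 < ε → ε < ε₀ →
        ENNReal.ofReal (c * ε ^ (4 / 5 : ℝ)) ≤
            SymGradTwoWell.minEnergy SymGradTwoWell.unitSquare 1 α ε ∧
          SymGradTwoWell.minEnergy SymGradTwoWell.unitSquare 1 α ε ≤
            ENNReal.ofReal (C * ε ^ (4 / 5 : ℝ)) := by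
  obtain ⟨C, hC, h⟩ := SymGradTwoWell.exists_minEnergy_le (α := α) (by nlinarith)
  refine ⟨(1 / 256) ^ 5, by norm_num, min (α ^ 2 / 512) (1 / 16),
    lt_min (by positivity) (by norm_num), C, hC, fun ε hε hε1 =>
      ⟨SymGradTwoWell.minEnergy_ge hα₀ hε hε1.le, h ε hε (hε1.le.trans (by norm_num))⟩⟩
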